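/- **Setting.** There are $n$ clients, client $i$ holding $r$ data points $x_{i1},\dots,x_{ir}$; put $M=nr$. Let $1\le s\le r$, $1\le k\le n$, $N=ns$, $B=ks$, $\gamma=B/M$. Let $\mathcal G\subset\mathbb R^d$ be nonempty, closed and convex, $\theta_0\in\mathcal G$, $\ell$ a loss function, $L>0$ a clipping bound, $\varepsilon_0>0$, $\eta_1,\eta_2,\dots$ step sizes. In iteration $t=1,\dots,T$ of Camel, every client chooses a uniformly random set of $s$ of its data points, computes the gradients $\nabla_\theta\ell(\theta_{t-1},x_{ij})$ of the chosen points, clips each to $g/\max\{1,\|g\|_2/L\}$, and perturbs and compresses each: the clipped gradient $x$ is rounded to $\bar x=\pm L x/\|x\|_2$, with sign $+$ with probability $\frac12+\frac{\|x\|_2}{2L}$; a random seed is drawn and expanded by a generator to a vector $v\in\mathbb R^d$; with $U\sim\mathrm{Bernoulli}(\frac{e^{\varepsilon_0}}{e^{\varepsilon_0}+1})$ the client sends the seed together with the sign bit $2U-1$ if $\langle v,\bar x\rangle\ge 0$ and $-(2U-1)$ otherwise. The $N$ compressed gradients are shuffled by a uniformly random permutation, and the first $B$ of them are revealed. Each is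 decompressed to $\pm R\,v/\|v\|_2$, where $R=L\frac{\sqrt\pi}{2}\frac{d\,\Gamma(\frac{d-1}2+1)}{\Gamma(\frac d2+1)}\frac{e^{\varepsilon_0}+1}{e^{\varepsilon_0}-1}$; with $\bar g^t$ the average of these $B$ vectors, $\theta_t=\Pi_{\mathcal G}(\theta_{t-1}-\eta_t\bar g^t)$, where $\Pi_{\mathcal G}$ is the projection onto $\mathcal G$. Datasets are neighbouring if they differ in exactly one data point. **(i) Privacy.** For all $E>0$ and $\delta_1\in(0,1)$ there is a constant $C$, depending only on $E$ and $\delta_1$, such that the following holds for every loss function, every distribution of the seeds and every (measurable) generator, and all $0<\varepsilon_0\le E$ and $0<\tilde\delta\le\delta_1$. Let $$\tilde\varepsilon=C\min\{\varepsilon_0,1\}e^{\varepsilon_0}\sqrt{\frac{\log(1/\tilde\delta)}{\gamma M}},\qquad \varepsilon(\lambda)=\frac{\lambda\log^2\!\big(1+\gamma(e^{\tilde\varepsilon}-1)\big)}{2}.$$ Each iteration (at any current model, with the $B$ revealed compressed gradients as output) is $(\lambda,\varepsilon(\lambda))$-RDP for every $\lambda>1$. For all $T\ge1$ and $\delta\in(0,1)$,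 the minimum $$\varepsilon=\min_{\lambda>1}\Big(T\varepsilon(\lambda)+\log(1-1/\lambda)+\frac{\log(1/\delta)-\log\lambda}{\lambda-1}\Big)$$ is attained, and the whole process of $T$ iterations (with all revealed compressed gradients and the final model as output) is $(\varepsilon,\delta)$-DP. **(ii) Communication.** Let the seeds be elements of $\mathbb Z_p$, $p$ prime, so that a compressed gradient has $\lceil\log_2p\rceil+1$ bits; for transmission it is padded to $l\ge2$ elements of $\mathbb Z_p$. In Camel each client secret-shares each compressed gradient, with a Carter–Wegman tag and a MAC key, between two servers; three servers run the secret-shared shuffle with its blind MAC verifications (using Beaver triples and $\kappa$-bit hashes), and two of them reconstruct the first $B$ entries and compare hashes. There is an absolute constant $C$ such that, in each iteration, processing the $N$ compressed gradients takes at most $C\,l(\lceil\log_2p\rceil+1)\,N$ bits of client–server communication (the broadcast of the new model not counted) and at most $C\,(l(\lceil\log_2p\rceil+1)+\kappa)\,N$ bits of inter-server communication; thus both are $O(N)$, independently of $d$. **(iii) Convergence.** Let $d\ge1$, and suppose that the generator is ideal, i.e. $v/\|v\|_2$ is uniformly distributed on the unit sphere of $\mathbb R^d$ for a random seed. Let $\mathcal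 G$ be bounded with diameter $D$, and for each data point $x$ let $\ell(\cdot,x)$ be convex on $\mathcal G$, differentiable at every point of $\mathcal G$, and $L$-Lipschitz on an open set containing $\mathcal G$. Let $F(\theta)=\frac1n\sum_{i=1}^n\frac1r\sum_{j=1}^r\ell(\theta,x_{ij})$, let $\theta^*$ minimize $F$ over $\mathcal G$, and let $\eta_t=\frac{D}{G\sqrt t}$ with $G=L\sqrt{1+\frac{14d}{\gamma M}\big(\frac{e^{\varepsilon_0}+1}{e^{\varepsilon_0}-1}\big)^2}$. Put $A=\sqrt{\frac{14d}{\gamma M}}\,\frac{e^{\varepsilon_0}+1}{e^{\varepsilon_0}-1}$. Then there is an absolute constant $C$ such that for every $T>1$, $F(\theta_T)$ is integrable and $$\mathbb E[F(\theta_T)]-F(\theta^*)\le C\,\frac{LD\log T}{\sqrt T}\,(1+A).$$ In particular, for every $c_0>0$ there is a constant $C'$ depending only on $c_0$ such that, whenever $A\ge c_0$, $$\mathbb E[F(\theta_T)]-F(\theta^*)\le C'\,\frac{LD\log T}{\sqrt T}\sqrt{\frac{14d}{\gamma M}}\,\frac{e^{\varepsilon_0}+1}{e^{\varepsilon_0}-1}.$$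 -/

import Mathlib

open MeasureTheory ProbabilityTheory
open scoped unitInterval

universe u v

namespace Camel

noncomputable section

/-! ### Differential privacy and Rényi differential privacy -/

/-- `n` clients, each holding `r` data points. -/
abbrev Dataset (n r : ℕ) (X : Type u) : Type u := Fin n → Fin r → X

/-- Two datasets are neighbouring if they differ in exactly one data point. -/
def Neighboring {n r : ℕ} {X : Type u} (D D' : Dataset n r X) : Prop :=
  ∃ i j, D i j ≠ D' i j ∧ ∀ i' j', (i', j') ≠ (i, j) → D i' j' = D' i' j'

/-- `(ε, δ)`-DP of a mechanism, given by the law of its output on each dataset. -/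
def IsDP {n r : ℕ} {X : Type u} {Y : Type v} [MeasurableSpace Y] (ε δ : ℝ)
    (mech : Dataset n r X → Measure Y) : Prop :=
  ∀ D D', Neighboring D D' → ∀ A : Set Y, MeasurableSet A →
    mech D A ≤ ENNReal.ofReal (Real.exp ε) * mech D' A + ENNReal.ofReal δ

open Classical in
/-- The Rényi divergence `D_α(P ‖ Q) = (α - 1)⁻¹ log E_Q[(dP/dQ)^α]` of order `α > 1`;
it is `∞` unless `P ≪ Q`. -/
def renyiDiv {Y : Type v} [MeasurableSpace Y] (α : ℝ) (P Q : Measure Y) : EReal :=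
  if P ≪ Q then
    (((α - 1)⁻¹ : ℝ) : EReal) * ENNReal.log (∫⁻ y, (P.rnDeriv Q y) ^ α ∂Q)
  else ⊤

/-- `(α, ε)`-RDP. -/
def IsRDP {n r : ℕ} {X : Type u} {Y : Type v} [MeasurableSpace Y] (α ε : ℝ)
    (mech : Dataset n r X → Measure Y) : Prop :=
  ∀ D D', Neighboring D D' → renyiDiv α (mech D) (mech D') ≤ (ε : EReal)

/-! ### Local perturbation, compression and decompression of a gradient -/

/-- The parameter space `ℝ^d` with the Euclidean norm. -/
abbrev Vec (d : ℕ) : Type := EuclideanSpace ℝ (Fin d)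

/-- A compressed noisy gradient: a sign bit (`true` is `+1`, `false` is `-1`) and a seed. -/
abbrev Compressed (S : Type v) : Type v := Bool × S

/-- The local randomness used to perturb one gradient: two independent uniform variables on
`[0,1]`, one for the randomized rounding and one for the Bernoulli variable `U`, and a seed. -/
abbrev LocalCoins (S : Type v) : Type v := I × I × S

/-- Gradient clipping `g / max {1, ‖g‖ / L}`. -/
def clip {d : ℕ} (L : ℝ) (g : Vec d) : Vec d := (max 1 (‖g‖ / L))⁻¹ • g

/-- Randomized rounding of `x` to the sphere of radius `L`: `L x / ‖x‖` with probability
`1/2 + ‖x‖ / (2L)` and `- L x / ‖x‖` otherwise. -/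
def roundToSphere {d : ℕ} (L : ℝ) (a : I) (x : Vec d) : Vec d :=
  if (a : ℝ) ≤ 1 / 2 + ‖x‖ / (2 * L) then (L / ‖x‖) • x else -((L / ‖x‖) • x)

/-- The Bernoulli variable `U`, equal to `1` with probability `e^ε₀ / (e^ε₀ + 1)`. -/
def keepSign (ε₀ : ℝ) (b : I) : Bool :=
  decide ((b : ℝ) ≤ Real.exp ε₀ / (Real.exp ε₀ + 1))

/-- Perturbation and compression. The seed is expanded to the vector `v = expand seed`; the
perturbed direction is `(2U - 1) v` or `-(2U - 1) v`, according to whether `⟨v, x̄⟩ ≥ 0` or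
`⟨v, x̄⟩ < 0`, where `x̄` is the rounded input. The sign in front of `v` and the seed are sent. -/
def noisyGradCmpr {d : ℕ} {S : Type v} (expand : S → Vec d) (ε₀ L : ℝ) (c : LocalCoins S)
    (x : Vec d) : Compressed S :=
  (if inner ℝ (expand c.2.2) (roundToSphere L c.1 x) < 0 then !(keepSign ε₀ c.2.1)
    else keepSign ε₀ c.2.1, c.2.2)

/-- The length of a decompressed vector. -/
def radius (d : ℕ) (ε₀ L : ℝ) : ℝ :=
  L * (√Real.pi / 2) * (d * Real.Gamma (((d : ℝ) - 1) / 2 + 1) / Real.Gamma ((d : ℝ) / 2 + 1)) *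
    ((Real.exp ε₀ + 1) / (Real.exp ε₀ - 1))

/-- Decompression: re-expand the seed, normalize, rescale and apply the sign. -/
def noisyGradDcmp {d : ℕ} {S : Type v} (expand : S → Vec d) (ε₀ L : ℝ) (m : Compressed S) :
    Vec d :=
  (if m.1 then (1 : ℝ) else -1) • radius d ε₀ L • (‖expand m.2‖⁻¹ • expand m.2)

/-- The uniform distribution on the unit sphere of `ℝ^d`, as a measure on `ℝ^d`. -/
def uniformSphere (d : ℕ) : Measure (Vec d) :=
  ((volume : Measure (Vec d)).toSphere Set.univ)⁻¹ •
    ((volume : Measure (Vec d)).toSphere.map Subtype.val)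

/-- The idealization of the pseudorandom generator: for a seed drawn from `seedLaw`, the
direction of the expanded vector is uniformly distributed on the unit sphere. -/
def IsIdealPRG {d : ℕ} {S : Type v} [MeasurableSpace S] (seedLaw : Measure S)
    (expand : S → Vec d) : Prop :=
  seedLaw.map (fun seed => ‖expand seed‖⁻¹ • expand seed) = uniformSphere d

/-! ### The training process -/

/-- The set of `s` data points which a client selects among its `r` data points. -/
def ClientSample (r s : ℕ) : Type := {U : Finset (Fin r) // U.card = s}

instance (r s : ℕ) : MeasurableSpace (ClientSample r s) := ⊤

instance (N : ℕ) : MeasurableSpace (Equiv.Perm (Fin N)) := ⊤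

/-- The randomness of one iteration: the selections of the clients, the permutation used in the
shuffle of all `n * s` compressed gradients, and the perturbation coins. -/
abbrev Round (n r s : ℕ) (S : Type v) : Type v :=
  (Fin n → ClientSample r s) × Equiv.Perm (Fin (n * s)) × (Fin n → Fin s → LocalCoins S)

/-- Selections and permutation are uniform, seeds follow `seedLaw`, all independent. -/
def roundMeasure (n r s : ℕ) {S : Type v} [MeasurableSpace S] (seedLaw : Measure S) :
    Measure (Round n r s S) :=
  (Measure.pi fun _ => uniformOn Set.univ).prod
    ((uniformOn Set.univ).prod
      (Measure.pi fun _ => Measure.pi fun _ => volume.prod (volume.prod seedLaw)))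

/-- The parameters of a training task (data only): loss function, feasible set, clipping
parameter, LDP level, step sizes (`stepSize t` is used in the `t`-th iteration, `t = 1, 2, …`),
initial model, distribution of the seeds, and expansion of the seeds. -/
structure Task (d : ℕ) (X : Type u) (S : Type v) [MeasurableSpace S] where
  loss : Vec d → X → ℝ
  feasible : Set (Vec d)
  L : ℝ
  ε₀ : ℝ
  stepSize : ℕ → ℝ
  init : Vec d
  seedLaw : Measure S
  expand : S → Vec d

/-- The projection onto `K`: the point of `K` nearest to `x`. -/
def proj {d : ℕ} (K : Set (Vec d)) (x : Vec d) : Vec d :=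
  Classical.epsilon fun y => y ∈ K ∧ ∀ z ∈ K, dist x y ≤ dist x z

section Training

variable {d n r k s : ℕ} {X : Type u} {S : Type v} [MeasurableSpace S]

/-- The compressed noisy gradient of the `a`-th data point selected by client `i`, at model `θ`. -/
def clientMessage (task : Task d X S) (D : Dataset n r X) (θ : Vec d) (ρ : Round n r s S)
    (i : Fin n) (a : Fin s) : Compressed S :=
  noisyGradCmpr task.expand task.ε₀ task.L (ρ.2.2 i a)
    (clip task.L
      (gradient (fun θ' => task.loss θ' (D i ((ρ.1 i).1.orderEmbOfFin (ρ.1 i).2 a))) θ))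

/-- The `N = n * s` compressed gradients of all clients, in one vector. -/
def allMessages (task : Task d X S) (D : Dataset n r X) (θ : Vec d) (ρ : Round n r s S)
    (q : Fin (n * s)) : Compressed S :=
  clientMessage task D θ ρ (finProdFinEquiv.symm q).1 (finProdFinEquiv.symm q).2

/-- The first `B = k * s` compressed gradients of the shuffled vector, which are reconstructed. -/
def revealed (hk : k ≤ n) (task : Task d X S) (D : Dataset n r X) (θ : Vec d)
    (ρ : Round n r s S) : Fin (k * s) → Compressed S :=
  fun b => allMessages task D θ ρ (ρ.2.1 (Fin.castLE (Nat.mul_le_mul_right s hk) b))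

/-- The model update of iteration `t`: a projected step along the average of the
decompressed gradients. -/
def update (task : Task d X S) (t : ℕ) (θ : Vec d) (m : Fin (k * s) → Compressed S) : Vec d :=
  proj task.feasible
    (θ - task.stepSize t •
      (((k * s : ℕ) : ℝ)⁻¹ • ∑ b, noisyGradDcmp task.expand task.ε₀ task.L (m b)))

/-- A single iteration at model `θ` as a mechanism: the law of the reconstructed gradients. -/
def iterationLaw (hk : k ≤ n) (s : ℕ) (task : Task d X S) (θ : Vec d) (D : Dataset n r X) :
    Measure (Fin (k * s) → Compressed S) :=
  (roundMeasure n r s task.seedLaw).map (revealed hk task D θ)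

/-- The joint law, after `T` iterations with fresh independent randomness, of all compressed
gradients which have been reconstructed and of the current model. -/
def runLaw (hk : k ≤ n) (s : ℕ) (task : Task d X S) (D : Dataset n r X) :
    (T : ℕ) → Measure ((Fin T → Fin (k * s) → Compressed S) × Vec d)
  | 0 => Measure.dirac (Fin.elim0, task.init)
  | T + 1 =>
    ((runLaw hk s task D T).prod (roundMeasure n r s task.seedLaw)).map fun z =>
      (Fin.snoc z.1.1 (revealed hk task D z.1.2 z.2),
        update task (T + 1) z.1.2 (revealed hk task D z.1.2 z.2))

/-- The empirical risk `F(θ) = (1/n) ∑ᵢ Fᵢ(θ)`, `Fᵢ(θ) = (1/r) ∑ⱼ ℓ(θ, xᵢⱼ)`. -/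
def risk (task : Task d X S) (D : Dataset n r X) (θ : Vec d) : ℝ :=
  (n : ℝ)⁻¹ * ∑ i, (r : ℝ)⁻¹ * ∑ j, task.loss θ (D i j)

end Training

/-- The total number of data points `M = n r`. -/
def totalPoints (n r : ℕ) : ℝ := (n : ℝ) * r

/-- The sampling rate `γ = B / M = k s / (n r)`. -/
def samplingRate (n r k s : ℕ) : ℝ := ((k : ℝ) * s) / totalPoints n r

/-- `C min {ε₀, 1} e^ε₀ √(log (1 / δ') / m)`: the privacy level after shuffling. -/
def shuffledEps (C ε₀ δ' m : ℝ) : ℝ :=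
  C * (min ε₀ 1 * Real.exp ε₀ * √(Real.log (1 / δ') / m))

/-- The RDP parameter of one iteration: `α log² (1 + γ (e^ε' - 1)) / 2`. -/
def iterationRDP (γ ε' α : ℝ) : ℝ :=
  α * (Real.log (1 + γ * (Real.exp ε' - 1))) ^ 2 / 2

/-- `T ε(α) + log (1 - 1/α) + (log (1/δ) - log α) / (α - 1)`. -/
def convertedEps (T : ℕ) (γ ε' δ α : ℝ) : ℝ :=
  T * iterationRDP γ ε' α + Real.log (1 - 1 / α) +
    (Real.log (1 / δ) - Real.log α) / (α - 1)

/-- `(e^ε₀ + 1) / (e^ε₀ - 1)`. -/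
def ldpFactor (ε₀ : ℝ) : ℝ := (Real.exp ε₀ + 1) / (Real.exp ε₀ - 1)

/-- The bound `L √(1 + (14 d / m) ((e^ε₀ + 1) / (e^ε₀ - 1))²)` used in the step sizes. -/
def gradBound (d : ℕ) (m L ε₀ : ℝ) : ℝ := L * √(1 + 14 * d / m * ldpFactor ε₀ ^ 2)

/-! ### The three-server protocol at the level of its messages

One iteration of the protocol with honest parties, as the list of all messages that are sent.
Clients secret-share authenticated compressed gradients between servers 1 and 2; the servers run
the secret-shared shuffle with its integrity checks, reconstruct the first `B` entries, and
compare digests. -/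

/-- Clients and the servers 1, 2, 3. -/
inductive Party (n : ℕ) : Type
  | client (i : Fin n)
  | server₁
  | server₂
  | server₃

/-- Whether a party is a server. -/
def Party.isServer {n : ℕ} : Party n → Bool
  | .client _ => false
  | _ => true

/-- A payload consists of elements of `ℤ/p`, of a `κ`-bit hash value, or of a model whose `d`
coordinates are represented by `e` bits each. -/
inductive Payload (p κ d e : ℕ) : Type
  | field (words : List (ZMod p))
  | hash (h : Fin κ → Bool)
  | model (θ : Fin d → Fin e → Bool)

/-- The number of bits of a seed in `ℤ/p`, or of any other element of `ℤ/p`. -/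
def seedBits (p : ℕ) : ℕ := Nat.clog 2 p

/-- The length of a payload in bits. -/
def Payload.bits {p κ d e : ℕ} : Payload p κ d e → ℕ
  | .field ws => ws.length * seedBits p
  | .hash _ => κ
  | .model _ => d * e

/-- Whether a payload is a model, sent from the servers to the clients for the next iteration. -/
def Payload.isModel {p κ d e : ℕ} : Payload p κ d e → Bool
  | .model _ => true
  | _ => false

/-- A message. -/
structure Msg (n p κ d e : ℕ) : Type where
  src : Party n
  dst : Party n
  payload : Payload p κ d e

/-- The components of a record: the tag, the `l` words of the compressed gradient, the `l` words
of the MAC key. -/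
inductive Slot (l : ℕ) : Type
  | tag
  | grad (j : Fin l)
  | key (j : Fin l)

/-- A record `(t, r, k)` of `2 l + 1` elements of `ℤ/p`. -/
abbrev Rec (p l : ℕ) : Type := Slot l → ZMod p

/-- A vector of `N` records. -/
abbrev Table (p l N : ℕ) : Type := Fin N → Rec p l

/-- The words of a record. -/
def Rec.words {p l : ℕ} (x : Rec p l) : List (ZMod p) :=
  x .tag :: ((List.finRange l).map (fun j => x (.grad j)) ++
    (List.finRange l).map (fun j => x (.key j)))

/-- The words of a vector of records. -/
def Table.words {p l N : ℕ} (x : Table p l N) : List (ZMod p) :=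
  (List.finRange N).flatMap fun q => Rec.words (x q)

/-- `π(v) = (v_{π(1)}, …, v_{π(N)})`. -/
def permute {N : ℕ} {α : Type*} (π : Equiv.Perm (Fin N)) (x : Fin N → α) : Fin N → α :=
  fun q => x (π q)

/-- A compressed gradient (a sign bit and a seed), padded to `l` words. -/
def encode {p : ℕ} (l : ℕ) (m : Compressed (ZMod p)) : Fin l → ZMod p :=
  fun j => if j.val = 0 then (if m.1 then 1 else 0) else if j.val = 1 then m.2 else 0

/-- A multiplication triple `(a, b, a b)` with the share of the first party. -/
structure Triple (p : ℕ) : Type where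
  (a b a₁ b₁ c₁ : ZMod p)

section Protocol

variable {n p κ d e l N : ℕ}

/-- The messages of one multiplication of shared values `x₁ + x₂` and `y₁ + y₂` by the parties
`P` and `Q`, with a triple provided by `R`. -/
def beaverMsgs (P Q R : Party n) (τ : Triple p) (x₁ x₂ y₁ y₂ : ZMod p) :
    List (Msg n p κ d e) :=
  [⟨R, P, .field [τ.a₁, τ.b₁, τ.c₁]⟩,
   ⟨R, Q, .field [τ.a - τ.a₁, τ.b - τ.b₁, τ.a * τ.b - τ.c₁]⟩,
   ⟨P, Q, .field [x₁ - τ.a₁, y₁ - τ.b₁]⟩,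
   ⟨Q, P, .field [x₂ - (τ.a - τ.a₁), y₂ - (τ.b - τ.b₁)]⟩]

/-- The resulting shares of the product. -/
def beaverShares (τ : Triple p) (x₁ x₂ y₁ y₂ : ZMod p) : ZMod p × ZMod p :=
  let ee := x₁ + x₂ - τ.a
  let ff := y₁ + y₂ - τ.b
  (ff * τ.a₁ + ee * τ.b₁ + τ.c₁,
    ee * ff + ff * (τ.a - τ.a₁) + ee * (τ.b - τ.b₁) + (τ.a * τ.b - τ.c₁))

/-- The randomness of one blind MAC verification: triples and shares of the random factor. -/
structure MacCoins (p l N : ℕ) : Type where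
  triples : Fin N → Fin l → Triple p
  last : Triple p
  w₁ : ZMod p
  w₂ : ZMod p

/-- Shares of `∑ tᵢ - ∑ᵢ ∑ⱼ kᵢ[j] rᵢ[j]`. -/
def macDefect (c : MacCoins p l N) (x₁ x₂ : Table p l N) : ZMod p × ZMod p :=
  let z := fun q j => beaverShares (c.triples q j)
    (x₁ q (.key j)) (x₂ q (.key j)) (x₁ q (.grad j)) (x₂ q (.grad j))
  (∑ q, x₁ q .tag - ∑ q, ∑ j, (z q j).1, ∑ q, x₂ q .tag - ∑ q, ∑ j, (z q j).2)

/-- Shares of the verification value `f`. -/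
def macValue (c : MacCoins p l N) (x₁ x₂ : Table p l N) : ZMod p × ZMod p :=
  beaverShares c.last c.w₁ c.w₂ (macDefect c x₁ x₂).1 (macDefect c x₁ x₂).2

/-- The messages of the blind MAC verification by `P` and `Q` of a shared table; hashes of the
shares of `f` are exchanged before the shares themselves. -/
def macMsgs (hash : List (ZMod p) → Fin κ → Bool) (P Q R : Party n) (c : MacCoins p l N)
    (x₁ x₂ : Table p l N) : List (Msg n p κ d e) :=
  ((List.finRange N).flatMap fun q => (List.finRange l).flatMap fun j =>
    beaverMsgs P Q R (c.triples q j)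
      (x₁ q (.key j)) (x₂ q (.key j)) (x₁ q (.grad j)) (x₂ q (.grad j))) ++
  beaverMsgs P Q R c.last c.w₁ c.w₂ (macDefect c x₁ x₂).1 (macDefect c x₁ x₂).2 ++
  [⟨P, Q, .hash (hash [(macValue c x₁ x₂).1])⟩,
   ⟨Q, P, .hash (hash [(macValue c x₁ x₂).2])⟩,
   ⟨P, Q, .field [(macValue c x₁ x₂).1]⟩,
   ⟨Q, P, .field [(macValue c x₁ x₂).2]⟩]

/-- The public deterministic functions: the generator of the MAC keys, the expansions of the
servers' seeds to permutations and to masks, and the hash function. -/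
structure Public (p κ l N : ℕ) : Type where
  keyGen : ZMod p → Fin l → ZMod p
  permGen : ZMod p → Equiv.Perm (Fin N)
  maskGen : ZMod p → Table p l N
  maskGen' : ZMod p → Table p l N
  hash : List (ZMod p) → Fin κ → Bool

/-- The randomness of the clients and servers in one iteration of the protocol. -/
structure ProtocolCoins (p l N : ℕ) : Type where
  /-- MAC key seeds of the clients, and the first shares of tags and gradients -/
  keySeed₁ : Fin N → ZMod p
  keySeed₂ : Fin N → ZMod p
  tagShare : Fin N → ZMod p
  gradShare : Fin N → Fin l → ZMod p
  /-- the servers' seeds -/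
  seed₁ : ZMod p
  seed₂ : ZMod p
  seed₁₂ : ZMod p
  /-- first shares in the two integrity checks during the shuffle -/
  shareA : Table p l N
  shareB : Table p l N
  shareC : Table p l N
  shareD : Table p l N
  /-- the three blind MAC verifications -/
  mac₁₃ : MacCoins p l N
  mac₂₃ : MacCoins p l N
  mac₁₂ : MacCoins p l N

/-- The Carter–Wegman tag `∑ⱼ k[j] r[j]` of an encoded gradient. -/
def clientTag (pub : Public p κ l N) (c : ProtocolCoins p l N)
    (x : Fin N → Compressed (ZMod p)) (q : Fin N) : ZMod p :=
  ∑ j, (pub.keyGen (c.keySeed₁ q) j + pub.keyGen (c.keySeed₂ q) j) * encode l (x q) j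

/-- The table of shares held by server 1. -/
def inputShare₁ (pub : Public p κ l N) (c : ProtocolCoins p l N) : Table p l N := fun q slot =>
  match slot with
  | .tag => c.tagShare q
  | .grad j => c.gradShare q j
  | .key j => pub.keyGen (c.keySeed₁ q) j

/-- The table of shares held by server 2. -/
def inputShare₂ (pub : Public p κ l N) (c : ProtocolCoins p l N)
    (x : Fin N → Compressed (ZMod p)) : Table p l N := fun q slot =>
  match slot with
  | .tag => clientTag pub c x q - c.tagShare q
  | .grad j => encode l (x q) j - c.gradShare q j
  | .key j => pub.keyGen (c.keySeed₂ q) j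

/-- The messages with which the clients secret-share their compressed gradients, tags and MAC
keys; `owner q` is the client that holds the `q`-th gradient. -/
def uploadMsgs (owner : Fin N → Fin n) (pub : Public p κ l N) (c : ProtocolCoins p l N)
    (x : Fin N → Compressed (ZMod p)) : List (Msg n p κ d e) :=
  (List.finRange N).flatMap fun q =>
    [⟨.client (owner q), .server₁,
      .field (c.keySeed₁ q :: inputShare₁ pub c q .tag ::
        (List.finRange l).map fun j => inputShare₁ pub c q (.grad j))⟩,
     ⟨.client (owner q), .server₂,
      .field (c.keySeed₂ q :: inputShare₂ pub c x q .tag ::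
        (List.finRange l).map fun j => inputShare₂ pub c x q (.grad j))⟩]

/-- The state of the secret-shared shuffle. -/
structure ShuffleState (p l N : ℕ) : Type where
  π₂ : Equiv.Perm (Fin N)
  /-- `a₁` -/
  mask : Table p l N
  /-- `π₂(π₁(a₁) + a₂')` -/
  corr : Table p l N
  /-- `Δ = π₂(π₁(a₁) + a₂') - b₂` -/
  Δ : Table p l N
  /-- `z₂ = ⟨x̂⟩₂ - a₁` -/
  z₂ : Table p l N
  /-- `x̂ - a₁ = z₂ + ⟨x̂⟩₁` -/
  masked : Table p l N
  /-- `z₁ = π₁(z₂ + ⟨x̂⟩₁) - a₂'` -/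
  z₁ : Table p l N
  /-- the output shares `⟨y⟩₁ = b₂` and `⟨y⟩₂ = π₂(z₁) + Δ` -/
  y₁ : Table p l N
  y₂ : Table p l N

/-- The values computed in the secret-shared shuffle of a shared table. -/
def shuffleState (pub : Public p κ l N) (c : ProtocolCoins p l N) (x₁ x₂ : Table p l N) :
    ShuffleState p l N :=
  let π₁ := pub.permGen c.seed₁
  let π₂ := pub.permGen c.seed₂
  let π₁₂ := pub.permGen c.seed₁₂
  let a₁ := pub.maskGen c.seed₂
  let a₂' := pub.maskGen c.seed₁
  let b₂ := pub.maskGen' c.seed₁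
  let corr := permute π₂ (permute π₁ a₁ + a₂')
  let z₂ := permute π₁₂ x₂ - a₁
  let masked := z₂ + permute π₁₂ x₁
  let z₁ := permute π₁ masked - a₂'
  { π₂ := π₂, mask := a₁, corr := corr, Δ := corr - b₂, z₂ := z₂, masked := masked, z₁ := z₁
    y₁ := b₂, y₂ := permute π₂ z₁ + (corr - b₂) }

/-- The messages of the maliciously secure secret-shared shuffle. -/
def shuffleMsgs (pub : Public p κ l N) (c : ProtocolCoins p l N) (x₁ x₂ : Table p l N) :
    List (Msg n p κ d e) :=
  let st := shuffleState pub c x₁ x₂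
  [⟨.server₁, .server₃, .field [c.seed₁]⟩,
   ⟨.server₂, .server₃, .field [c.seed₂]⟩,
   ⟨.server₁, .server₂, .field [c.seed₁₂]⟩,
   ⟨.server₃, .server₂, .field (Table.words st.Δ)⟩,
   ⟨.server₂, .server₁, .field (Table.words st.z₂)⟩,
   ⟨.server₁, .server₃, .field (Table.words (st.masked - c.shareA))⟩,
   ⟨.server₃, .server₁, .field (Table.words c.shareB)⟩] ++
  macMsgs pub.hash .server₁ .server₃ .server₂ c.mac₁₃
    (c.shareA + c.shareB) (st.masked - c.shareA + (st.mask - c.shareB)) ++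
  [⟨.server₁, .server₂, .field (Table.words st.z₁)⟩,
   ⟨.server₂, .server₃, .field (Table.words (permute st.π₂ st.z₁ - c.shareC))⟩,
   ⟨.server₃, .server₂, .field (Table.words c.shareD)⟩] ++
  macMsgs pub.hash .server₂ .server₃ .server₁ c.mac₂₃
    (c.shareC + c.shareD) (permute st.π₂ st.z₁ - c.shareC + (st.corr - c.shareD)) ++
  macMsgs pub.hash .server₁ .server₂ .server₃ c.mac₁₂ st.y₁ st.y₂

/-- The first `B` records of a table. -/
def Table.take {B : ℕ} (hB : B ≤ N) (x : Table p l N) : Table p l B :=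
  fun b => x (Fin.castLE hB b)

/-- The messages with which servers 1 and 2 reconstruct the first `B` records; hashes of the
shares are exchanged first. -/
def reconstructMsgs {B : ℕ} (hB : B ≤ N) (hash : List (ZMod p) → Fin κ → Bool)
    (y₁ y₂ : Table p l N) : List (Msg n p κ d e) :=
  [⟨.server₁, .server₂, .hash (hash (Table.words (Table.take hB y₁)))⟩,
   ⟨.server₂, .server₁, .hash (hash (Table.words (Table.take hB y₂)))⟩,
   ⟨.server₁, .server₂, .field (Table.words (Table.take hB y₁))⟩,
   ⟨.server₂, .server₁, .field (Table.words (Table.take hB y₂))⟩]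

/-- The messages with which servers 1 and 2 compare the digest of the new model and broadcast
the model to the clients. -/
def modelMsgs (digest : Fin κ → Bool) (θ : Fin d → Fin e → Bool) : List (Msg n p κ d e) :=
  [⟨.server₁, .server₂, .hash digest⟩, ⟨.server₂, .server₁, .hash digest⟩] ++
  (List.finRange n).flatMap fun i =>
    [⟨.server₁, .client i, .model θ⟩, ⟨.server₂, .client i, .model θ⟩]

/-- All messages of one iteration. -/
def iterationMsgs {k s : ℕ} (hk : k ≤ n) (pub : Public p κ l (n * s))
    (c : ProtocolCoins p l (n * s)) (x : Fin (n * s) → Compressed (ZMod p))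
    (digest : Fin κ → Bool) (θ : Fin d → Fin e → Bool) : List (Msg n p κ d e) :=
  let x₁ := inputShare₁ pub c
  let x₂ := inputShare₂ pub c x
  let st := shuffleState pub c x₁ x₂
  uploadMsgs (fun q => (finProdFinEquiv.symm q).1) pub c x ++
  shuffleMsgs pub c x₁ x₂ ++
  reconstructMsgs (Nat.mul_le_mul_right s hk) pub.hash st.y₁ st.y₂ ++
  modelMsgs digest θ

/-- The number of bits exchanged between clients and servers for processing the compressed
gradients, that is, in all messages other than the broadcast of the model. -/
def clientServerBits (ms : List (Msg n p κ d e)) : ℕ :=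
  ((ms.filter fun m => (m.src.isServer != m.dst.isServer) && !m.payload.isModel).map
    fun m => m.payload.bits).sum

/-- The number of bits exchanged between servers. -/
def interServerBits (ms : List (Msg n p κ d e)) : ℕ :=
  ((ms.filter fun m => m.src.isServer && m.dst.isServer).map fun m => m.payload.bits).sum

end Protocol

end

end Camel

namespace Camel

/-! ### Exponential moments of mixtures -/

/-! Privacy. The seeds have the same law on all datasets, so it suffices to bound, uniformly in the
seeds, the moments of the likelihood ratio `P / Q` of the revealed signs on two neighbouring
datasets. Every sign has probability at least `ζ / 2` with `ζ = 2 / (e^E + 1)`. Hence each message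
is, with probability `ζ`, a fair coin that ignores its data point (a clone). `P` and `Q` differ only
when the differing point `x` is revealed, which has probability `γ`. Given the set `J` of positions
occupied by `x` and by clones, `x` is equally likely to sit at each of them. Its effect is therefore
a mean over `J` of bounded functions of independent fair signs, of size about `|J|^(-1/2)`
(`sum_pinned_clone_expansion`, `sum_weight_cosh_le`). Since `|J| - 1` is binomial with mean `ζ (B -
1)`, averaging over `J` gives the sub-Gaussian scale `γ min {ε₀, 1} / √B` for `(P - Q) / Q`
(`binomial_exp_min_le`).

The denominator `Q` is not conditioned on revealing `x`. But exchanging two positions or two points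
alters at most two factors of a likelihood, each by a bounded ratio. So the part of `Q` in which `x`
is revealed is at most a constant times `γ Q` (`sum_revealed_le`). Joint convexity of the
perspective of `cosh - 1` then splits the moment over the mixture (`sum_perspective_mixture_le`,
`shuffle_cosh_moment_le`). The bound `(P / Q)^α ≤ exp (α (P - Q) / Q)` settles `α ≥ 2`, and Hölder
interpolation settles `1 < α < 2` (`sum_mixedLikelihood_rpow_le`). The stated RDP parameter is
larger for a suitable `C`, because `log (1 + γ (e^x - 1)) ≥ γ x`. Moments multiply along adaptive
iterations (`exists_density_runLaw`), and Young's inequality turns a moment into `(ε, δ)`-DP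
(`dp_of_renyiMoment_le`).

Communication. Nothing but counting: only the upload and the model broadcast cross between clients
and servers, and every server message consists of a bounded number of tables of `N (2 l + 1)` words,
of `N l` Beaver multiplications, or of finitely many words and hashes.

Convergence. On the sphere, `E[sign ⟨v, u⟩ v]` is a multiple of the unit vector `u`; the length `R`
undoes this factor and the sign flips, so decompression is unbiased
(`integral_inner_noisyGradDcmp`). Given selections and permutation, the revealed messages are
independent, so the averaged gradient has second moment at most `L² + R² / B ≤ G²`; each position
reveals a uniformly distributed data point, so its mean is the gradient of `F`. Projected stochastic
gradient descent with steps `D / (G √t)` then has the last-iterate rate `G D log T / √T`. This is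
obtained by comparing averages over the last iterates, with each earlier iterate `θ_m` itself used
as comparison point (`last_iterate_le`); that requires the joint law of `θ_m` and `θ_{m+j}`
(`pairLaw`). -/

lemma exp_le_one_add_add_cosh (y : ℝ) : Real.exp y ≤ 1 + y + 2 * (Real.cosh y - 1) := by
  have := Real.add_one_le_exp (-y)
  rw [Real.cosh_eq]; linarith

/-- The function `cosh - 1` replaces the exponential because it is even, nonnegative and vanishes at
`0`: the linear term of the exponential disappears anyway when two distributions of the same mass
are compared. -/
lemma convexOn_cosh_sub_one : ConvexOn ℝ Set.univ fun y : ℝ => Real.cosh y - 1 := by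
  refine ⟨convex_univ, fun x _ y _ a b ha hb hab => ?_⟩
  have h1 := convexOn_exp.2 (Set.mem_univ x) (Set.mem_univ y) ha hb hab
  have h2 := convexOn_exp.2 (Set.mem_univ (-x)) (Set.mem_univ (-y)) ha hb hab
  simp only [smul_eq_mul, Real.cosh_eq] at h1 h2 ⊢
  have e : a * -x + b * -y = -(a * x + b * y) := by ring
  rw [e] at h2
  linarith

lemma cosh_sub_one_nonneg (y : ℝ) : 0 ≤ Real.cosh y - 1 := by
  linarith [Real.one_le_cosh y]

lemma cosh_sub_one_mono {x y : ℝ} (h : |x| ≤ |y|) : Real.cosh x - 1 ≤ Real.cosh y - 1 := by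
  linarith [Real.cosh_le_cosh.2 h]

/-- The perspective of `cosh - 1` is antitone in its second argument. -/
lemma perspective_cosh_antitone (a : ℝ) {p q : ℝ} (hp : 0 < p) (hpq : p ≤ q) :
    q * (Real.cosh (a / q) - 1) ≤ p * (Real.cosh (a / p) - 1) := by
  have hq : 0 < q := hp.trans_le hpq
  -- Convexity between `a / p` and `0` with weight `p / q`; the value at `0` contributes nothing.
  have h := convexOn_cosh_sub_one.2 (Set.mem_univ (a / p)) (Set.mem_univ (0 : ℝ))
    (show 0 ≤ p / q by positivity) (show 0 ≤ 1 - p / q by rw [sub_nonneg, div_le_one hq]; exact hpq)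
    (by ring)
  simp only [smul_eq_mul, mul_zero, add_zero, Real.cosh_zero, sub_self] at h
  have e : p / q * (a / p) = a / q := by field_simp
  rw [e] at h
  calc q * (Real.cosh (a / q) - 1) ≤ q * (p / q * (Real.cosh (a / p) - 1)) := by gcongr
    _ = _ := by field_simp

/-- Joint convexity of the perspective of `cosh - 1`. -/
lemma perspective_cosh_sum_le {κ : Type*} [Fintype κ] (w A a : κ → ℝ) (hw : ∀ k, 0 ≤ w k)
    (hA : ∀ k, 0 < A k) (t : ℝ) (hT : 0 < ∑ k, w k * A k) :
    (∑ k, w k * A k) * (Real.cosh (t * (∑ k, w k * a k) / ∑ k, w k * A k) - 1) ≤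
      ∑ k, w k * (A k * (Real.cosh (t * a k / A k) - 1)) := by
  set T := ∑ k, w k * A k with hTdef
  -- Jensen's inequality for the probability weights `w A / T`, at the points `t a / A`.
  have h := convexOn_cosh_sub_one.map_sum_le (t := Finset.univ) (w := fun k => w k * A k / T)
    (p := fun k => t * a k / A k)
    (fun k _ => div_nonneg (mul_nonneg (hw k) (hA k).le) hT.le)
    (by rw [← Finset.sum_div, ← hTdef, div_self hT.ne']) (fun k _ => Set.mem_univ _)
  simp only [smul_eq_mul] at h
  have e : ∑ k, w k * A k / T * (t * a k / A k) = t * (∑ k, w k * a k) / T := by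
    rw [Finset.mul_sum, Finset.sum_div]
    refine Finset.sum_congr rfl fun k _ => ?_
    have := (hA k).ne'
    field_simp
  rw [e] at h
  calc T * (Real.cosh (t * (∑ k, w k * a k) / T) - 1)
      ≤ T * ∑ k, w k * A k / T * (Real.cosh (t * a k / A k) - 1) := by gcongr
    _ = _ := by
      rw [Finset.mul_sum]
      refine Finset.sum_congr rfl fun k _ => ?_
      field_simp

/-- Averages over sign vectors of products factorize. -/
lemma sum_bool_prod {ι : Type*} [Fintype ι] [DecidableEq ι] (f : ι → Bool → ℝ) :
    ∑ ω : ι → Bool, ∏ b, f b (ω b) = ∏ b, (f b true + f b false) := by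
  have := Finset.prod_univ_sum (fun _ : ι => (Finset.univ : Finset Bool)) f
  rw [Fintype.piFinset_univ] at this
  simp only [Fintype.sum_bool] at this
  exact this.symm

/-- The exponential moment of an average of signed coordinates in `J`, against a product
weight on the other coordinates. -/
lemma sum_weight_exp {ι : Type*} [Fintype ι] [DecidableEq ι] (J : Finset ι)
    (H : ι → Bool → ℝ) (hH : ∀ b, H b true + H b false = 1) (a : ι → Bool → ℝ) :
    ∑ ω : ι → Bool, (∏ b ∈ Jᶜ, H b (ω b)) * Real.exp (∑ b ∈ J, a b (ω b)) =
      ∏ b ∈ J, (Real.exp (a b true) + Real.exp (a b false)) := by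
  have h := sum_bool_prod fun b s => if b ∈ J then Real.exp (a b s) else H b s
  have h1 : ∀ ω : ι → Bool, (∏ b, if b ∈ J then Real.exp (a b (ω b)) else H b (ω b)) =
      (∏ b ∈ Jᶜ, H b (ω b)) * Real.exp (∑ b ∈ J, a b (ω b)) := by
    intro ω
    rw [Real.exp_sum, Finset.prod_ite, mul_comm]
    congr 1
    · refine Finset.prod_congr ?_ fun _ _ => rfl
      ext; simp
    · refine Finset.prod_congr ?_ fun _ _ => rfl
      ext; simp
  simp_rw [h1] at h
  rw [h, ← Finset.prod_subset (Finset.subset_univ J)]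
  · exact Finset.prod_congr rfl fun b hb => by simp [hb]
  · intro b _ hb
    simp [hb, hH]

/-- The mean over `J` of a function of the coordinates. -/
noncomputable def meanOn {ι : Type*} (J : Finset ι) (p : ι → Bool → ℝ) (ω : ι → Bool) : ℝ :=
  (J.card : ℝ)⁻¹ * ∑ b ∈ J, p b (ω b)

lemma sum_weight {ι : Type*} [Fintype ι] [DecidableEq ι] (J : Finset ι)
    (H : ι → Bool → ℝ) (hH : ∀ b, H b true + H b false = 1) :
    ∑ ω : ι → Bool, ∏ b ∈ Jᶜ, H b (ω b) = 2 ^ J.card := by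
  have := sum_weight_exp J H hH (fun _ _ => 0)
  simp only [Finset.sum_const_zero, Real.exp_zero, mul_one] at this
  rw [this, Finset.prod_const]; norm_num

lemma abs_meanOn_le {ι : Type*} {J : Finset ι} (hJ : J.Nonempty) {p : ι → Bool → ℝ} {τ : ℝ}
    (hp : ∀ b s, |p b s| ≤ τ) (ω : ι → Bool) : |meanOn J p ω| ≤ τ := by
  have hc : (0 : ℝ) < J.card := by exact_mod_cast hJ.card_pos
  rw [meanOn, abs_mul, abs_of_nonneg (inv_nonneg.2 hc.le), inv_mul_le_iff₀ hc]
  calc |∑ b ∈ J, p b (ω b)| ≤ ∑ b ∈ J, |p b (ω b)| := Finset.abs_sum_le_sum_abs _ _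
    _ ≤ ∑ b ∈ J, τ := Finset.sum_le_sum fun b _ => hp _ _
    _ = J.card * τ := by simp

/-- Sub-Gaussian estimate for the mean over `J` of antisymmetric bounded functions of signs. -/
lemma sum_weight_cosh_le {ι : Type*} [Fintype ι] [DecidableEq ι] {J : Finset ι}
    (hJ : J.Nonempty) (H : ι → Bool → ℝ) (hH : ∀ b, H b true + H b false = 1)
    (hH0 : ∀ b s, 0 ≤ H b s) (a : ι → Bool → ℝ) (ha : ∀ b, a b true + a b false = 0) {τ c : ℝ}
    (hτ : ∀ b s, |a b s| ≤ τ) (hc : 0 ≤ c) :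
    ∑ ω : ι → Bool, (∏ b ∈ Jᶜ, H b (ω b)) * (Real.cosh (c * meanOn J a ω) - 1) ≤
      2 ^ J.card * (Real.exp (min ((c * τ) ^ 2 / J.card) (c * τ)) - 1) := by
  have hcard : (0 : ℝ) < J.card := by exact_mod_cast hJ.card_pos
  have hτ0 : 0 ≤ τ := by
    obtain ⟨b, _⟩ := hJ
    exact (abs_nonneg _).trans (hτ b true)
  have hv : ∀ ω : ι → Bool, 0 ≤ ∏ b ∈ Jᶜ, H b (ω b) :=
    fun ω => Finset.prod_nonneg fun b _ => hH0 _ _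
  -- Stated for both signs of `c'`, since `cosh` needs `c` and `-c`. By antisymmetry each factor is
  -- `2 cosh`, at most `2 exp` of half the square.
  have key : ∀ c' : ℝ, ∑ ω : ι → Bool, (∏ b ∈ Jᶜ, H b (ω b)) * Real.exp (c' * meanOn J a ω) ≤
      2 ^ J.card * Real.exp ((c' * τ) ^ 2 / J.card) := by
    intro c'
    have h := sum_weight_exp J H hH fun b s => c' * (J.card : ℝ)⁻¹ * a b s
    have e : ∀ ω : ι → Bool, c' * meanOn J a ω = ∑ b ∈ J, c' * (J.card : ℝ)⁻¹ * a b (ω b) := by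
      intro ω
      rw [meanOn, ← Finset.mul_sum]; ring
    simp_rw [e, h]
    calc ∏ b ∈ J, (Real.exp (c' * (J.card : ℝ)⁻¹ * a b true) +
            Real.exp (c' * (J.card : ℝ)⁻¹ * a b false))
        ≤ ∏ b ∈ J, (2 * Real.exp ((c' * τ) ^ 2 / J.card ^ 2)) := by
          refine Finset.prod_le_prod (fun b _ => by positivity) fun b _ => ?_
          have hb : a b false = - a b true := by linarith [ha b]
          have h1 := Real.cosh_le_exp_half_sq (c' * (J.card : ℝ)⁻¹ * a b true)
          rw [Real.cosh_eq] at h1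
          rw [hb, mul_neg]
          have h2 : (c' * (J.card : ℝ)⁻¹ * a b true) ^ 2 / 2 ≤ (c' * τ) ^ 2 / J.card ^ 2 := by
            have h3 : a b true ^ 2 ≤ τ ^ 2 := by
              rw [← sq_abs]
              exact pow_le_pow_left₀ (abs_nonneg _) (hτ b true) 2
            calc (c' * (J.card : ℝ)⁻¹ * a b true) ^ 2 / 2
                ≤ (c' * (J.card : ℝ)⁻¹ * a b true) ^ 2 := half_le_self (sq_nonneg _)
              _ = c' ^ 2 * ((J.card : ℝ)⁻¹) ^ 2 * a b true ^ 2 := by ring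
              _ ≤ c' ^ 2 * ((J.card : ℝ)⁻¹) ^ 2 * τ ^ 2 := by gcongr
              _ = _ := by field_simp
          linarith [Real.exp_le_exp.2 h2]
      _ = 2 ^ J.card * Real.exp ((c' * τ) ^ 2 / J.card) := by
          rw [Finset.prod_const, mul_pow, ← Real.exp_nat_mul]
          congr 2
          field_simp
  have b1 : ∑ ω : ι → Bool, (∏ b ∈ Jᶜ, H b (ω b)) * (Real.cosh (c * meanOn J a ω) - 1) ≤
      2 ^ J.card * (Real.exp ((c * τ) ^ 2 / J.card) - 1) := by
    have k1 := key c
    have k2 := key (-c)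
    have e : ∀ ω : ι → Bool, (∏ b ∈ Jᶜ, H b (ω b)) * (Real.cosh (c * meanOn J a ω) - 1) =
        ((∏ b ∈ Jᶜ, H b (ω b)) * Real.exp (c * meanOn J a ω) +
          (∏ b ∈ Jᶜ, H b (ω b)) * Real.exp (-c * meanOn J a ω)) / 2 -
          ∏ b ∈ Jᶜ, H b (ω b) := by
      intro ω
      rw [Real.cosh_eq, neg_mul]; ring
    simp_rw [e]
    rw [Finset.sum_sub_distrib, ← Finset.sum_div, Finset.sum_add_distrib, sum_weight J H hH]
    have : (-c * τ) ^ 2 = (c * τ) ^ 2 := by ring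
    rw [this] at k2
    linarith
  -- The pointwise bound, without any cancellation. It is the better one when `J` is small compared
  -- with `c τ`.
  have b2 : ∑ ω : ι → Bool, (∏ b ∈ Jᶜ, H b (ω b)) * (Real.cosh (c * meanOn J a ω) - 1) ≤
      2 ^ J.card * (Real.exp (c * τ) - 1) := by
    calc _ ≤ ∑ ω : ι → Bool, (∏ b ∈ Jᶜ, H b (ω b)) * (Real.exp (c * τ) - 1) := by
          refine Finset.sum_le_sum fun ω _ => mul_le_mul_of_nonneg_left ?_ (hv ω)
          have h1 : |c * meanOn J a ω| ≤ |c * τ| := by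
            rw [abs_mul, abs_of_nonneg hc, abs_of_nonneg (mul_nonneg hc hτ0)]
            exact mul_le_mul_of_nonneg_left (abs_meanOn_le hJ hτ ω) hc
          have h2 := cosh_sub_one_mono h1
          have h3 : Real.cosh (c * τ) ≤ Real.exp (c * τ) := by
            have : Real.exp (-(c * τ)) ≤ Real.exp (c * τ) :=
              Real.exp_le_exp.2 (by linarith [mul_nonneg hc hτ0])
            rw [Real.cosh_eq]; linarith
          linarith
      _ = _ := by rw [← Finset.sum_mul, sum_weight J H hH]
  rcases min_choice ((c * τ) ^ 2 / J.card) (c * τ) with h | h <;> rw [h]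
  · exact b1
  · exact b2

/-- The moment estimate for a mixture. `T = ∑ w v A` dominates `Q` from below up to a factor. -/
lemma sum_perspective_mixture_le {ι κ : Type*} [Fintype ι] [DecidableEq ι] [Fintype κ]
    (w : κ → ℝ) (hw : ∀ k, 0 ≤ w k) (J : κ → Finset ι) (hJ : ∀ k, (J k).Nonempty)
    (H : κ → ι → Bool → ℝ) (hH : ∀ k b, H k b true + H k b false = 1)
    (hH0 : ∀ k b s, 0 ≤ H k b s) (p q : ι → Bool → ℝ)
    (hp : ∀ b, p b true + p b false = 1) (hq : ∀ b, q b true + q b false = 1)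
    {ζ τ K t : ℝ} (hζ : 0 < ζ) (hqζ : ∀ b s, ζ ≤ q b s) (hpq : ∀ b s, |p b s - q b s| ≤ τ)
    (hK : 1 ≤ K) (ht : 0 ≤ t) (Q : (ι → Bool) → ℝ)
    (hdom : ∀ ω, ∑ k, w k * (∏ b ∈ (J k)ᶜ, H k b (ω b)) * meanOn (J k) q ω ≤ K * Q ω)
    (hpos : ∀ ω, 0 < ∑ k, w k * (∏ b ∈ (J k)ᶜ, H k b (ω b)) * meanOn (J k) q ω) :
    ∑ ω, Q ω * (Real.cosh (t * (∑ k, w k * (∏ b ∈ (J k)ᶜ, H k b (ω b)) *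
        meanOn (J k) (fun b s => p b s - q b s) ω) / Q ω) - 1) ≤
      ∑ k, w k * (2 ^ (J k).card *
        (Real.exp (min ((K / ζ * t * τ) ^ 2 / (J k).card) (K / ζ * t * τ)) - 1)) := by
  have hK0 : 0 < K := by linarith
  have hA : ∀ k ω, ζ ≤ meanOn (J k) q ω := by
    intro k ω
    have hc : (0 : ℝ) < (J k).card := by exact_mod_cast (hJ k).card_pos
    rw [meanOn, le_inv_mul_iff₀ hc]
    calc ((J k).card : ℝ) * ζ = ∑ b ∈ J k, ζ := by simp
      _ ≤ _ := Finset.sum_le_sum fun b _ => hqζ _ _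
  have hq1 : ∀ b s, |q b s| ≤ 1 := by
    intro b s
    have h0 := hq b
    have h1 := hqζ b true
    have h2 := hqζ b false
    rw [abs_le]
    cases s <;> constructor <;> linarith
  have hA1 : ∀ k ω, meanOn (J k) q ω ≤ 1 := fun k ω =>
    (le_abs_self _).trans (abs_meanOn_le (hJ k) hq1 ω)
  set V : κ → (ι → Bool) → ℝ := fun k ω => ∏ b ∈ (J k)ᶜ, H k b (ω b) with hV
  have hV0 : ∀ k ω, 0 ≤ V k ω := fun k ω => Finset.prod_nonneg fun b _ => hH0 _ _ _
  set a : κ → (ι → Bool) → ℝ := fun k ω => meanOn (J k) (fun b s => p b s - q b s) ω with ha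
  -- The perspective is antitone in its second argument, so `Q` may be lowered to `T / K`; joint
  -- convexity then splits the mixture `T` into its components. In each of them the mean of `q` lies
  -- in `[ζ, 1]`, so it drops out at the price of `1 / ζ` inside `cosh`.
  have step : ∀ ω, Q ω * (Real.cosh (t * (∑ k, w k * V k ω * a k ω) / Q ω) - 1) ≤
      ∑ k, w k * (V k ω * (Real.cosh (K / ζ * t * a k ω) - 1)) := by
    intro ω
    set T := ∑ k, w k * V k ω * meanOn (J k) q ω with hT
    have hT0 : 0 < T := hpos ω
    have hTQ : T / K ≤ Q ω := by
      rw [div_le_iff₀ hK0, mul_comm]; exact hdom ω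
    calc Q ω * (Real.cosh (t * (∑ k, w k * V k ω * a k ω) / Q ω) - 1)
        ≤ T / K * (Real.cosh (t * (∑ k, w k * V k ω * a k ω) / (T / K)) - 1) :=
          perspective_cosh_antitone _ (by positivity) hTQ
      _ ≤ T * (Real.cosh (t * (∑ k, w k * V k ω * a k ω) / (T / K)) - 1) :=
          mul_le_mul_of_nonneg_right (div_le_self hT0.le hK) (cosh_sub_one_nonneg _)
      _ = T * (Real.cosh (K * t * (∑ k, w k * V k ω * a k ω) / T) - 1) := by
          congr 3; field_simp
      _ ≤ ∑ k, w k * V k ω * (meanOn (J k) q ω *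
            (Real.cosh (K * t * a k ω / meanOn (J k) q ω) - 1)) :=
          perspective_cosh_sum_le (fun k => w k * V k ω) (fun k => meanOn (J k) q ω)
            (fun k => a k ω) (fun k => mul_nonneg (hw k) (hV0 k ω))
            (fun k => hζ.trans_le (hA k ω)) _ hT0
      _ ≤ _ := by
          refine Finset.sum_le_sum fun k _ => ?_
          rw [← mul_assoc (w k) (V k ω)]
          refine mul_le_mul_of_nonneg_left ?_ (mul_nonneg (hw k) (hV0 k ω))
          have hAk := hζ.trans_le (hA k ω)
          calc meanOn (J k) q ω * (Real.cosh (K * t * a k ω / meanOn (J k) q ω) - 1)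
              ≤ 1 * (Real.cosh (K * t * a k ω / meanOn (J k) q ω) - 1) :=
                mul_le_mul_of_nonneg_right (hA1 k ω) (cosh_sub_one_nonneg _)
            _ ≤ _ := by
                rw [one_mul]
                refine cosh_sub_one_mono ?_
                rw [abs_div, abs_of_pos hAk, div_mul_eq_mul_div, div_mul_eq_mul_div, abs_div,
                  abs_of_pos hζ]
                exact div_le_div_of_nonneg_left (abs_nonneg _) hζ (hA k ω)
  calc _ ≤ ∑ ω, ∑ k, w k * (V k ω * (Real.cosh (K / ζ * t * a k ω) - 1)) :=
        Finset.sum_le_sum fun ω _ => step ω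
    _ = ∑ k, w k * ∑ ω, V k ω * (Real.cosh (K / ζ * t * a k ω) - 1) := by
        rw [Finset.sum_comm]
        simp_rw [Finset.mul_sum]
    _ ≤ _ := by
        refine Finset.sum_le_sum fun k _ => mul_le_mul_of_nonneg_left ?_ (hw k)
        refine sum_weight_cosh_le (hJ k) (H k) (hH k) (hH0 k) _ (fun b => ?_) hpq (by positivity)
        linarith [hp b, hq b]

lemma exp_sub_one_le_mul_exp (x : ℝ) : Real.exp x - 1 ≤ x * Real.exp x := by
  have h := Real.add_one_le_exp (-x)
  have h2 : Real.exp x * Real.exp (-x) = 1 := by rw [← Real.exp_add]; simp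
  nlinarith [Real.exp_pos x]

/-- A binomial average of `exp (min (y² / K) y)` is governed by the mean of `K`. -/
lemma binomial_exp_min_le {ι : Type*} [DecidableEq ι] (s : Finset ι) {ζ y : ℝ} (hζ : 0 < ζ)
    (hζ1 : ζ ≤ 1) (hy : 0 ≤ y) :
    ∑ t ∈ s.powerset, ζ ^ t.card * (1 - ζ) ^ (s.card - t.card) *
        (Real.exp (min (y ^ 2 / ((t.card + 1 : ℕ) : ℝ)) y) - 1) ≤
      Real.exp (12 / ζ * y ^ 2 / (s.card + 1)) - 1 := by
  set L : ℝ := s.card + 1 with hL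
  have hL0 : 0 < L := by positivity
  have h1ζ : 0 ≤ 1 - ζ := by linarith
  have hsum : ∀ a : ℝ, ∑ t ∈ s.powerset, ζ ^ t.card * (1 - ζ) ^ (s.card - t.card) * a = a := by
    intro a
    rw [← Finset.sum_mul, Finset.sum_pow_mul_eq_add_pow]
    simp
  have hw : ∀ t : Finset ι, 0 ≤ ζ ^ t.card * (1 - ζ) ^ (s.card - t.card) := fun t => by positivity
  -- If `y ≥ ζ L / 8`, then `y` itself is below `12 y² / (ζ L)` and the trivial branch of the
  -- minimum suffices. Otherwise atypically small `t` must be shown to be rare.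
  rcases le_total (ζ * L / 8) y with hbig | hsmall
  · calc _ ≤ ∑ t ∈ s.powerset, ζ ^ t.card * (1 - ζ) ^ (s.card - t.card) * (Real.exp y - 1) := by
          refine Finset.sum_le_sum fun t _ => mul_le_mul_of_nonneg_left ?_ (hw t)
          linarith [Real.exp_le_exp.2 (min_le_right (y ^ 2 / ((t.card + 1 : ℕ) : ℝ)) y)]
      _ = Real.exp y - 1 := hsum _
      _ ≤ _ := by
          have : y ≤ 12 / ζ * y ^ 2 / L := by
            rw [le_div_iff₀ hL0, div_mul_eq_mul_div, le_div_iff₀ hζ]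
            nlinarith
          linarith [Real.exp_le_exp.2 this]
  -- Size at least `ζ L / 4` makes `y² / size` good enough. For smaller sizes, `exp (ζ L / 4 - 1 -
  -- |t|)` is at least `1` and serves as a Chernoff majorant of the indicator of this event.
  · have hpt : ∀ t : Finset ι, Real.exp (min (y ^ 2 / ((t.card + 1 : ℕ) : ℝ)) y) - 1 ≤
        (Real.exp (4 / ζ * y ^ 2 / L) - 1) +
          y ^ 2 * Real.exp (y + ζ * L / 4 - 1) * Real.exp (-1) ^ t.card := by
      intro t
      have hc : (0 : ℝ) < ((t.card + 1 : ℕ) : ℝ) := by positivity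
      have hc1 : (1 : ℝ) ≤ ((t.card + 1 : ℕ) : ℝ) := by exact_mod_cast Nat.le_add_left 1 t.card
      rcases le_total (ζ * L / 4) ((t.card + 1 : ℕ) : ℝ) with h | h
      · have h1 : y ^ 2 / ((t.card + 1 : ℕ) : ℝ) ≤ 4 / ζ * y ^ 2 / L := by
          calc y ^ 2 / ((t.card + 1 : ℕ) : ℝ) ≤ y ^ 2 / (ζ * L / 4) := by gcongr
            _ = _ := by field_simp
        have h2 := Real.exp_le_exp.2 ((min_le_left _ y).trans h1)
        have h3 : 0 ≤ y ^ 2 * Real.exp (y + ζ * L / 4 - 1) * Real.exp (-1) ^ t.card := by positivity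
        linarith
      · set x := min (y ^ 2 / ((t.card + 1 : ℕ) : ℝ)) y with hx
        have hx1 : x ≤ y ^ 2 := (min_le_left _ _).trans (div_le_self (sq_nonneg _) hc1)
        have hx2 : x ≤ y := min_le_right _ _
        have h0 : 0 ≤ Real.exp (4 / ζ * y ^ 2 / L) - 1 := by
          have : 0 ≤ 4 / ζ * y ^ 2 / L := by positivity
          linarith [Real.one_le_exp this]
        have h1 : Real.exp x - 1 ≤ y ^ 2 * Real.exp y :=
          (exp_sub_one_le_mul_exp x).trans
            (mul_le_mul hx1 (Real.exp_le_exp.2 hx2) (Real.exp_pos _).le (sq_nonneg _))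
        have h2 : y ^ 2 * Real.exp y ≤
            y ^ 2 * Real.exp (y + ζ * L / 4 - 1) * Real.exp (-1) ^ t.card := by
          rw [mul_assoc, ← Real.exp_nat_mul, ← Real.exp_add]
          refine mul_le_mul_of_nonneg_left (Real.exp_le_exp.2 ?_) (sq_nonneg _)
          push_cast at h
          linarith
        linarith
    -- The binomial generating function at `1 / e`, with `1 - ζ (1 - 1 / e) ≤ exp (-ζ / 2)`.
    have hmgf : ∑ t ∈ s.powerset, ζ ^ t.card * (1 - ζ) ^ (s.card - t.card) *
        Real.exp (-1) ^ t.card ≤ Real.exp (-(ζ / 2) * s.card) := by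
      have e : ∀ t ∈ s.powerset, ζ ^ t.card * (1 - ζ) ^ (s.card - t.card) *
        Real.exp (-1) ^ t.card = (ζ * Real.exp (-1)) ^ t.card * (1 - ζ) ^ (s.card - t.card) := by
        intro t _
        rw [mul_pow]; ring
      rw [Finset.sum_congr rfl e, Finset.sum_pow_mul_eq_add_pow, mul_comm (-(ζ / 2)),
        Real.exp_nat_mul]
      refine pow_le_pow_left₀ (by positivity) ?_ _
      have h1 := Real.add_one_le_exp (-(ζ / 2))
      have h2 : Real.exp (-1) ≤ 1 / 2 := by
        rw [Real.exp_neg, one_div]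
        exact inv_anti₀ (by norm_num) (by linarith [Real.add_one_le_exp (1 : ℝ)])
      nlinarith
    have hexp : y ^ 2 * Real.exp (y + ζ * L / 4 - 1) * Real.exp (-(ζ / 2) * s.card) ≤
        8 / ζ * y ^ 2 / L := by
      rw [mul_assoc, ← Real.exp_add]
      -- Here `y ≤ ζ L / 8` enters: the positive terms use up at most three quarters of `ζ L / 2`,
      -- and the `ζ / 2` from `L - 1` is absorbed by the `-1`.
      have h1 : y + ζ * L / 4 - 1 + -(ζ / 2) * s.card ≤ -(ζ * L / 8) := by
        have : (s.card : ℝ) = L - 1 := by simp [hL]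
        rw [this]; nlinarith
      have h2 : Real.exp (-(ζ * L / 8)) ≤ (ζ * L / 8)⁻¹ := by
        rw [Real.exp_neg]
        exact inv_anti₀ (by positivity) (by linarith [Real.add_one_le_exp (ζ * L / 8)])
      calc _ ≤ y ^ 2 * (ζ * L / 8)⁻¹ :=
            mul_le_mul_of_nonneg_left ((Real.exp_le_exp.2 h1).trans h2) (sq_nonneg _)
        _ = _ := by field_simp
    calc _ ≤ ∑ t ∈ s.powerset, ζ ^ t.card * (1 - ζ) ^ (s.card - t.card) *
            ((Real.exp (4 / ζ * y ^ 2 / L) - 1) +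
              y ^ 2 * Real.exp (y + ζ * L / 4 - 1) * Real.exp (-1) ^ t.card) :=
          Finset.sum_le_sum fun t _ => mul_le_mul_of_nonneg_left (hpt t) (hw t)
      _ = (Real.exp (4 / ζ * y ^ 2 / L) - 1) + y ^ 2 * Real.exp (y + ζ * L / 4 - 1) *
            ∑ t ∈ s.powerset, ζ ^ t.card * (1 - ζ) ^ (s.card - t.card) * Real.exp (-1) ^ t.card := by
          simp_rw [mul_add]
          rw [Finset.sum_add_distrib, hsum, Finset.mul_sum]
          congr 1
          exact Finset.sum_congr rfl fun t _ => by ring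
      _ ≤ (Real.exp (4 / ζ * y ^ 2 / L) - 1) + 8 / ζ * y ^ 2 / L := by
          have := mul_le_mul_of_nonneg_left hmgf
            (show 0 ≤ y ^ 2 * Real.exp (y + ζ * L / 4 - 1) by positivity)
          linarith
      _ ≤ _ := by
          -- The constant `12 = 4 + 8` collects typical and atypical sizes, through `(e^a - 1) + b ≤
          -- e^(a + b) - 1`.
          have e : 12 / ζ * y ^ 2 / L = 4 / ζ * y ^ 2 / L + 8 / ζ * y ^ 2 / L := by ring
          rw [e, Real.exp_add]
          have a0 : 0 ≤ 4 / ζ * y ^ 2 / L := by positivity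
          have b0 : 0 ≤ 8 / ζ * y ^ 2 / L := by positivity
          have h1 := Real.one_le_exp a0
          have h2 := Real.add_one_le_exp (8 / ζ * y ^ 2 / L)
          nlinarith

/-! ### Moments of a likelihood ratio -/

/-- For positive `P`, `Q` of total mass one and `α ≥ 2`, the `α`-moment of `P / Q` is controlled
by `cosh`. -/
lemma sum_rpow_ratio_le {Ω : Type*} [Fintype Ω] (P Q : Ω → ℝ) (hP : ∀ ω, 0 < P ω)
    (hQ : ∀ ω, 0 < Q ω) (hP1 : ∑ ω, P ω = 1) (hQ1 : ∑ ω, Q ω = 1) {α : ℝ} (hα : 0 ≤ α) :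
    ∑ ω, Q ω * (P ω / Q ω) ^ α ≤
      1 + 2 * ∑ ω, Q ω * (Real.cosh (α * (P ω - Q ω) / Q ω) - 1) := by
  have hpt : ∀ ω, Q ω * (P ω / Q ω) ^ α ≤ Q ω + α * (P ω - Q ω) +
      2 * (Q ω * (Real.cosh (α * (P ω - Q ω) / Q ω) - 1)) := by
    intro ω
    have hq := hQ ω
    have h1 : P ω / Q ω ≤ Real.exp ((P ω - Q ω) / Q ω) := by
      have := Real.add_one_le_exp ((P ω - Q ω) / Q ω)
      calc P ω / Q ω = (P ω - Q ω) / Q ω + 1 := by field_simp; ring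
        _ ≤ _ := this
    have h2 : (P ω / Q ω) ^ α ≤ Real.exp (α * (P ω - Q ω) / Q ω) := by
      calc (P ω / Q ω) ^ α ≤ (Real.exp ((P ω - Q ω) / Q ω)) ^ α :=
            Real.rpow_le_rpow (div_pos (hP ω) hq).le h1 hα
        _ = _ := by rw [← Real.exp_mul]; congr 1; ring
    have h3 := h2.trans (exp_le_one_add_add_cosh _)
    calc Q ω * (P ω / Q ω) ^ α ≤ Q ω * (1 + α * (P ω - Q ω) / Q ω +
          2 * (Real.cosh (α * (P ω - Q ω) / Q ω) - 1)) := by gcongr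
      _ = _ := by field_simp
  calc _ ≤ ∑ ω, (Q ω + α * (P ω - Q ω) +
      2 * (Q ω * (Real.cosh (α * (P ω - Q ω) / Q ω) - 1))) := Finset.sum_le_sum fun ω _ => hpt ω
    _ = _ := by
      -- The linear term vanishes because `P` and `Q` have the same mass.
      rw [Finset.sum_add_distrib, Finset.sum_add_distrib, ← Finset.mul_sum, ← Finset.mul_sum,
        Finset.sum_sub_distrib, hP1, hQ1]
      ring

/-- Interpolation of the moments of a likelihood ratio between the orders `1` and `2`. -/
lemma sum_rpow_ratio_interpolate {Ω : Type*} [Fintype Ω] (P Q : Ω → ℝ) (hP : ∀ ω, 0 < P ω)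
    (hQ : ∀ ω, 0 < Q ω) (hP1 : ∑ ω, P ω = 1) {α : ℝ} (h1 : 1 < α) (h2 : α < 2) :
    ∑ ω, Q ω * (P ω / Q ω) ^ α ≤ (∑ ω, Q ω * (P ω / Q ω) ^ (2 : ℝ)) ^ (α - 1) := by
  -- Hölder applied to `P^(2 - α) · (Q (P / Q)²)^(α - 1)`, which is the integrand `Q (P / Q)^α`; the
  -- first factor integrates to `1`.
  have hpq : (2 - α)⁻¹.HolderConjugate (α - 1)⁻¹ := by
    rw [Real.holderConjugate_iff]
    refine ⟨(one_lt_inv₀ (by linarith)).2 (by linarith), ?_⟩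
    rw [inv_inv, inv_inv]; ring
  have h := Real.inner_le_Lp_mul_Lq_of_nonneg Finset.univ hpq
    (f := fun ω => P ω ^ (2 - α)) (g := fun ω => (Q ω * (P ω / Q ω) ^ (2 : ℝ)) ^ (α - 1))
    (fun ω _ => by have := hP ω; positivity)
    (fun ω _ => by have := hP ω; have := hQ ω; positivity)
  have e1 : ∀ ω, P ω ^ (2 - α) * (Q ω * (P ω / Q ω) ^ (2 : ℝ)) ^ (α - 1) =
      Q ω * (P ω / Q ω) ^ α := by
    intro ω
    have hp := hP ω
    have hq := hQ ω
    rw [Real.div_rpow hp.le hq.le, Real.div_rpow hp.le hq.le, Real.mul_rpow hq.le (by positivity),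
      Real.div_rpow (by positivity) (by positivity), ← Real.rpow_mul hp.le, ← Real.rpow_mul hq.le,
      Real.rpow_def_of_pos hp, Real.rpow_def_of_pos hp, Real.rpow_def_of_pos hp,
      Real.rpow_def_of_pos hq, Real.rpow_def_of_pos hq, Real.rpow_def_of_pos hq]
    nth_rewrite 3 [← Real.exp_log hq]
    rw [← Real.exp_sub, ← Real.exp_sub, ← Real.exp_add, ← Real.exp_add, ← Real.exp_add]
    congr 1
    ring
  simp_rw [e1] at h
  refine h.trans (le_of_eq ?_)
  have e2 : ∀ ω, (P ω ^ (2 - α)) ^ (2 - α)⁻¹ = P ω := fun ω => by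
    rw [← Real.rpow_mul (hP ω).le, mul_inv_cancel₀ (by linarith), Real.rpow_one]
  have e3 : ∀ ω, ((Q ω * (P ω / Q ω) ^ (2 : ℝ)) ^ (α - 1)) ^ (α - 1)⁻¹ =
      Q ω * (P ω / Q ω) ^ (2 : ℝ) := fun ω => by
    have hp := hP ω
    have hq := hQ ω
    rw [← Real.rpow_mul (by positivity), mul_inv_cancel₀ (by linarith), Real.rpow_one]
  simp_rw [e2, e3, hP1]
  simp

/-! ### Combinatorics of the shuffle -/

/-- Positions carry different seeds, so exchanging points between positions is not a symmetry of the
likelihood. It changes at most two factors, however, and this bounds the damage by `K ^ 2`. -/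
lemma prod_le_sq_mul_prod {ι Z : Type*} [Fintype ι] [DecidableEq ι] {f : Z → ι → ℝ} {K : ℝ}
    (hf : ∀ z b, 0 < f z b) (hK : ∀ z z' b, f z b ≤ K * f z' b) (hK1 : 1 ≤ K) {φ ψ : ι → Z}
    (S : Finset ι) (hS : S.card ≤ 2) (h : ∀ b ∉ S, φ b = ψ b) :
    ∏ b, f (φ b) b ≤ K ^ 2 * ∏ b, f (ψ b) b := by
  have hK0 : 0 < K := by linarith
  calc ∏ b, f (φ b) b ≤ ∏ b, ((if b ∈ S then K else 1) * f (ψ b) b) := by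
        refine Finset.prod_le_prod (fun b _ => (hf _ _).le) fun b _ => ?_
        by_cases hb : b ∈ S
        · simpa [hb] using hK _ _ _
        · simp [hb, h b hb]
    _ = K ^ S.card * ∏ b, f (ψ b) b := by
        rw [Finset.prod_mul_distrib]
        congr 1
        rw [Finset.prod_ite_mem, Finset.univ_inter, Finset.prod_const]
    _ ≤ _ := by
        refine mul_le_mul_of_nonneg_right (pow_le_pow_right₀ hK1 hS) ?_
        exact Finset.prod_nonneg fun b _ => (hf _ _).le

/-- Reindexing by right multiplication with a transposition moves the pin from one position to
another; a function that is unaffected by the transposition then has the same pinned sum at both. -/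
lemma sum_perm_pinned_swap {κ : Type*} [Fintype κ] [DecidableEq κ] (P : κ → Prop)
    [DecidablePred P] (g : Equiv.Perm κ → ℝ) (c c' : κ) :
    (∑ π : Equiv.Perm κ, if P (π c') then g (π * Equiv.swap c c') else 0) =
      ∑ π : Equiv.Perm κ, if P (π c) then g π else 0 := by
  rw [← Equiv.sum_comp (Equiv.mulRight (Equiv.swap c c'))]
  refine Finset.sum_congr rfl fun π _ => ?_
  simp [Equiv.Perm.mul_apply, mul_assoc]

/-- Pinning the slot revealed at one position costs a factor `1 / N`, up to the change of `g`
under a transposition. -/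
lemma card_mul_sum_perm_pinned_le {κ : Type*} [Fintype κ] [DecidableEq κ] {K : ℝ}
    (g : Equiv.Perm κ → ℝ) (c q : κ)
    (h : ∀ π c', g (π * Equiv.swap c c') ≤ K * g π) :
    (Fintype.card κ : ℝ) * (∑ π : Equiv.Perm κ, if π c = q then g π else 0) ≤
      K * ∑ π, g π := by
  have h1 : ∀ c', (∑ π : Equiv.Perm κ, if π c = q then g π else 0) ≤
      ∑ π : Equiv.Perm κ, if π c' = q then K * g π else 0 := by
    intro c'
    rw [← sum_perm_pinned_swap (fun z => z = q) g c c']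
    refine Finset.sum_le_sum fun π _ => ?_
    split_ifs
    · exact h π c'
    · exact le_rfl
  calc (Fintype.card κ : ℝ) * (∑ π : Equiv.Perm κ, if π c = q then g π else 0)
      = ∑ c' : κ, ∑ π : Equiv.Perm κ, if π c = q then g π else 0 := by simp
    _ ≤ ∑ c' : κ, ∑ π : Equiv.Perm κ, if π c' = q then K * g π else 0 :=
        Finset.sum_le_sum fun c' _ => h1 c'
    _ = ∑ π : Equiv.Perm κ, ∑ c' : κ, if π c' = q then K * g π else 0 := Finset.sum_comm
    _ = K * ∑ π, g π := by
        rw [Finset.mul_sum]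
        refine Finset.sum_congr rfl fun π _ => ?_
        -- A permutation shows the slot `q` at exactly one position, so summing over the position
        -- removes the pin.
        rw [Finset.sum_eq_single (π.symm q)]
        · simp
        · intro b _ hb
          rw [if_neg]
          rintro rfl
          simp at hb
        · simp

/-- Double counting of pairs of a set `J` and a marked element of it, written as `J = insert b t`.
This exchanges "first the position of `x`, then the clones" for "first their union". -/
lemma sum_insert_powerset {ι : Type*} [Fintype ι] [DecidableEq ι] (Y : ι → Finset ι → ℝ) :
    ∑ b, ∑ t ∈ (Finset.univ.erase b).powerset, Y b (insert b t) =
      ∑ J : Finset ι, ∑ b ∈ J, Y b J := by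
  have h1 : ∀ b, ∑ t ∈ (Finset.univ.erase b).powerset, Y b (insert b t) =
      ∑ J ∈ Finset.univ.filter (fun J : Finset ι => b ∈ J), Y b J := by
    intro b
    refine Finset.sum_bij' (fun t _ => insert b t) (fun J _ => J.erase b) ?_ ?_ ?_ ?_ ?_
    · intro t _; simp
    · intro J _
      rw [Finset.mem_powerset]
      exact Finset.erase_subset_erase _ (Finset.subset_univ _)
    · intro t ht
      rw [Finset.mem_powerset] at ht
      exact Finset.erase_insert fun hb => by simpa using ht hb
    · intro J hJ
      exact Finset.insert_erase (by simpa using hJ)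
    · intro t _; rfl
  simp_rw [h1]
  refine Finset.sum_comm' fun b J => ?_
  simp

/-- Expansion of the messages around the pinned one into a mixture of uniform signs (clones,
at the positions of `t`) and the remaining parts `H`; the pinned message is equally likely to be
at any of the positions in `insert b t`. -/
lemma sum_pinned_clone_expansion {ι κ : Type*} [Fintype ι] [DecidableEq ι] [Fintype κ]
    [DecidableEq κ] {e : ι → κ} (he : Function.Injective e) (R : κ → Prop) [DecidablePred R]
    (ζ : ℝ) (F H : κ → ι → Bool → ℝ) (hF : ∀ q b s, F q b s = ζ / 2 + (1 - ζ) * H q b s)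
    (p : ι → Bool → ℝ) (ω : ι → Bool) :
    (∑ b, ∑ π : Equiv.Perm κ, if R (π (e b)) then
        p b (ω b) * ∏ b' ∈ Finset.univ.erase b, F (π (e b')) b' (ω b') else 0) =
      ∑ b, ∑ t ∈ (Finset.univ.erase b).powerset, ∑ π : Equiv.Perm κ, if R (π (e b)) then
        (ζ / 2) ^ t.card * (1 - ζ) ^ ((Finset.univ.erase b).card - t.card) *
          (∏ b' ∈ (insert b t)ᶜ, H (π (e b')) b' (ω b')) * meanOn (insert b t) p ω else 0 := by
  have hexp : ∀ b (π : Equiv.Perm κ),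
      ∏ b' ∈ Finset.univ.erase b, F (π (e b')) b' (ω b') =
        ∑ t ∈ (Finset.univ.erase b).powerset,
          (ζ / 2) ^ t.card * (1 - ζ) ^ ((Finset.univ.erase b).card - t.card) *
          ∏ b' ∈ (insert b t)ᶜ, H (π (e b')) b' (ω b') := by
    intro b π
    simp_rw [hF]
    rw [Finset.prod_add]
    refine Finset.sum_congr rfl fun t ht => ?_
    rw [Finset.mem_powerset] at ht
    rw [Finset.prod_const, Finset.prod_mul_distrib, Finset.prod_const, Finset.card_sdiff_of_subset ht,
      mul_assoc]
    congr 3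
    ext; simp [Finset.mem_sdiff, and_comm]
  set X : ι → Finset ι → ℝ := fun b J => ∑ π : Equiv.Perm κ, if R (π (e b)) then
    ∏ b' ∈ Jᶜ, H (π (e b')) b' (ω b') else 0 with hX
  -- The heart of the cloning argument: the factors outside `J` do not notice which position of `J`
  -- holds the pinned point, because a transposition inside `J` fixes all other positions.
  have hconst : ∀ J : Finset ι, ∀ b ∈ J, ∀ c ∈ J, X b J = X c J := by
    intro J b hb c hc
    rw [hX]
    simp only
    rw [← sum_perm_pinned_swap R _ (e b) (e c)]
    refine Finset.sum_congr rfl fun π _ => ?_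
    split_ifs
    · refine Finset.prod_congr rfl fun b' hb' => ?_
      rw [Finset.mem_compl] at hb'
      rw [Equiv.Perm.mul_apply, Equiv.swap_apply_of_ne_of_ne]
      · exact fun h => hb' (he h ▸ hb)
      · exact fun h => hb' (he h ▸ hc)
    · rfl
  have hmean : ∀ J : Finset ι, ∑ b ∈ J, p b (ω b) * X b J = ∑ b ∈ J, meanOn J p ω * X b J := by
    intro J
    rcases J.eq_empty_or_nonempty with rfl | ⟨b₀, hb₀⟩
    · simp
    have hc : (J.card : ℝ) ≠ 0 := by
      simpa using Finset.ne_empty_of_mem hb₀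
    have h1 : ∑ b ∈ J, p b (ω b) * X b J = ∑ b ∈ J, p b (ω b) * X b₀ J :=
      Finset.sum_congr rfl fun b hb => by rw [hconst J b hb b₀ hb₀]
    have h2 : ∑ b ∈ J, meanOn J p ω * X b J = ∑ b ∈ J, meanOn J p ω * X b₀ J :=
      Finset.sum_congr rfl fun b hb => by rw [hconst J b hb b₀ hb₀]
    rw [h1, h2, ← Finset.sum_mul, Finset.sum_const, nsmul_eq_mul, meanOn]
    field_simp
  -- The weight of the clones expressed through `J = insert b t` alone, so that it can leave the sum
  -- over `b ∈ J`; the pinned position accounts for the `- 1`.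
  set cf : Finset ι → ℝ := fun J => (ζ / 2) ^ (J.card - 1) *
    (1 - ζ) ^ (Fintype.card ι - 1 - (J.card - 1)) with hcf
  have hcft : ∀ b, ∀ t ∈ (Finset.univ.erase b).powerset, cf (insert b t) =
      (ζ / 2) ^ t.card * (1 - ζ) ^ ((Finset.univ.erase b).card - t.card) := by
    intro b t ht
    rw [Finset.mem_powerset] at ht
    have : b ∉ t := fun hb => by simpa using ht hb
    simp [hcf, Finset.card_insert_of_notMem this, Finset.card_erase_of_mem, Finset.card_univ]
  calc _ = ∑ b, ∑ t ∈ (Finset.univ.erase b).powerset,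
        cf (insert b t) * (p b (ω b) * X b (insert b t)) := by
        refine Finset.sum_congr rfl fun b _ => ?_
        simp_rw [hexp, Finset.mul_sum, hX, Finset.mul_sum]
        rw [Finset.sum_comm]
        refine Finset.sum_congr rfl fun π _ => ?_
        split_ifs
        · refine Finset.sum_congr rfl fun t ht => ?_
          rw [hcft b t ht]; ring
        · simp
    _ = ∑ b, ∑ t ∈ (Finset.univ.erase b).powerset,
        cf (insert b t) * (meanOn (insert b t) p ω * X b (insert b t)) := by
        rw [sum_insert_powerset fun b J => cf J * (p b (ω b) * X b J),
          sum_insert_powerset fun b J => cf J * (meanOn J p ω * X b J)]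
        refine Finset.sum_congr rfl fun J _ => ?_
        rw [← Finset.mul_sum, ← Finset.mul_sum, hmean]
    _ = _ := by
        refine Finset.sum_congr rfl fun b _ => Finset.sum_congr rfl fun t ht => ?_
        rw [hcft b t ht]
        simp_rw [hX, Finset.mul_sum]
        refine Finset.sum_congr rfl fun π _ => ?_
        split_ifs
        · ring
        · simp

/-- The difference of two products of likelihoods which differ only at the point `x`. -/
lemma prod_sub_prod_eq_sum {ι Z : Type*} [Fintype ι] [DecidableEq ι] [DecidableEq Z]
    {φ : ι → Z} (hφ : Function.Injective φ) (x : Z) (f f' : Z → ι → ℝ)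
    (heq : ∀ z, z ≠ x → f z = f' z) :
    ∏ b, f (φ b) b - ∏ b, f' (φ b) b =
      ∑ b, if φ b = x then
        (f x b - f' x b) * ∏ b' ∈ Finset.univ.erase b, f' (φ b') b' else 0 := by
  by_cases hx : ∃ b, φ b = x
  · obtain ⟨b, hb⟩ := hx
    rw [Finset.sum_eq_single b]
    · rw [if_pos hb, ← Finset.mul_prod_erase _ _ (Finset.mem_univ b),
        ← Finset.mul_prod_erase Finset.univ (fun b => f' (φ b) b) (Finset.mem_univ b), hb,
        Finset.prod_congr rfl fun b' hb' => by
          rw [heq (φ b') fun h => Finset.ne_of_mem_erase hb' (hφ (h.trans hb.symm))]]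
      ring
    · intro b' _ hne
      rw [if_neg fun h => hne (hφ (h.trans hb.symm))]
    · simp
  · push Not at hx
    rw [Finset.sum_eq_zero fun b _ => if_neg (hx b),
      Finset.prod_congr rfl fun b _ => by rw [heq _ (hx b)], sub_self]

lemma powerset_erase_eq_filter {ι : Type*} [Fintype ι] [DecidableEq ι] (b : ι) :
    (Finset.univ.erase b).powerset = Finset.univ.filter fun t : Finset ι => b ∉ t := by
  ext t
  simp only [Finset.mem_powerset, Finset.mem_filter, Finset.mem_univ, true_and]
  exact ⟨fun h hb => by simpa using h hb, fun h c hc =>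
    Finset.mem_erase.2 ⟨fun hcb => h (hcb ▸ hc), Finset.mem_univ _⟩⟩

/-- The moment estimate for the shuffled messages with a single differing point `x`. Here `pt ξ q`
is the point in slot `q` for the selection `ξ`, position `b` reveals slot `π (e b)`, and `γ` is an
upper bound for the probability that `x` is revealed. -/
lemma shuffle_cosh_moment_le {ι κ Ξ Z : Type*} [Fintype ι] [DecidableEq ι] [Fintype κ]
    [DecidableEq κ] [Fintype Ξ] [DecidableEq Z] {e : ι → κ} (he : Function.Injective e)
    {pt : Ξ → κ → Z} (hpt : ∀ ξ, Function.Injective (pt ξ)) (x : Z) (f f' : Z → ι → Bool → ℝ)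
    (heq : ∀ z, z ≠ x → f z = f' z) (hf : ∀ z b, f z b true + f z b false = 1)
    (hf' : ∀ z b, f' z b true + f' z b false = 1) {ζ τ K c γ t : ℝ} (hζ : 0 < ζ) (hζ1 : ζ < 1)
    (hfζ' : ∀ z b s, ζ / 2 ≤ f' z b s)
    (hτ : ∀ b s, |f x b s - f' x b s| ≤ τ) (hK : 1 ≤ K) (hc : 0 < c) (hγ : 0 < γ) (ht : 0 ≤ t)
    (hne : ∃ ξ b, ∃ π : Equiv.Perm κ, pt ξ (π (e b)) = x)
    (hmass : c * ∑ ξ, ∑ b, ∑ π : Equiv.Perm κ, (if pt ξ (π (e b)) = x then (1 : ℝ) else 0) ≤ γ)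
    (hdom : ∀ ω : ι → Bool, c * ∑ ξ, ∑ b, ∑ π : Equiv.Perm κ, (if pt ξ (π (e b)) = x then
        ∏ b', f' (pt ξ (π (e b'))) b' (ω b') else 0) ≤
      K * γ * (c * ∑ ξ, ∑ π : Equiv.Perm κ, ∏ b, f' (pt ξ (π (e b))) b (ω b))) :
    ∑ ω : ι → Bool, (c * ∑ ξ, ∑ π : Equiv.Perm κ, ∏ b, f' (pt ξ (π (e b))) b (ω b)) *
      (Real.cosh (t * ((c * ∑ ξ, ∑ π : Equiv.Perm κ, ∏ b, f (pt ξ (π (e b))) b (ω b)) -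
          (c * ∑ ξ, ∑ π : Equiv.Perm κ, ∏ b, f' (pt ξ (π (e b))) b (ω b))) /
        (c * ∑ ξ, ∑ π : Equiv.Perm κ, ∏ b, f' (pt ξ (π (e b))) b (ω b))) - 1) ≤
      2 * (Real.exp (12 / ζ * (K / (ζ / 2) * (t * γ) * τ) ^ 2 / Fintype.card ι) - 1) := by
  have h1ζ : 0 < 1 - ζ := by linarith
  -- The part of the likelihood that remains after splitting off the data-independent fair coin of
  -- weight `ζ`; it is again a probability on signs.
  set H : Z → ι → Bool → ℝ := fun z b s => (f' z b s - ζ / 2) / (1 - ζ) with hHdef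
  have hH0 : ∀ z b s, 0 ≤ H z b s := fun z b s =>
    div_nonneg (by linarith [hfζ' z b s]) h1ζ.le
  have hH1 : ∀ z b, H z b true + H z b false = 1 := fun z b => by
    simp only [hHdef]
    rw [← add_div, div_eq_one_iff_eq h1ζ.ne']
    linarith [hf' z b]
  have hFH : ∀ z b s, f' z b s = ζ / 2 + (1 - ζ) * H z b s := fun z b s => by
    simp only [hHdef]; field_simp; ring
  -- A mixture component is a selection, the position of `x`, the set of the other clones, and a
  -- permutation showing `x` at that position. Division by `γ` normalizes to the event that `x` is
  -- revealed, which explains the factor `t * γ` below.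
  set w : Ξ × ι × Finset ι × Equiv.Perm κ → ℝ := fun k =>
    if k.2.1 ∉ k.2.2.1 then
      if pt k.1 (k.2.2.2 (e k.2.1)) = x then
        c / γ * ((ζ / 2) ^ k.2.2.1.card *
          (1 - ζ) ^ ((Finset.univ.erase k.2.1).card - k.2.2.1.card))
      else 0
    else 0 with hw
  have hw0 : ∀ k, 0 ≤ w k := fun k => by
    simp only [hw]
    split_ifs <;> positivity
  have hsumw : ∀ Y : Ξ → ι → Finset ι → Equiv.Perm κ → ℝ,
      ∑ k : Ξ × ι × Finset ι × Equiv.Perm κ, w k * Y k.1 k.2.1 k.2.2.1 k.2.2.2 =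
        c / γ * ∑ ξ, ∑ b, ∑ t ∈ (Finset.univ.erase b).powerset, ∑ π : Equiv.Perm κ,
          if pt ξ (π (e b)) = x then ((ζ / 2) ^ t.card *
            (1 - ζ) ^ ((Finset.univ.erase b).card - t.card)) * Y ξ b t π else 0 := by
    intro Y
    simp_rw [Fintype.sum_prod_type, Finset.mul_sum, powerset_erase_eq_filter, Finset.sum_filter]
    refine Finset.sum_congr rfl fun ξ _ => Finset.sum_congr rfl fun b _ =>
      Finset.sum_congr rfl fun t _ => ?_
    by_cases hbt : b ∈ t
    · simp [hw, hbt]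
    · simp only [hw, hbt, not_false_eq_true, if_true]
      refine Finset.sum_congr rfl fun π _ => ?_
      split_ifs <;> ring
  have hexpand : ∀ (p : ι → Bool → ℝ) (ω : ι → Bool),
      ∑ k, w k * (∏ b ∈ (insert k.2.1 k.2.2.1)ᶜ, H (pt k.1 (k.2.2.2 (e b))) b (ω b)) *
        meanOn (insert k.2.1 k.2.2.1) p ω =
      c / γ * ∑ ξ, ∑ b, ∑ π : Equiv.Perm κ, if pt ξ (π (e b)) = x then
        p b (ω b) * ∏ b' ∈ Finset.univ.erase b, f' (pt ξ (π (e b'))) b' (ω b') else 0 := by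
    intro p ω
    have h := hsumw fun ξ b t π => (∏ b' ∈ (insert b t)ᶜ, H (pt ξ (π (e b'))) b' (ω b')) *
      meanOn (insert b t) p ω
    simp_rw [mul_assoc]
    rw [h]
    congr 1
    refine Finset.sum_congr rfl fun ξ _ => ?_
    rw [sum_pinned_clone_expansion he (fun q => pt ξ q = x) ζ (fun q => f' (pt ξ q))
      (fun q => H (pt ξ q)) (fun q => hFH (pt ξ q)) p ω]
    simp_rw [mul_assoc]
  set Q : (ι → Bool) → ℝ := fun ω =>
    c * ∑ ξ, ∑ π : Equiv.Perm κ, ∏ b, f' (pt ξ (π (e b))) b (ω b) with hQ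
  -- With `f' x` at the pinned position the product is complete, so the mixture of means of `f' x`
  -- is the part of `Q` in which `x` is revealed, divided by `γ`. This is what `hdom` compares with
  -- `Q`.
  have hpin : ∀ ω : ι → Bool, ∑ ξ, ∑ b, ∑ π : Equiv.Perm κ, (if pt ξ (π (e b)) = x then
        f' x b (ω b) * ∏ b' ∈ Finset.univ.erase b, f' (pt ξ (π (e b'))) b' (ω b') else 0) =
      ∑ ξ, ∑ b, ∑ π : Equiv.Perm κ, (if pt ξ (π (e b)) = x then
        ∏ b', f' (pt ξ (π (e b'))) b' (ω b') else 0) := by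
    intro ω
    refine Finset.sum_congr rfl fun ξ _ => Finset.sum_congr rfl fun b _ =>
      Finset.sum_congr rfl fun π _ => ?_
    split_ifs with h
    · rw [← h, Finset.mul_prod_erase Finset.univ (fun b' => f' (pt ξ (π (e b'))) b' (ω b'))
        (Finset.mem_univ b)]
    · rfl
  have hdiff : ∀ ω : ι → Bool,
      t * ((c * ∑ ξ, ∑ π : Equiv.Perm κ, ∏ b, f (pt ξ (π (e b))) b (ω b)) - Q ω) =
      t * γ * ∑ k, w k * (∏ b ∈ (insert k.2.1 k.2.2.1)ᶜ, H (pt k.1 (k.2.2.2 (e b))) b (ω b)) *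
        meanOn (insert k.2.1 k.2.2.1) (fun b s => f x b s - f' x b s) ω := by
    intro ω
    rw [hexpand, hQ]
    simp only
    rw [← mul_sub, ← Finset.sum_sub_distrib]
    have : ∀ ξ, ∑ π : Equiv.Perm κ, ∏ b, f (pt ξ (π (e b))) b (ω b) -
        ∑ π : Equiv.Perm κ, ∏ b, f' (pt ξ (π (e b))) b (ω b) =
        ∑ b, ∑ π : Equiv.Perm κ, if pt ξ (π (e b)) = x then (f x b (ω b) - f' x b (ω b)) *
          ∏ b' ∈ Finset.univ.erase b, f' (pt ξ (π (e b'))) b' (ω b') else 0 := by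
      intro ξ
      rw [← Finset.sum_sub_distrib, Finset.sum_comm]
      refine Finset.sum_congr rfl fun π _ => ?_
      exact prod_sub_prod_eq_sum (φ := fun b => pt ξ (π (e b)))
        ((hpt ξ).comp (π.injective.comp he)) x (fun z b => f z b (ω b)) (fun z b => f' z b (ω b))
        (fun z hz => by rw [heq z hz])
    simp_rw [this]
    field_simp
  change ∑ ω, Q ω * (Real.cosh (t * ((c * ∑ ξ, ∑ π : Equiv.Perm κ,
    ∏ b, f (pt ξ (π (e b))) b (ω b)) - Q ω) / Q ω) - 1) ≤ _
  simp_rw [hdiff]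
  have hfpos : ∀ z b s, 0 < f' z b s := fun z b s => by linarith [hfζ' z b s]
  refine (sum_perspective_mixture_le w hw0 (fun k => insert k.2.1 k.2.2.1)
    (fun k => Finset.insert_nonempty _ _) (fun k b => H (pt k.1 (k.2.2.2 (e b))) b)
    (fun k b => hH1 _ b) (fun k b s => hH0 _ b s) (f x) (f' x) (hf x) (hf' x)
    (by positivity : 0 < ζ / 2) (hfζ' x) hτ hK (mul_nonneg ht hγ.le) Q ?_ ?_).trans ?_
  · intro ω
    rw [hexpand, hpin, div_mul_eq_mul_div, div_le_iff₀ hγ]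
    refine (hdom ω).trans (le_of_eq ?_)
    simp only [hQ]; ring
  · intro ω
    rw [hexpand, hpin]
    refine mul_pos (by positivity) ?_
    obtain ⟨ξ, b, π, h⟩ := hne
    have hn : ∀ ξ b (π : Equiv.Perm κ), 0 ≤ (if pt ξ (π (e b)) = x then
        ∏ b', f' (pt ξ (π (e b'))) b' (ω b') else 0) := fun ξ b π => by
      split_ifs
      · exact Finset.prod_nonneg fun b' _ => (hfpos _ _ _).le
      · exact le_rfl
    refine Finset.sum_pos' (fun ξ _ => Finset.sum_nonneg fun b _ => Finset.sum_nonneg fun π _ =>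
      hn ξ b π) ⟨ξ, Finset.mem_univ _, ?_⟩
    refine Finset.sum_pos' (fun b _ => Finset.sum_nonneg fun π _ => hn ξ b π)
      ⟨b, Finset.mem_univ _, ?_⟩
    refine Finset.sum_pos' (fun π _ => hn ξ b π) ⟨π, Finset.mem_univ _, ?_⟩
    rw [if_pos h]
    exact Finset.prod_pos fun b' _ => hfpos _ _ _
  · set y := K / (ζ / 2) * (t * γ) * τ with hy
    have hτ0 : 0 ≤ τ := by
      obtain ⟨-, b, -⟩ := hne
      exact (abs_nonneg _).trans (hτ b true)
    have hy0 : 0 ≤ y := by positivity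
    have h := hsumw fun _ b t _ => 2 ^ (insert b t).card *
      (Real.exp (min (y ^ 2 / ((insert b t).card : ℝ)) y) - 1)
    rw [h]
    set EE := Real.exp (12 / ζ * y ^ 2 / Fintype.card ι) - 1 with hEE
    have hb : ∀ ξ b, ∑ t ∈ (Finset.univ.erase b).powerset, (∑ π : Equiv.Perm κ,
          if pt ξ (π (e b)) = x then ((ζ / 2) ^ t.card *
            (1 - ζ) ^ ((Finset.univ.erase b).card - t.card)) * (2 ^ (insert b t).card *
      (Real.exp (min (y ^ 2 / ((insert b t).card : ℝ)) y) - 1)) else 0) ≤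
        (∑ π : Equiv.Perm κ, if pt ξ (π (e b)) = x then (1 : ℝ) else 0) * (2 * EE) := by
      intro ξ b
      rw [Finset.sum_comm, Finset.sum_mul]
      refine Finset.sum_le_sum fun π _ => ?_
      split_ifs
      · rw [one_mul]
        have hb := binomial_exp_min_le (Finset.univ.erase b) hζ hζ1.le hy0
        have hcard : (((Finset.univ.erase b).card : ℕ) : ℝ) + 1 = Fintype.card ι := by
          rw [Finset.card_erase_of_mem (Finset.mem_univ b), Finset.card_univ]
          have : 0 < Fintype.card ι := Fintype.card_pos_iff.2 ⟨b⟩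
          rw [Nat.cast_sub this]; simp
        rw [hcard, ← hEE] at hb
        refine le_trans (le_of_eq ?_) (mul_le_mul_of_nonneg_left hb (by norm_num : (0 : ℝ) ≤ 2))
        rw [Finset.mul_sum]
        refine Finset.sum_congr rfl fun t ht => ?_
        rw [powerset_erase_eq_filter, Finset.mem_filter] at ht
        -- `2 ^ |J|` cancels the halves in `(ζ / 2) ^ |t|` and leaves binomial weights, apart from
        -- one factor `2` due to `|J| = |t| + 1`. This is the factor `2` in the conclusion.
        rw [Finset.card_insert_of_notMem ht.2, div_pow, pow_succ]
        field_simp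
      · simp
    have hEE0 : 0 ≤ EE := by
      have : 0 ≤ 12 / ζ * y ^ 2 / Fintype.card ι := by positivity
      linarith [Real.one_le_exp this]
    calc _ ≤ c / γ * ∑ ξ, ∑ b, (∑ π : Equiv.Perm κ,
            if pt ξ (π (e b)) = x then (1 : ℝ) else 0) * (2 * EE) := by
          refine mul_le_mul_of_nonneg_left ?_ (by positivity)
          exact Finset.sum_le_sum fun ξ _ => Finset.sum_le_sum fun b _ => hb ξ b
      _ = (c * ∑ ξ, ∑ b, ∑ π : Equiv.Perm κ,
            (if pt ξ (π (e b)) = x then (1 : ℝ) else 0)) / γ * (2 * EE) := by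
          simp_rw [← Finset.sum_mul]; ring
      _ ≤ 1 * (2 * EE) :=
          mul_le_mul_of_nonneg_right ((div_le_one hγ).2 hmass) (by positivity)
      _ = _ := one_mul _

/-! ### Selections of the clients -/

instance (r s : ℕ) : Fintype (ClientSample r s) :=
  inferInstanceAs (Fintype {U : Finset (Fin r) // U.card = s})

lemma ClientSample.nonempty {r s : ℕ} (h : s ≤ r) : Nonempty (ClientSample r s) := by
  obtain ⟨U, -, hU⟩ := Finset.exists_subset_card_eq
    (s := (Finset.univ : Finset (Fin r))) (n := s) (by simpa using h)
  exact ⟨⟨U, hU⟩⟩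

/-- The data point in slot `q`, for the selections `U`. -/
def slotPoint {n r s : ℕ} (U : Fin n → ClientSample r s) (q : Fin (n * s)) : Fin n × Fin r :=
  ((finProdFinEquiv.symm q).1,
    (U (finProdFinEquiv.symm q).1).1.orderEmbOfFin (U (finProdFinEquiv.symm q).1).2
      (finProdFinEquiv.symm q).2)

lemma slotPoint_injective {n r s : ℕ} (U : Fin n → ClientSample r s) :
    Function.Injective (slotPoint U) := by
  have h : Function.Injective fun z : Fin n × Fin s =>
      (z.1, (U z.1).1.orderEmbOfFin (U z.1).2 z.2) := by
    rintro ⟨i, a⟩ ⟨i', a'⟩ h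
    simp only [Prod.mk.injEq] at h
    obtain ⟨rfl, h2⟩ := h
    rw [((U i).1.orderEmbOfFin (U i).2).injective h2]
  exact h.comp finProdFinEquiv.symm.injective

lemma exists_slotPoint_eq_iff {n r s : ℕ} (U : Fin n → ClientSample r s) (z : Fin n × Fin r) :
    (∃ q, slotPoint U q = z) ↔ z.2 ∈ (U z.1).1 := by
  constructor
  · rintro ⟨q, rfl⟩
    exact Finset.orderEmbOfFin_mem _ _ _
  · intro h
    have : z.2 ∈ Set.range ((U z.1).1.orderEmbOfFin (U z.1).2) := by
      rw [Finset.range_orderEmbOfFin]; exact h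
    obtain ⟨a, ha⟩ := this
    refine ⟨finProdFinEquiv (z.1, a), ?_⟩
    simp only [slotPoint, Equiv.symm_apply_apply]
    exact Prod.ext rfl ha

/-- Exchange the points `j` and `c` in a selection. -/
def ClientSample.swap {r s : ℕ} (j c : Fin r) (V : ClientSample r s) : ClientSample r s :=
  ⟨V.1.map (Equiv.swap j c).toEmbedding, by rw [Finset.card_map]; exact V.2⟩

lemma ClientSample.mem_swap {r s : ℕ} (j c j' : Fin r) (V : ClientSample r s) :
    j' ∈ (V.swap j c).1 ↔ Equiv.swap j c j' ∈ V.1 := by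
  simp [ClientSample.swap, Finset.mem_map_equiv]

/-- Exchange the points `j` and `c` of client `i` in the selections. -/
def selectionSwap {n r s : ℕ} (i : Fin n) (j c : Fin r) (U : Fin n → ClientSample r s) :
    Fin n → ClientSample r s :=
  Function.update U i ((U i).swap j c)

lemma mem_selectionSwap {n r s : ℕ} (i : Fin n) (j c : Fin r) (U : Fin n → ClientSample r s)
    (z : Fin n × Fin r) :
    z.2 ∈ (selectionSwap i j c U z.1).1 ↔
      (Equiv.swap (i, j) (i, c) z).2 ∈ (U (Equiv.swap (i, j) (i, c) z).1).1 := by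
  obtain ⟨i', j'⟩ := z
  by_cases hi : i' = i
  · subst hi
    have e : Equiv.swap (i', j) (i', c) (i', j') = (i', Equiv.swap j c j') := by
      simp only [Equiv.swap_apply_def, Prod.mk.injEq, true_and]
      split_ifs <;> rfl
    rw [e]
    simp only [selectionSwap, Function.update_self, ClientSample.mem_swap]
  · have e : Equiv.swap (i, j) (i, c) (i', j') = (i', j') :=
      Equiv.swap_apply_of_ne_of_ne (by simp [hi]) (by simp [hi])
    rw [e]
    simp [selectionSwap, hi]

lemma selectionSwap_involutive {n r s : ℕ} (i : Fin n) (j c : Fin r) :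
    Function.Involutive (selectionSwap (s := s) i j c) := by
  intro U
  funext i'
  apply Subtype.ext
  ext j'
  rw [mem_selectionSwap i j c _ (i', j'), mem_selectionSwap]
  simp

/-- Choosing preimages of the values of `ψ` under `φ` gives an injective, hence bijective, self-map
of a finite type. -/
lemma exists_perm_comp_eq {κ Z : Type*} [Finite κ] {φ ψ : κ → Z}
    (hψ : Function.Injective ψ) (h : ∀ z, (∃ q, φ q = z) ↔ ∃ q, ψ q = z) :
    ∃ ρ : Equiv.Perm κ, ∀ q, φ (ρ q) = ψ q := by
  choose g hg using fun q => (h (ψ q)).2 ⟨q, rfl⟩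
  have hinj : Function.Injective g := fun a b hab => hψ (by rw [← hg a, ← hg b, hab])
  exact ⟨Equiv.ofBijective g (Finite.injective_iff_bijective.1 hinj), hg⟩

/-- A selection is listed in increasing order, so changing one of its points may shift many slots.
The sum over all permutations sees only the set of selected points, so the change amounts to
renaming two points in place. -/
lemma sum_perm_selectionSwap {n r s : ℕ} {ι : Type*} [Fintype ι] (e : ι → Fin (n * s))
    (i : Fin n) (j c : Fin r) (U : Fin n → ClientSample r s) (f : Fin n × Fin r → ι → ℝ) :
    ∑ π : Equiv.Perm (Fin (n * s)), ∏ b, f (slotPoint (selectionSwap i j c U) (π (e b))) b =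
      ∑ π : Equiv.Perm (Fin (n * s)),
        ∏ b, f (Equiv.swap (i, j) (i, c) (slotPoint U (π (e b)))) b := by
  obtain ⟨ρ, hρ⟩ := exists_perm_comp_eq (φ := slotPoint (selectionSwap i j c U))
    ((Equiv.swap (i, j) (i, c)).injective.comp (slotPoint_injective U)) (fun z => by
      rw [exists_slotPoint_eq_iff, mem_selectionSwap, ← exists_slotPoint_eq_iff]
      constructor
      · rintro ⟨q, hq⟩
        exact ⟨q, by simp [hq]⟩
      · rintro ⟨q, hq⟩
        exact ⟨q, by simp [← hq]⟩)
  rw [← Equiv.sum_comp (Equiv.mulLeft ρ)]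
  refine Finset.sum_congr rfl fun π _ => Finset.prod_congr rfl fun b _ => ?_
  simp only [Equiv.coe_mulLeft, Equiv.Perm.mul_apply, hρ, Function.comp]

/-- Requiring a point to be selected costs a factor `s / r`. -/
lemma mul_sum_selected_le {n r s : ℕ} (x : Fin n × Fin r) {K : ℝ}
    (W : (Fin n → ClientSample r s) → ℝ) (h : ∀ c U, W U ≤ K * W (selectionSwap x.1 x.2 c U)) :
    (r : ℝ) * (∑ U, if x.2 ∈ (U x.1).1 then W U else 0) ≤ K * s * ∑ U, W U := by
  have h1 : ∀ c : Fin r, (∑ U, if x.2 ∈ (U x.1).1 then W U else 0) ≤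
      ∑ U, if c ∈ (U x.1).1 then K * W U else 0 := by
    intro c
    calc (∑ U, if x.2 ∈ (U x.1).1 then W U else 0)
        ≤ ∑ U, if x.2 ∈ (U x.1).1 then K * W (selectionSwap x.1 x.2 c U) else 0 := by
          refine Finset.sum_le_sum fun U _ => ?_
          split_ifs
          · exact h c U
          · exact le_rfl
      _ = ∑ U, if c ∈ (U x.1).1 then K * W U else 0 := by
          rw [← Equiv.sum_comp (selectionSwap_involutive (s := s) x.1 x.2 c).toPerm]
          refine Finset.sum_congr rfl fun U _ => ?_
          simp only [Function.Involutive.coe_toPerm]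
          rw [selectionSwap_involutive x.1 x.2 c U]
          have := mem_selectionSwap x.1 x.2 c U x
          rw [show Equiv.swap (x.1, x.2) (x.1, c) x = (x.1, c) from Equiv.swap_apply_left _ _] at this
          simp only [this]
  calc (r : ℝ) * (∑ U, if x.2 ∈ (U x.1).1 then W U else 0)
      = ∑ c : Fin r, ∑ U : Fin n → ClientSample r s, if x.2 ∈ (U x.1).1 then W U else 0 := by simp
    _ ≤ ∑ c : Fin r, ∑ U : Fin n → ClientSample r s, if c ∈ (U x.1).1 then K * W U else 0 :=
        Finset.sum_le_sum fun c _ => h1 c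
    _ = ∑ U : Fin n → ClientSample r s, ∑ c : Fin r, if c ∈ (U x.1).1 then K * W U else 0 :=
        Finset.sum_comm
    _ = _ := by
        rw [Finset.mul_sum]
        refine Finset.sum_congr rfl fun U _ => ?_
        -- Each selection of a client has exactly `s` points; hence the factor `s` after summing
        -- over `c`.
        rw [Finset.sum_ite_mem, Finset.univ_inter, Finset.sum_const, (U x.1).2, nsmul_eq_mul]
        ring

/-- Requiring a point to be revealed costs a factor `γ = (B / N) (s / r)`. -/
lemma sum_revealed_le {n r s : ℕ} {ι : Type*} [Fintype ι] (e : ι → Fin (n * s))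
    (hn : 0 < n) (hs : 0 < s) (x : Fin n × Fin r) {K : ℝ} (hK : 0 ≤ K)
    (g : (Fin n → ClientSample r s) → Equiv.Perm (Fin (n * s)) → ℝ)
    (hg : ∀ U π b c, g U (π * Equiv.swap (e b) c) ≤ K * g U π)
    (hW : ∀ c U, ∑ π, g U π ≤ K * ∑ π, g (selectionSwap x.1 x.2 c U) π) :
    ∑ U, ∑ b, ∑ π, (if slotPoint U (π (e b)) = x then g U π else 0) ≤
      K ^ 2 * (Fintype.card ι / (n * s) * (s / r)) * ∑ U, ∑ π, g U π := by
  have hr : (0 : ℝ) < r := by exact_mod_cast (Fin.pos x.2)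
  have hN : (0 : ℝ) < (n : ℝ) * s := by positivity
  have h1 : ∀ U b, ∑ π, (if slotPoint U (π (e b)) = x then g U π else 0) ≤
      if x.2 ∈ (U x.1).1 then K / (n * s) * ∑ π, g U π else 0 := by
    intro U b
    -- If `x` is selected it occupies one slot, and revealing it is pinning that slot. If it is not
    -- selected, no permutation shows it.
    split_ifs with hx
    · obtain ⟨q, hq⟩ := (exists_slotPoint_eq_iff U x).2 hx
      have h := card_mul_sum_perm_pinned_le (g U) (e b) q (fun π c => hg U π b c)
      rw [Fintype.card_fin] at h
      push_cast at h
      rw [div_mul_eq_mul_div, le_div_iff₀ hN, mul_comm]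
      refine le_trans (le_of_eq ?_) h
      congr 1
      refine Finset.sum_congr rfl fun π _ => ?_
      rw [← hq]
      simp only [(slotPoint_injective U).eq_iff]
    · refine le_of_eq (Finset.sum_eq_zero fun π _ => if_neg fun h => hx ?_)
      exact (exists_slotPoint_eq_iff U x).1 ⟨_, h⟩
  have h2 := mul_sum_selected_le x (fun U => ∑ π, g U π) hW
  calc ∑ U, ∑ b, ∑ π, (if slotPoint U (π (e b)) = x then g U π else 0)
      ≤ ∑ U : Fin n → ClientSample r s, ∑ b : ι,
          (if x.2 ∈ (U x.1).1 then K / (n * s) * ∑ π, g U π else 0) :=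
        Finset.sum_le_sum fun U _ => Finset.sum_le_sum fun b _ => h1 U b
    _ = Fintype.card ι * (K / (n * s)) *
          (∑ U : Fin n → ClientSample r s, if x.2 ∈ (U x.1).1 then ∑ π, g U π else 0) := by
        rw [Finset.mul_sum]
        refine Finset.sum_congr rfl fun U _ => ?_
        rw [Finset.sum_const, Finset.card_univ, nsmul_eq_mul]
        split_ifs
        · ring
        · ring
    _ ≤ Fintype.card ι * (K / (n * s)) * (K * s * (∑ U, ∑ π, g U π) / r) := by
        refine mul_le_mul_of_nonneg_left ?_ (by positivity)
        rw [le_div_iff₀ hr, mul_comm]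
        exact h2
    _ = _ := by field_simp

/-! ### Likelihood of the revealed signs -/

/-- The average over selections and permutations of the product of the likelihoods `f z b` of
the point `z` at the position `b`. -/
noncomputable def mixedLikelihood {n r k s : ℕ} (hk : k ≤ n)
    (f : Fin n × Fin r → Fin (k * s) → ℝ) : ℝ :=
  ((Fintype.card (Fin n → ClientSample r s) : ℝ) *
      Fintype.card (Equiv.Perm (Fin (n * s))))⁻¹ *
    ∑ U : Fin n → ClientSample r s, ∑ π : Equiv.Perm (Fin (n * s)),
      ∏ b, f (slotPoint U (π (Fin.castLE (Nat.mul_le_mul_right s hk) b))) b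

section

variable {n r k s : ℕ} (hk : k ≤ n)

lemma mixedLikelihood_const_pos (hsr : s ≤ r) :
    0 < ((Fintype.card (Fin n → ClientSample r s) : ℝ) *
      Fintype.card (Equiv.Perm (Fin (n * s))))⁻¹ := by
  have := ClientSample.nonempty hsr
  have h1 : 0 < Fintype.card (Fin n → ClientSample r s) := Fintype.card_pos
  have h2 : 0 < Fintype.card (Equiv.Perm (Fin (n * s))) := Fintype.card_pos
  positivity

lemma mixedLikelihood_pos (hsr : s ≤ r) {f : Fin n × Fin r → Fin (k * s) → ℝ}
    (hf : ∀ z b, 0 < f z b) : 0 < mixedLikelihood hk f := by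
  have := ClientSample.nonempty hsr
  refine mul_pos (mixedLikelihood_const_pos hsr) ?_
  refine Finset.sum_pos (fun U _ => Finset.sum_pos (fun π _ => Finset.prod_pos fun b _ => hf _ _)
    Finset.univ_nonempty) Finset.univ_nonempty

lemma sum_mixedLikelihood (hsr : s ≤ r) {f : Fin n × Fin r → Fin (k * s) → Bool → ℝ}
    (hf : ∀ z b, f z b true + f z b false = 1) :
    ∑ ω : Fin (k * s) → Bool, mixedLikelihood hk (fun z b => f z b (ω b)) = 1 := by
  have := ClientSample.nonempty hsr
  simp only [mixedLikelihood]
  rw [← Finset.mul_sum, Finset.sum_comm]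
  have : ∀ U : Fin n → ClientSample r s, ∑ ω : Fin (k * s) → Bool,
      ∑ π : Equiv.Perm (Fin (n * s)),
      ∏ b, f (slotPoint U (π (Fin.castLE (Nat.mul_le_mul_right s hk) b))) b (ω b) =
      Fintype.card (Equiv.Perm (Fin (n * s))) := by
    intro U
    rw [Finset.sum_comm]
    simp_rw [sum_bool_prod (fun b => f (slotPoint U _) b), hf]
    simp
  simp_rw [this]
  rw [Finset.sum_const, Finset.card_univ, nsmul_eq_mul]
  exact inv_mul_cancel₀ (inv_pos.1 (mixedLikelihood_const_pos hsr)).ne'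

/-- The Rényi moment of one iteration for fixed seeds. -/
theorem sum_mixedLikelihood_rpow_le (h1k : 1 ≤ k) (h1s : 1 ≤ s) (hsr : s ≤ r)
    (x : Fin n × Fin r) (f f' : Fin n × Fin r → Fin (k * s) → Bool → ℝ)
    (heq : ∀ z, z ≠ x → f z = f' z) (hf : ∀ z b, f z b true + f z b false = 1)
    (hf' : ∀ z b, f' z b true + f' z b false = 1) {ζ τ α : ℝ} (hζ : 0 < ζ) (hζ1 : ζ < 1)
    (hfζ : ∀ z b s, ζ / 2 ≤ f z b s) (hfζ' : ∀ z b s, ζ / 2 ≤ f' z b s)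
    (hτ : ∀ b s, |f x b s - f' x b s| ≤ τ) (hα : 1 < α) :
    ∑ ω : Fin (k * s) → Bool, mixedLikelihood hk (fun z b => f' z b (ω b)) *
        (mixedLikelihood hk (fun z b => f z b (ω b)) /
          mixedLikelihood hk (fun z b => f' z b (ω b))) ^ α ≤
      Real.exp ((α - 1) * (α * (768 * ((2 - ζ) / ζ) ^ 8 / ζ ^ 3 *
        (((k : ℝ) * s / (n * r)) * τ) ^ 2 / (k * s)))) := by
  have hn : 0 < n := by omega
  have hr : 0 < r := by omega
  have hk0 : (0 : ℝ) < k := by exact_mod_cast h1k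
  have hs0 : (0 : ℝ) < s := by exact_mod_cast h1s
  have hn0 : (0 : ℝ) < n := by exact_mod_cast hn
  have hr0 : (0 : ℝ) < r := by exact_mod_cast hr
  set γ : ℝ := (k : ℝ) * s / (n * r) with hγ
  have hγ0 : 0 < γ := by positivity
  -- The largest ratio of two sign probabilities, `(1 - ζ / 2) / (ζ / 2)`.
  set K : ℝ := (2 - ζ) / ζ with hKdef
  have hK1 : 1 ≤ K := by rw [hKdef, one_le_div hζ]; linarith
  have hK0 : 0 < K := by linarith
  set e : Fin (k * s) → Fin (n * s) := Fin.castLE (Nat.mul_le_mul_right s hk) with he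
  have heinj : Function.Injective e := Fin.castLE_injective _
  set c := ((Fintype.card (Fin n → ClientSample r s) : ℝ) *
      Fintype.card (Equiv.Perm (Fin (n * s))))⁻¹ with hc
  have hc0 : 0 < c := mixedLikelihood_const_pos hsr
  have hB : (Fintype.card (Fin (k * s)) : ℝ) = k * s := by simp
  have hγ' : (Fintype.card (Fin (k * s)) : ℝ) / (n * s) * (s / r) = γ := by
    rw [hB, hγ]; field_simp
  have hfpos : ∀ z b s, 0 < f z b s := fun z b s => by linarith [hfζ z b s]
  have hfpos' : ∀ z b s, 0 < f' z b s := fun z b s => by linarith [hfζ' z b s]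
  have hratio : ∀ z z' b s, f' z b s ≤ K * f' z' b s := by
    intro z z' b s
    have h1 : f' z b s ≤ 1 - ζ / 2 := by
      have := hf' z b
      have h2 := hfζ' z b true
      have h3 := hfζ' z b false
      cases s <;> linarith
    calc f' z b s ≤ K * (ζ / 2) := by rw [hKdef]; field_simp; linarith
      _ ≤ _ := mul_le_mul_of_nonneg_left (hfζ' z' b s) hK0.le
  -- Both exchanges, of positions and of selected points, cost `K ^ 2`; together this gives `K ^ 4`.
  have hdom : ∀ ω : Fin (k * s) → Bool, c * ∑ U : Fin n → ClientSample r s, ∑ b,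
      ∑ π : Equiv.Perm (Fin (n * s)), (if slotPoint U (π (e b)) = x then
        ∏ b', f' (slotPoint U (π (e b'))) b' (ω b') else 0) ≤
      K ^ 4 * γ * (c * ∑ U : Fin n → ClientSample r s, ∑ π : Equiv.Perm (Fin (n * s)),
        ∏ b, f' (slotPoint U (π (e b))) b (ω b)) := by
    intro ω
    have h := sum_revealed_le e hn h1s x (K := K ^ 2) (by positivity)
      (fun U π => ∏ b', f' (slotPoint U (π (e b'))) b' (ω b')) (fun U π b c' => ?_) fun c' U => ?_
    · rw [hγ'] at h
      calc _ ≤ c * ((K ^ 2) ^ 2 * γ * ∑ U : Fin n → ClientSample r s,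
            ∑ π : Equiv.Perm (Fin (n * s)), ∏ b, f' (slotPoint U (π (e b))) b (ω b)) :=
            mul_le_mul_of_nonneg_left h hc0.le
        _ = _ := by ring
    · refine prod_le_sq_mul_prod (f := fun z b => f' z b (ω b)) (fun z b => hfpos' _ _ _)
        (fun z z' b => hratio z z' b _) hK1
        (Finset.univ.filter fun b' => e b' = e b ∨ e b' = c') ?_ fun b' hb' => ?_
      · rw [← Finset.card_image_of_injective _ heinj]
        refine (Finset.card_le_card (t := {e b, c'}) fun q hq => ?_).trans Finset.card_le_two
        simp only [Finset.mem_image, Finset.mem_filter, Finset.mem_univ, true_and] at hq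
        obtain ⟨b', hb', rfl⟩ := hq
        simpa using hb'
      · simp only [Finset.mem_filter, Finset.mem_univ, true_and, not_or] at hb'
        rw [Equiv.Perm.mul_apply, Equiv.swap_apply_of_ne_of_ne hb'.1 hb'.2]
    · rw [sum_perm_selectionSwap e x.1 x.2 c' U (fun z b => f' z b (ω b)), Finset.mul_sum]
      refine Finset.sum_le_sum fun π _ => ?_
      have hinj : Function.Injective fun b => slotPoint U (π (e b)) :=
        (slotPoint_injective U).comp (π.injective.comp heinj)
      refine prod_le_sq_mul_prod (f := fun z b => f' z b (ω b)) (fun z b => hfpos' _ _ _)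
        (fun z z' b => hratio z z' b _) hK1
        (Finset.univ.filter fun b' => slotPoint U (π (e b')) = (x.1, x.2) ∨
          slotPoint U (π (e b')) = (x.1, c')) ?_ fun b' hb' => ?_
      · rw [← Finset.card_image_of_injective _ hinj]
        refine (Finset.card_le_card (t := {(x.1, x.2), (x.1, c')}) fun q hq => ?_).trans
          Finset.card_le_two
        simp only [Finset.mem_image, Finset.mem_filter, Finset.mem_univ, true_and] at hq
        obtain ⟨b', hb', rfl⟩ := hq
        simpa using hb'
      · simp only [Finset.mem_filter, Finset.mem_univ, true_and, not_or] at hb'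
        rw [Equiv.swap_apply_of_ne_of_ne hb'.1 hb'.2]
  -- The same argument for constant likelihoods, where exchanges cost nothing: the exact probability
  -- of revealing `x`.
  have hmass : c * ∑ U : Fin n → ClientSample r s, ∑ b, ∑ π : Equiv.Perm (Fin (n * s)),
      (if slotPoint U (π (e b)) = x then (1 : ℝ) else 0) ≤ γ := by
    have h := sum_revealed_le (r := r) e hn h1s x (K := 1) zero_le_one (fun _ _ => 1)
      (fun _ _ _ _ => by simp) (fun _ _ => by simp)
    rw [hγ'] at h
    calc _ ≤ c * (1 ^ 2 * γ * ∑ U : Fin n → ClientSample r s,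
          ∑ π : Equiv.Perm (Fin (n * s)), (1 : ℝ)) := mul_le_mul_of_nonneg_left h hc0.le
      _ = c * c⁻¹ * γ := by
          rw [hc, inv_inv]
          simp only [Finset.sum_const, Finset.card_univ, nsmul_eq_mul]
          ring
      _ = γ := by rw [mul_inv_cancel₀ hc0.ne', one_mul]
  have hne : ∃ (U : Fin n → ClientSample r s) (b : Fin (k * s)) (π : Equiv.Perm (Fin (n * s))),
      slotPoint U (π (e b)) = x := by
    obtain ⟨V⟩ := ClientSample.nonempty hsr
    have hb : 0 < k * s := by positivity
    have hVne : V.1.Nonempty := by rw [← Finset.card_pos, V.2]; omega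
    obtain ⟨j, hj⟩ := hVne
    have hx : x.2 ∈ (selectionSwap x.1 x.2 j (fun _ => V) x.1).1 := by
      rw [mem_selectionSwap, show Equiv.swap (x.1, x.2) (x.1, j) x = (x.1, j) from
        Equiv.swap_apply_left _ _]
      exact hj
    obtain ⟨q, hq⟩ := (exists_slotPoint_eq_iff _ x).2 hx
    exact ⟨_, ⟨0, hb⟩, Equiv.swap (e ⟨0, hb⟩) q, by simpa using hq⟩
  set P : (Fin (k * s) → Bool) → ℝ := fun ω => mixedLikelihood hk (fun z b => f z b (ω b)) with hP
  set Q : (Fin (k * s) → Bool) → ℝ := fun ω => mixedLikelihood hk (fun z b => f' z b (ω b)) with hQ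
  have hP0 : ∀ ω, 0 < P ω := fun ω => mixedLikelihood_pos hk hsr fun z b => hfpos _ _ _
  have hQ0 : ∀ ω, 0 < Q ω := fun ω => mixedLikelihood_pos hk hsr fun z b => hfpos' _ _ _
  have hP1 : ∑ ω, P ω = 1 := sum_mixedLikelihood hk hsr hf
  have hQ1 : ∑ ω, Q ω = 1 := sum_mixedLikelihood hk hsr hf'
  -- With dominating constant `K ^ 4` and lower bound `ζ / 2`, the cosh estimate has exponent `48 K
  -- ^ 8 / ζ ^ 3 · (t γ τ)² / B = t² G / 16`.
  set G : ℝ := 768 * K ^ 8 / ζ ^ 3 * (γ * τ) ^ 2 / (k * s) with hG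
  have hG0 : 0 ≤ G := by positivity
  have hge : ∀ t : ℝ, 0 ≤ t → ∑ ω, Q ω * (P ω / Q ω) ^ t ≤ Real.exp (t ^ 2 * (G / 4)) := by
    intro t ht
    have h := shuffle_cosh_moment_le heinj (pt := slotPoint (n := n) (r := r) (s := s))
      slotPoint_injective x f f' heq hf hf' hζ hζ1 hfζ' hτ
      (one_le_pow₀ hK1 : 1 ≤ K ^ 4) hc0 hγ0 ht hne hmass hdom
    have h2 := sum_rpow_ratio_le P Q hP0 hQ0 hP1 hQ1 ht
    have e1 : 12 / ζ * (K ^ 4 / (ζ / 2) * (t * γ) * τ) ^ 2 / (Fintype.card (Fin (k * s)) : ℝ) =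
        t ^ 2 * (G / 16) := by
      rw [hB, hG]; field_simp; ring
    rw [e1] at h
    set z := t ^ 2 * (G / 16) with hz
    have hz0 : 0 ≤ z := by positivity
    have h3 : ∑ ω, Q ω * (P ω / Q ω) ^ t ≤ 1 + 4 * (Real.exp z - 1) := by
      refine h2.trans ?_
      have : ∑ ω, Q ω * (Real.cosh (t * (P ω - Q ω) / Q ω) - 1) ≤ 2 * (Real.exp z - 1) := h
      linarith
    refine h3.trans ?_
    -- Bernoulli's inequality in the form `1 + 4 (e^z - 1) ≤ e^(4 z)` absorbs the factor in front.
    have e2 : t ^ 2 * (G / 4) = ((4 : ℕ) : ℝ) * z := by rw [hz]; push_cast; ring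
    rw [e2, Real.exp_nat_mul]
    have h4 := one_add_mul_le_pow (a := Real.exp z - 1)
      (by linarith [Real.exp_pos z] : (-2 : ℝ) ≤ Real.exp z - 1) 4
    simpa using h4
  -- The target exponent `(α - 1) α G` degenerates at `α = 1`, unlike `α² G / 4`. For `α ≥ 2` there
  -- is room to spare; below `2` the second moment is interpolated, which produces the factor `α -
  -- 1`.
  rcases le_or_gt 2 α with h2 | h2
  · refine (hge α (by linarith)).trans (Real.exp_le_exp.2 ?_)
    have h3 : 0 ≤ α * G * (3 / 4 * α - 1) :=
      mul_nonneg (by positivity) (by linarith)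
    nlinarith [h3]
  · refine (sum_rpow_ratio_interpolate P Q hP0 hQ0 hP1 hα h2).trans ?_
    calc (∑ ω, Q ω * (P ω / Q ω) ^ (2 : ℝ)) ^ (α - 1)
        ≤ (Real.exp (2 ^ 2 * (G / 4))) ^ (α - 1) := by
          refine Real.rpow_le_rpow ?_ (hge 2 (by norm_num)) (by linarith)
          exact Finset.sum_nonneg fun ω _ => by
            have := hP0 ω
            have := hQ0 ω
            positivity
      _ = Real.exp ((α - 1) * G) := by rw [← Real.exp_mul]; congr 1; ring
      _ ≤ _ := Real.exp_le_exp.2 (mul_le_mul_of_nonneg_left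
          (le_mul_of_one_le_left hG0 hα.le) (by linarith))

end

/-! ### The law of a message -/

lemma volume_Iic_keep (κ : ℝ) (h0 : 0 ≤ κ) (h1 : κ ≤ 1) :
    (volume : Measure I) {b | (b : ℝ) ≤ κ} = ENNReal.ofReal κ := by
  have : {b : I | (b : ℝ) ≤ κ} = Set.Iic ⟨κ, h0, h1⟩ := by
    ext b; simp [← Subtype.coe_le_coe]
  rw [this, unitInterval.volume_Iic]

section Message

variable {d : ℕ} {S : Type v}

@[fun_prop]
lemma measurable_roundToSphere (L : ℝ) :
    Measurable fun p : I × Vec d => roundToSphere L p.1 p.2 := by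
  unfold roundToSphere
  refine Measurable.ite (measurableSet_le ?_ ?_) ?_ ?_ <;> fun_prop

@[fun_prop]
lemma measurable_keepSign (ε₀ : ℝ) : Measurable (keepSign ε₀) := by
  unfold keepSign
  have : MeasurableSet {b : I | (b : ℝ) ≤ Real.exp ε₀ / (Real.exp ε₀ + 1)} :=
    measurableSet_le (by fun_prop) (by fun_prop)
  refine measurable_to_bool ?_
  convert this using 1
  ext; simp

lemma measurable_noisyGradCmpr [MeasurableSpace S] {expand : S → Vec d} (he : Measurable expand) (ε₀ L : ℝ) :
    Measurable fun p : LocalCoins S × Vec d => noisyGradCmpr expand ε₀ L p.1 p.2 := by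
  unfold noisyGradCmpr
  have h1 : Measurable fun p : LocalCoins S × Vec d =>
      inner ℝ (expand p.1.2.2) (roundToSphere L p.1.1 p.2) := by
    refine Measurable.inner (by fun_prop) ?_
    exact (measurable_roundToSphere L).comp (by fun_prop : Measurable
      fun p : LocalCoins S × Vec d => (p.1.1, p.2))
  refine Measurable.prodMk (Measurable.ite (measurableSet_lt h1 measurable_const) ?_ ?_)
    (by fun_prop)
  · exact (measurable_of_finite fun b : Bool => !b).comp ((measurable_keepSign ε₀).comp (by fun_prop))
  · exact (measurable_keepSign ε₀).comp (by fun_prop)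

/-- The probability that the sign of the message is `σ`, given the seed. -/
noncomputable def signProb (expand : S → Vec d) (ε₀ L : ℝ) (x : Vec d) (m : Compressed S) : ℝ :=
  (volume : Measure (I × I)).real
    {ab | (noisyGradCmpr expand ε₀ L (ab.1, ab.2, m.2) x).1 = m.1}

lemma measurable_sign_fixed_seed (expand : S → Vec d) (ε₀ L : ℝ) (x : Vec d) (seed : S) :
    Measurable fun ab : I × I => (noisyGradCmpr expand ε₀ L (ab.1, ab.2, seed) x).1 := by
  have h := measurable_noisyGradCmpr (S := Unit) (expand := fun _ => expand seed)
    measurable_const ε₀ L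
  exact (h.comp (by fun_prop : Measurable fun ab : I × I =>
    (((ab.1, ab.2, ()) : LocalCoins Unit), x))).fst

lemma signProb_add (expand : S → Vec d) (ε₀ L : ℝ) (x : Vec d) (seed : S) :
    signProb expand ε₀ L x (true, seed) + signProb expand ε₀ L x (false, seed) = 1 := by
  have hm := measurable_sign_fixed_seed expand ε₀ L x seed
  have h := probReal_add_probReal_compl (μ := (volume : Measure (I × I)))
    (hm (measurableSet_singleton true))
  have e : {ab : I × I | (noisyGradCmpr expand ε₀ L (ab.1, ab.2, seed) x).1 = false} =
      ((fun ab : I × I => (noisyGradCmpr expand ε₀ L (ab.1, ab.2, seed) x).1) ⁻¹' {true})ᶜ := by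
    ext; simp
  rw [signProb, signProb, e]
  exact h

lemma keep_prob_mem (ε₀ : ℝ) : 0 ≤ Real.exp ε₀ / (Real.exp ε₀ + 1) ∧
    Real.exp ε₀ / (Real.exp ε₀ + 1) ≤ 1 := by
  have := Real.exp_pos ε₀
  exact ⟨by positivity, by rw [div_le_one (by positivity)]; linarith⟩

lemma volume_keepSign_eq (ε₀ : ℝ) (c : Bool) :
    (volume : Measure I) {b | keepSign ε₀ b = c} =
      ENNReal.ofReal (if c then Real.exp ε₀ / (Real.exp ε₀ + 1) else (Real.exp ε₀ + 1)⁻¹) := by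
  have hp := Real.exp_pos ε₀
  have h := volume_Iic_keep _ (keep_prob_mem ε₀).1 (keep_prob_mem ε₀).2
  cases c
  · have hm : MeasurableSet {b : I | (b : ℝ) ≤ Real.exp ε₀ / (Real.exp ε₀ + 1)} :=
      measurableSet_le (by fun_prop) (by fun_prop)
    have e : {b : I | keepSign ε₀ b = false} =
        {b : I | (b : ℝ) ≤ Real.exp ε₀ / (Real.exp ε₀ + 1)}ᶜ := by
      ext; simp [keepSign]
    rw [e, prob_compl_eq_one_sub hm, h, ← ENNReal.ofReal_one, ← ENNReal.ofReal_sub _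
      (keep_prob_mem ε₀).1]
    congr 1
    simp only [Bool.false_eq_true, if_false]
    field_simp
    ring
  · have e : {b : I | keepSign ε₀ b = true} =
        {b : I | (b : ℝ) ≤ Real.exp ε₀ / (Real.exp ε₀ + 1)} := by
      ext; simp [keepSign]
    rw [e, h]
    simp

/-- Whatever the rounding gives, a prescribed sign is attained by exactly one value of the
randomizing bit `U`, and both values have probability at least `1 / (e^ε₀ + 1)`. -/
lemma le_signProb (expand : S → Vec d) {ε₀ : ℝ} (hε : 0 ≤ ε₀) (L : ℝ) (x : Vec d)
    (m : Compressed S) : (Real.exp ε₀ + 1)⁻¹ ≤ signProb expand ε₀ L x m := by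
  have hp := Real.exp_pos ε₀
  have hm := measurable_sign_fixed_seed expand ε₀ L x m.2 (measurableSet_singleton m.1)
  rw [signProb, measureReal_def]
  refine (ENNReal.ofReal_le_iff_le_toReal (measure_ne_top _ _)).1 ?_
  change _ ≤ (volume.prod volume : Measure (I × I)) _
  rw [show {ab : I × I | (noisyGradCmpr expand ε₀ L (ab.1, ab.2, m.2) x).1 = m.1} =
    (fun ab : I × I => (noisyGradCmpr expand ε₀ L (ab.1, ab.2, m.2) x).1) ⁻¹' {m.1} from rfl,
    Measure.prod_apply hm]
  calc ENNReal.ofReal (Real.exp ε₀ + 1)⁻¹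
      = ∫⁻ _ : I, ENNReal.ofReal (Real.exp ε₀ + 1)⁻¹ := by simp
    _ ≤ _ := by
        refine lintegral_mono fun a => ?_
        have hle : ∀ c : Bool, ENNReal.ofReal (Real.exp ε₀ + 1)⁻¹ ≤
            (volume : Measure I) {b | keepSign ε₀ b = c} := by
          intro c
          rw [volume_keepSign_eq]
          refine ENNReal.ofReal_le_ofReal ?_
          cases c
          · simp
          · simp only [if_true]
            rw [inv_eq_one_div]
            gcongr
            exact Real.one_le_exp hε
        by_cases hin : inner ℝ (expand m.2) (roundToSphere L a x) < 0
        · refine (hle (!m.1)).trans (measure_mono fun b hb => ?_)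
          simp only [Set.mem_ofPred_eq] at hb
          simp [noisyGradCmpr, hin, hb]
        · refine (hle m.1).trans (measure_mono fun b hb => ?_)
          simp only [Set.mem_ofPred_eq] at hb
          simp [noisyGradCmpr, hin, hb]

variable [MeasurableSpace S]

lemma measurable_signProb {expand : S → Vec d} (he : Measurable expand) (ε₀ L : ℝ) :
    Measurable fun p : Vec d × Compressed S => signProb expand ε₀ L p.1 p.2 := by
  have h : Measurable fun q : (Vec d × Compressed S) × (I × I) =>
      (noisyGradCmpr expand ε₀ L (q.2.1, q.2.2, q.1.2.2) q.1.1).1 :=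
    ((measurable_noisyGradCmpr he ε₀ L).comp (by fun_prop : Measurable
      fun q : (Vec d × Compressed S) × (I × I) =>
        (((q.2.1, q.2.2, q.1.2.2) : LocalCoins S), q.1.1))).fst
  have hs : MeasurableSet {q : (Vec d × Compressed S) × (I × I) |
      (noisyGradCmpr expand ε₀ L (q.2.1, q.2.2, q.1.2.2) q.1.1).1 = q.1.2.1} :=
    measurableSet_eq_fun h (by fun_prop)
  exact (measurable_measure_prodMk_left (ν := (volume : Measure (I × I))) hs).ennreal_toReal

/-- The reference measure for messages: counting measure on signs, times the law of the seeds. -/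
noncomputable abbrev msgBase (ν : Measure S) : Measure (Compressed S) :=
  (Measure.count : Measure Bool).prod ν

/-- The law of the message sent for the clipped gradient `x`. -/
noncomputable def msgLaw (expand : S → Vec d) (ε₀ L : ℝ) (ν : Measure S) (x : Vec d) :
    Measure (Compressed S) :=
  ((volume : Measure I).prod ((volume : Measure I).prod ν)).map
    fun c => noisyGradCmpr expand ε₀ L c x

lemma measurable_noisyGradCmpr_left {expand : S → Vec d} (he : Measurable expand) (ε₀ L : ℝ)
    (x : Vec d) : Measurable fun c : LocalCoins S => noisyGradCmpr expand ε₀ L c x := by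
  have h := measurable_noisyGradCmpr he ε₀ L
  have h2 : Measurable fun c : LocalCoins S => (c, x) := measurable_prodMk_right
  have h3 := h.comp h2
  rw [Function.comp_def] at h3
  exact h3

lemma isProbabilityMeasure_msgLaw {expand : S → Vec d} (he : Measurable expand) (ε₀ L : ℝ)
    (ν : Measure S) [IsProbabilityMeasure ν] (x : Vec d) :
    IsProbabilityMeasure (msgLaw expand ε₀ L ν x) :=
  Measure.isProbabilityMeasure_map (measurable_noisyGradCmpr_left he ε₀ L x).aemeasurable

/-- The seed is sent unchanged, so its law is untouched; conditionally on it only the sign is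
random. The reference measure depends on neither data nor model, which makes all message laws
comparable. -/
lemma msgLaw_eq_withDensity {expand : S → Vec d} (he : Measurable expand) (ε₀ L : ℝ)
    (ν : Measure S) [IsProbabilityMeasure ν] (x : Vec d) :
    msgLaw expand ε₀ L ν x =
      (msgBase ν).withDensity fun m => ENNReal.ofReal (signProb expand ε₀ L x m) := by
  have hF := measurable_noisyGradCmpr_left he ε₀ L x
  ext A hA
  have hdens : Measurable fun m => ENNReal.ofReal (signProb expand ε₀ L x m) :=
    ((measurable_signProb he ε₀ L).comp (by fun_prop : Measurable
      fun m : Compressed S => (x, m))).ennreal_ofReal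
  -- Reassociating the product makes the seed the outer variable of integration.
  rw [msgLaw, Measure.map_apply hF hA, ← Measure.prodAssoc_prod,
    MeasurableEquiv.map_apply, Measure.prod_apply_symm (MeasurableEquiv.prodAssoc.measurable
      (hF hA)), withDensity_apply _ hA, ← lintegral_indicator hA,
    lintegral_prod_symm' _ (hdens.indicator hA)]
  refine lintegral_congr fun seed => ?_
  rw [lintegral_count, tsum_fintype, Fintype.sum_bool]
  have hm := measurable_sign_fixed_seed expand ε₀ L x seed
  classical
  have hval : ∀ sg : Bool, A.indicator (fun m => ENNReal.ofReal (signProb expand ε₀ L x m))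
      (sg, seed) = if (sg, seed) ∈ A then (volume : Measure (I × I))
        {ab | (noisyGradCmpr expand ε₀ L (ab.1, ab.2, seed) x).1 = sg} else 0 := by
    intro sg
    rw [Set.indicator_apply]
    split_ifs
    · rw [signProb, measureReal_def, ENNReal.ofReal_toReal (measure_ne_top _ _)]
    · rfl
  rw [hval, hval]
  set T : Set (I × I) := {ab | noisyGradCmpr expand ε₀ L (ab.1, ab.2, seed) x ∈ A} with hT
  have hpart : ∀ sg : Bool, (volume : Measure (I × I))
      (T ∩ {ab | (noisyGradCmpr expand ε₀ L (ab.1, ab.2, seed) x).1 = sg}) =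
      if (sg, seed) ∈ A then (volume : Measure (I × I))
        {ab | (noisyGradCmpr expand ε₀ L (ab.1, ab.2, seed) x).1 = sg} else 0 := by
    intro sg
    have hiff : ∀ ab : I × I, (noisyGradCmpr expand ε₀ L (ab.1, ab.2, seed) x).1 = sg →
        (ab ∈ T ↔ (sg, seed) ∈ A) := by
      intro ab hab
      have : noisyGradCmpr expand ε₀ L (ab.1, ab.2, seed) x = (sg, seed) := Prod.ext hab rfl
      rw [hT, Set.mem_ofPred_eq, this]
    split_ifs with h
    · congr 1
      ext ab
      simp only [Set.mem_inter_iff, Set.mem_ofPred_eq, and_iff_right_iff_imp]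
      exact fun hab => (hiff ab hab).2 h
    · rw [← measure_empty (μ := (volume : Measure (I × I)))]
      congr 1
      ext ab
      simp only [Set.mem_inter_iff, Set.mem_ofPred_eq, Set.mem_empty_iff_false, iff_false, not_and]
      exact fun h1 hab => h ((hiff ab hab).1 h1)
  rw [← hpart, ← hpart]
  have hsplit := measure_inter_add_sdiff (μ := (volume : Measure (I × I))) T
    (hm (measurableSet_singleton true))
  change (volume : Measure (I × I)) T = _
  rw [← hsplit]
  congr 2
  ext ab
  simp

end Message

/-! ### The law of the revealed messages -/

lemma measurable_gradient {d : ℕ} (f : Vec d → ℝ) : Measurable (gradient f) := by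
  unfold gradient
  exact (InnerProductSpace.toDual ℝ (Vec d)).symm.continuous.measurable.comp
    (measurable_fderiv ℝ f)

lemma measurable_clip {d : ℕ} (L : ℝ) : Measurable (clip (d := d) L) := by
  unfold clip
  fun_prop

section

variable {d : ℕ} {X : Type u} {S : Type v} [MeasurableSpace S]

/-- The clipped gradient of the loss at the data point `x`. -/
noncomputable def clippedGrad (task : Task d X S) (x : X) (θ : Vec d) : Vec d :=
  clip task.L (gradient (fun θ' => task.loss θ' x) θ)

lemma measurable_clippedGrad (task : Task d X S) (x : X) : Measurable (clippedGrad task x) :=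
  (measurable_clip task.L).comp (measurable_gradient _)

end

/-- The law of selected coordinates of a doubly indexed product measure. -/
lemma pi_pi_map_eval {n s : ℕ} {ι Y Y' : Type*} [Fintype ι] [MeasurableSpace Y]
    [MeasurableSpace Y'] (ν : Measure Y) [IsProbabilityMeasure ν] {e : ι → Fin n × Fin s}
    (he : Function.Injective e) (G : ι → Y → Y') (hG : ∀ b, Measurable (G b)) :
    (Measure.pi fun _ : Fin n => Measure.pi fun _ : Fin s => ν).map
      (fun c b => G b (c (e b).1 (e b).2)) = Measure.pi fun b => ν.map (G b) := by
  have : ∀ b, IsProbabilityMeasure (ν.map (G b)) := fun b =>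
    Measure.isProbabilityMeasure_map (hG b).aemeasurable
  refine (Measure.pi_eq fun A hA => ?_).symm
  have hmeas : Measurable fun (c : Fin n → Fin s → Y) b => G b (c (e b).1 (e b).2) := by
    refine measurable_pi_lambda _ fun b => (hG b).comp ?_
    exact (measurable_pi_apply _).comp (measurable_pi_apply _)
  rw [Measure.map_apply hmeas (.univ_pi hA)]
  -- The preimage of a box is a box: coordinate `z` is constrained by the unique `b` with `e b = z`,
  -- and not at all if there is none.
  set T : Fin n × Fin s → Set Y := fun z => ⋂ b, ⋂ (_ : e b = z), G b ⁻¹' A b with hT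
  have hpre : (fun (c : Fin n → Fin s → Y) b => G b (c (e b).1 (e b).2)) ⁻¹' Set.univ.pi A =
      Set.univ.pi fun i => Set.univ.pi fun a => T (i, a) := by
    ext c
    simp only [Set.mem_preimage, Set.mem_pi, Set.mem_univ, true_implies, hT, Set.mem_iInter]
    constructor
    · intro h i a b hb
      have := h b
      rwa [hb] at this
    · intro h b
      exact h (e b).1 (e b).2 b rfl
  rw [hpre, Measure.pi_pi]
  simp_rw [Measure.pi_pi]
  rw [← Fintype.prod_prod_type' (fun i a => ν (T (i, a)))]
  symm
  refine Fintype.prod_of_injective e he _ _ (fun z hz => ?_) fun b => ?_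
  · have : T z = Set.univ := by
      rw [Set.eq_univ_iff_forall]
      intro y
      simp only [hT, Set.mem_iInter]
      exact fun b hb => (hz ⟨b, hb⟩).elim
    rw [this, measure_univ]
  · rw [Measure.map_apply (hG b) (hA b)]
    congr 1
    ext y
    simp only [hT, Set.mem_iInter, Set.mem_preimage]
    exact ⟨fun h b' hb' => by rwa [he hb'], fun h => h b rfl⟩

lemma lintegral_pi_prod {m : ℕ} {Y : Type*} [MeasurableSpace Y] (μ : Measure Y) [SigmaFinite μ]
    (f : Fin m → Y → ENNReal) (hf : ∀ i, Measurable (f i)) :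
    ∫⁻ x, ∏ i, f i (x i) ∂(Measure.pi fun _ : Fin m => μ) = ∏ i, ∫⁻ y, f i y ∂μ := by
  induction m with
  | zero => simp
  | succ m ih =>
    have h := (measurePreserving_piFinSuccAbove (fun _ : Fin (m + 1) => μ) 0).symm
    rw [← h.lintegral_comp_emb (MeasurableEquiv.measurableEmbedding _)]
    simp_rw [MeasurableEquiv.piFinSuccAbove_symm_apply, Fin.insertNthEquiv,
      Fin.prod_univ_succ, Fin.insertNth_zero, Equiv.coe_fn_mk, Fin.cons_succ, Fin.cons_zero]
    rw [← ih (fun i => f i.succ) (fun i => hf _)]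
    exact lintegral_prod_mul (hf 0).aemeasurable (Finset.measurable_prod _ fun i _ =>
      (hf _).comp (measurable_pi_apply i)).aemeasurable

lemma pi_withDensity {m : ℕ} {Y : Type*} [MeasurableSpace Y] (μ : Measure Y) [SigmaFinite μ]
    (f : Fin m → Y → ENNReal) (hf : ∀ i, Measurable (f i))
    [∀ i, SigmaFinite (μ.withDensity (f i))] :
    Measure.pi (fun i => μ.withDensity (f i)) =
      (Measure.pi fun _ : Fin m => μ).withDensity fun x => ∏ i, f i (x i) := by
  refine Measure.pi_eq fun A hA => ?_
  rw [withDensity_apply _ (.univ_pi hA), ← lintegral_indicator (.univ_pi hA)]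
  have : ∀ x : Fin m → Y, (Set.univ.pi A).indicator (fun x => ∏ i, f i (x i)) x =
      ∏ i, (A i).indicator (f i) (x i) := by
    intro x
    classical
    by_cases hx : x ∈ Set.univ.pi A
    · rw [Set.indicator_of_mem hx]
      exact Finset.prod_congr rfl fun i _ => (Set.indicator_of_mem (hx i trivial) _).symm
    · rw [Set.indicator_of_notMem hx]
      simp only [Set.mem_pi, Set.mem_univ, true_implies, not_forall] at hx
      obtain ⟨i, hi⟩ := hx
      exact (Finset.prod_eq_zero (Finset.mem_univ i) (Set.indicator_of_notMem hi _)).symm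
  simp_rw [this]
  rw [lintegral_pi_prod μ _ fun i => (hf i).indicator (hA i)]
  exact Finset.prod_congr rfl fun i _ => by
    rw [withDensity_apply _ (hA i), lintegral_indicator (hA i)]

section

variable {d n r k s : ℕ} {X : Type u} {S : Type v} [MeasurableSpace S]

instance (r s : ℕ) : DiscreteMeasurableSpace (ClientSample r s) := ⟨fun _ => trivial⟩

instance (N : ℕ) : DiscreteMeasurableSpace (Equiv.Perm (Fin N)) := ⟨fun _ => trivial⟩

lemma revealed_apply (hk : k ≤ n) (task : Task d X S) (D : Dataset n r X) (θ : Vec d)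
    (U : Fin n → ClientSample r s) (π : Equiv.Perm (Fin (n * s)))
    (c : Fin n → Fin s → LocalCoins S) (b : Fin (k * s)) :
    revealed hk task D θ (U, π, c) b =
      noisyGradCmpr task.expand task.ε₀ task.L
        (c (finProdFinEquiv.symm (π (Fin.castLE (Nat.mul_le_mul_right s hk) b))).1
          (finProdFinEquiv.symm (π (Fin.castLE (Nat.mul_le_mul_right s hk) b))).2)
        (clippedGrad task (D (slotPoint U (π (Fin.castLE (Nat.mul_le_mul_right s hk) b))).1
          (slotPoint U (π (Fin.castLE (Nat.mul_le_mul_right s hk) b))).2) θ) := rfl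

/-- Selections and permutations form a countable discrete space, so they may be fixed; what remains
is a measurable function of the model and of the local coins. -/
lemma measurable_revealed (hk : k ≤ n) (task : Task d X S) (he : Measurable task.expand)
    (D : Dataset n r X) :
    Measurable fun p : Vec d × Round n r s S => revealed hk task D p.1 p.2 := by
  have h : Measurable fun q : ((Fin n → ClientSample r s) × Equiv.Perm (Fin (n * s))) ×
      (Vec d × (Fin n → Fin s → LocalCoins S)) =>
      revealed hk task D q.2.1 (q.1.1, q.1.2, q.2.2) := by
    refine measurable_from_prod_countable_right fun x => measurable_pi_lambda _ fun b => ?_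
    simp only [revealed_apply]
    have h1 := measurable_noisyGradCmpr he task.ε₀ task.L
    have h2 : Measurable fun q : Vec d × (Fin n → Fin s → LocalCoins S) =>
        (q.2 (finProdFinEquiv.symm (x.2 (Fin.castLE (Nat.mul_le_mul_right s hk) b))).1
          (finProdFinEquiv.symm (x.2 (Fin.castLE (Nat.mul_le_mul_right s hk) b))).2,
        clippedGrad task (D (slotPoint x.1 (x.2 (Fin.castLE (Nat.mul_le_mul_right s hk) b))).1
          (slotPoint x.1 (x.2 (Fin.castLE (Nat.mul_le_mul_right s hk) b))).2) q.1) := by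
      refine Measurable.prodMk ?_ ((measurable_clippedGrad task _).comp measurable_fst)
      exact (measurable_pi_apply _).comp ((measurable_pi_apply _).comp measurable_snd)
    have h3 := h1.comp h2
    rw [Function.comp_def] at h3
    exact h3
  have h2 : Measurable fun p : Vec d × Round n r s S =>
      (((p.2.1, p.2.2.1), (p.1, p.2.2.2)) :
        ((Fin n → ClientSample r s) × Equiv.Perm (Fin (n * s))) ×
          (Vec d × (Fin n → Fin s → LocalCoins S))) := by
    fun_prop
  have h3 := h.comp h2
  rw [Function.comp_def] at h3
  exact h3

lemma measurable_revealed_right (hk : k ≤ n) (task : Task d X S) (he : Measurable task.expand)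
    (D : Dataset n r X) (θ : Vec d) :
    Measurable fun ρ : Round n r s S => revealed hk task D θ ρ := by
  have h := (measurable_revealed (s := s) hk task he D).comp
    (measurable_prodMk_left (x := θ))
  rw [Function.comp_def] at h
  exact h

lemma isProbabilityMeasure_roundMeasure (hsr : s ≤ r) (ν : Measure S) [IsProbabilityMeasure ν] :
    IsProbabilityMeasure (roundMeasure n r s ν) := by
  have := ClientSample.nonempty hsr
  unfold roundMeasure
  infer_instance

/-- The law of the revealed messages is a mixture of product measures, over the selections and
the permutations. -/
lemma iterationLaw_eq (hk : k ≤ n) (hsr : s ≤ r) (task : Task d X S)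
    [IsProbabilityMeasure task.seedLaw] (he : Measurable task.expand) (θ : Vec d)
    (D : Dataset n r X) :
    iterationLaw hk s task θ D =
      ((Fintype.card (Fin n → ClientSample r s) : ENNReal) *
        Fintype.card (Equiv.Perm (Fin (n * s))))⁻¹ •
      ∑ U : Fin n → ClientSample r s, ∑ π : Equiv.Perm (Fin (n * s)), Measure.pi fun b : Fin (k * s) =>
        msgLaw task.expand task.ε₀ task.L task.seedLaw
          (clippedGrad task (D (slotPoint U (π (Fin.castLE (Nat.mul_le_mul_right s hk) b))).1
            (slotPoint U (π (Fin.castLE (Nat.mul_le_mul_right s hk) b))).2) θ) := by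
  have := ClientSample.nonempty hsr
  have hmeas := measurable_revealed_right (s := s) hk task he D θ
  ext A hA
  have hpre := hmeas hA
  rw [iterationLaw, Measure.map_apply hmeas hA, roundMeasure, Measure.prod_apply hpre,
    lintegral_fintype]
  have hinner : ∀ U : Fin n → ClientSample r s,
      ((uniformOn Set.univ : Measure (Equiv.Perm (Fin (n * s)))).prod
        (Measure.pi fun _ : Fin n => Measure.pi fun _ : Fin s =>
          (volume : Measure I).prod ((volume : Measure I).prod task.seedLaw)))
        (Prod.mk U ⁻¹' ((fun ρ : Round n r s S => revealed hk task D θ ρ) ⁻¹' A)) =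
      ∑ π : Equiv.Perm (Fin (n * s)), (Measure.pi fun b : Fin (k * s) =>
        msgLaw task.expand task.ε₀ task.L task.seedLaw
          (clippedGrad task (D (slotPoint U (π (Fin.castLE (Nat.mul_le_mul_right s hk) b))).1
            (slotPoint U (π (Fin.castLE (Nat.mul_le_mul_right s hk) b))).2) θ)) A *
        (Fintype.card (Equiv.Perm (Fin (n * s))) : ENNReal)⁻¹ := by
    intro U
    rw [Measure.prod_apply (measurable_prodMk_left hpre), lintegral_fintype]
    refine Finset.sum_congr rfl fun π _ => ?_
    congr 1
    · set e : Fin (k * s) → Fin n × Fin s := fun b =>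
        finProdFinEquiv.symm (π (Fin.castLE (Nat.mul_le_mul_right s hk) b)) with hedef
      -- Distinct positions show distinct slots, so the coins used are independent and the
      -- conditional law is a product.
      have heinj : Function.Injective e := finProdFinEquiv.symm.injective.comp
        (π.injective.comp (Fin.castLE_injective _))
      set G : Fin (k * s) → LocalCoins S → Compressed S := fun b c =>
        noisyGradCmpr task.expand task.ε₀ task.L c
          (clippedGrad task (D (slotPoint U (π (Fin.castLE (Nat.mul_le_mul_right s hk) b))).1
            (slotPoint U (π (Fin.castLE (Nat.mul_le_mul_right s hk) b))).2) θ) with hGdef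
      have hGm : ∀ b, Measurable (G b) := fun b =>
        measurable_noisyGradCmpr_left he task.ε₀ task.L _
      have hmap := pi_pi_map_eval (volume.prod (volume.prod task.seedLaw)) heinj G hGm
      have : (Measure.pi fun b : Fin (k * s) => msgLaw task.expand task.ε₀ task.L task.seedLaw
          (clippedGrad task (D (slotPoint U (π (Fin.castLE (Nat.mul_le_mul_right s hk) b))).1
            (slotPoint U (π (Fin.castLE (Nat.mul_le_mul_right s hk) b))).2) θ)) =
          Measure.pi fun b => (volume.prod (volume.prod task.seedLaw)).map (G b) := rfl
      rw [this, ← hmap, Measure.map_apply _ hA]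
      · rfl
      · refine measurable_pi_lambda _ fun b => (hGm b).comp ?_
        exact (measurable_pi_apply _).comp (measurable_pi_apply _)
    · rw [uniformOn_univ, Measure.count_singleton, one_div]
  simp_rw [hinner]
  simp only [Measure.smul_apply, Measure.coe_finsetSum, Finset.sum_apply, smul_eq_mul]
  rw [Finset.mul_sum]
  refine Finset.sum_congr rfl fun U _ => ?_
  rw [Measure.pi_singleton, ← Finset.sum_mul, mul_assoc, mul_comm]
  congr 1
  simp_rw [uniformOn_univ, Measure.count_singleton, one_div]
  rw [Finset.prod_const, Finset.card_univ, Fintype.card_fin, Fintype.card_fun, Fintype.card_fin,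
    ENNReal.mul_inv (Or.inr (ENNReal.natCast_ne_top _))
      (Or.inl (ENNReal.natCast_ne_top _)), mul_comm, Nat.cast_pow, ENNReal.inv_pow]

/-- The likelihood of the revealed messages `m` on the dataset `D` at the model `θ`, with respect
to the product of the reference measures. -/
noncomputable def revealedDensity (hk : k ≤ n) (task : Task d X S) (D : Dataset n r X)
    (p : Vec d × (Fin (k * s) → Compressed S)) : ℝ :=
  mixedLikelihood hk fun z b =>
    signProb task.expand task.ε₀ task.L (clippedGrad task (D z.1 z.2) p.1) (p.2 b)

lemma measurable_revealedDensity (hk : k ≤ n) (task : Task d X S) (he : Measurable task.expand)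
    (D : Dataset n r X) : Measurable (revealedDensity (s := s) hk task D) := by
  unfold revealedDensity mixedLikelihood
  refine Measurable.const_mul ?_ _
  refine Finset.measurable_sum _ fun U _ => Finset.measurable_sum _ fun π _ =>
    Finset.measurable_prod _ fun b _ => ?_
  have h1 := measurable_signProb he task.ε₀ task.L
  have h2 : Measurable fun p : Vec d × (Fin (k * s) → Compressed S) =>
      (clippedGrad task (D (slotPoint U (π (Fin.castLE (Nat.mul_le_mul_right s hk) b))).1
          (slotPoint U (π (Fin.castLE (Nat.mul_le_mul_right s hk) b))).2) p.1, p.2 b) :=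
    ((measurable_clippedGrad task _).comp measurable_fst).prodMk
      ((measurable_pi_apply b).comp measurable_snd)
  have h3 := h1.comp h2
  rw [Function.comp_def] at h3
  exact h3

lemma iterationLaw_eq_withDensity (hk : k ≤ n) (hsr : s ≤ r) (task : Task d X S)
    [IsProbabilityMeasure task.seedLaw] (he : Measurable task.expand) (θ : Vec d)
    (D : Dataset n r X) :
    iterationLaw hk s task θ D =
      (Measure.pi fun _ : Fin (k * s) => msgBase task.seedLaw).withDensity fun m =>
        ENNReal.ofReal (revealedDensity hk task D (θ, m)) := by
  have hne := ClientSample.nonempty hsr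
  rw [iterationLaw_eq hk hsr task he θ D]
  have hprob : ∀ x, IsProbabilityMeasure (msgLaw task.expand task.ε₀ task.L task.seedLaw x) :=
    fun x => isProbabilityMeasure_msgLaw he _ _ _ x
  have hsm : ∀ x, Measurable fun m => ENNReal.ofReal
      (signProb task.expand task.ε₀ task.L x m) := fun x => by
    have h := (measurable_signProb he task.ε₀ task.L).comp (measurable_prodMk_left (x := x))
    rw [Function.comp_def] at h
    exact h.ennreal_ofReal
  have hpi : ∀ y : Fin (k * s) → Vec d, (Measure.pi fun b : Fin (k * s) =>
      msgLaw task.expand task.ε₀ task.L task.seedLaw (y b)) =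
      (Measure.pi fun _ : Fin (k * s) => msgBase task.seedLaw).withDensity fun m =>
        ∏ b, ENNReal.ofReal (signProb task.expand task.ε₀ task.L (y b) (m b)) := by
    intro y
    have h1 : ∀ x, msgLaw task.expand task.ε₀ task.L task.seedLaw x = _ := fun x =>
      msgLaw_eq_withDensity he task.ε₀ task.L task.seedLaw x
    have : ∀ b, SigmaFinite ((msgBase task.seedLaw).withDensity fun m =>
        ENNReal.ofReal (signProb task.expand task.ε₀ task.L (y b) m)) := fun b => by
      rw [← h1]; infer_instance
    simp_rw [h1]
    exact pi_withDensity _ _ fun b => hsm _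
  simp_rw [hpi]
  ext A hA
  rw [withDensity_apply _ hA]
  simp only [Measure.smul_apply, Measure.coe_finsetSum, Finset.sum_apply, smul_eq_mul,
    withDensity_apply _ hA]
  have hnn : ∀ x m, 0 ≤ signProb task.expand task.ε₀ task.L x m := fun x m => measureReal_nonneg
  have hprodm : ∀ y : Fin (k * s) → Vec d, Measurable fun m : Fin (k * s) → Compressed S =>
      ∏ b, ENNReal.ofReal (signProb task.expand task.ε₀ task.L (y b) (m b)) := fun y =>
    Finset.measurable_prod _ fun b _ => (hsm (y b)).comp (measurable_pi_apply b)
  have hexp : ∀ m : Fin (k * s) → Compressed S,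
      ENNReal.ofReal (revealedDensity hk task D (θ, m)) =
      ((Fintype.card (Fin n → ClientSample r s) : ENNReal) *
        Fintype.card (Equiv.Perm (Fin (n * s))))⁻¹ *
      ∑ U : Fin n → ClientSample r s, ∑ π : Equiv.Perm (Fin (n * s)),
        ∏ b, ENNReal.ofReal (signProb task.expand task.ε₀ task.L
          (clippedGrad task (D (slotPoint U (π (Fin.castLE (Nat.mul_le_mul_right s hk) b))).1
            (slotPoint U (π (Fin.castLE (Nat.mul_le_mul_right s hk) b))).2) θ) (m b)) := by
    intro m
    have h0 := mixedLikelihood_const_pos (n := n) hsr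
    rw [revealedDensity, mixedLikelihood, ENNReal.ofReal_mul h0.le,
      ENNReal.ofReal_inv_of_pos (inv_pos.1 h0), ENNReal.ofReal_mul (by positivity),
      ENNReal.ofReal_natCast, ENNReal.ofReal_natCast]
    congr 1
    rw [ENNReal.ofReal_sum_of_nonneg fun U _ => Finset.sum_nonneg fun π _ =>
      Finset.prod_nonneg fun b _ => hnn _ _]
    refine Finset.sum_congr rfl fun U _ => ?_
    rw [ENNReal.ofReal_sum_of_nonneg fun π _ => Finset.prod_nonneg fun b _ => hnn _ _]
    exact Finset.sum_congr rfl fun π _ => ENNReal.ofReal_prod_of_nonneg fun b _ => hnn _ _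
  simp_rw [hexp]
  rw [lintegral_const_mul _ (Finset.measurable_sum _ fun U _ => Finset.measurable_sum _ fun π _ =>
    hprodm _), lintegral_finsetSum _ fun U _ => Finset.measurable_sum _ fun π _ => hprodm _]
  congr 1
  refine Finset.sum_congr rfl fun U _ => ?_
  rw [lintegral_finsetSum _ fun π _ => hprodm _]

end

/-! ### The projection onto a closed convex set -/

section Projection

variable {d : ℕ} {K : Set (Vec d)}

/-- A nonempty closed set in a finite-dimensional space attains its distance to `x`, so the choice
operator in `proj` has something to choose. -/
lemma proj_spec (hne : K.Nonempty) (hc : IsClosed K) (x : Vec d) :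
    proj K x ∈ K ∧ ∀ z ∈ K, dist x (proj K x) ≤ dist x z := by
  obtain ⟨y, hy, h⟩ := hc.exists_infDist_eq_dist hne x
  exact Classical.epsilon_spec (p := fun y => y ∈ K ∧ ∀ z ∈ K, dist x y ≤ dist x z)
    ⟨y, hy, fun z hz => h ▸ Metric.infDist_le_dist_of_mem hz⟩

lemma proj_mem (hne : K.Nonempty) (hc : IsClosed K) (x : Vec d) : proj K x ∈ K :=
  (proj_spec hne hc x).1

lemma inner_proj_le (hne : K.Nonempty) (hc : IsClosed K) (hconv : Convex ℝ K) (x : Vec d)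
    {z : Vec d} (hz : z ∈ K) : inner ℝ (x - proj K x) (z - proj K x) ≤ 0 := by
  obtain ⟨hp, h⟩ := proj_spec hne hc x
  refine (norm_eq_iInf_iff_real_inner_le_zero hconv hp).1 ?_ z hz
  have : Nonempty K := hne.to_subtype
  refine le_antisymm (le_ciInf fun w => ?_) (ciInf_le ⟨0, ?_⟩ (⟨_, hp⟩ : K))
  · simpa [dist_eq_norm] using h w w.2
  · rintro _ ⟨w, rfl⟩
    exact norm_nonneg _

/-- Adding the variational inequalities at the two projections gives `‖a - b‖² ≤ ⟨x - y, a - b⟩`;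
then Cauchy–Schwarz. -/
lemma norm_proj_sub_proj_le (hne : K.Nonempty) (hc : IsClosed K) (hconv : Convex ℝ K)
    (x y : Vec d) : ‖proj K x - proj K y‖ ≤ ‖x - y‖ := by
  have h1 := inner_proj_le hne hc hconv x (proj_mem hne hc y)
  have h2 := inner_proj_le hne hc hconv y (proj_mem hne hc x)
  set a := proj K x
  set b := proj K y
  have h3 : ‖a - b‖ ^ 2 ≤ inner ℝ (x - y) (a - b) := by
    have e : inner ℝ (x - y) (a - b) = ‖a - b‖ ^ 2 - inner ℝ (x - a) (b - a) -
        inner ℝ (y - b) (a - b) := by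
      rw [← real_inner_self_eq_norm_sq]
      simp only [inner_sub_left, inner_sub_right]
      ring
    linarith
  have h4 := real_inner_le_norm (x - y) (a - b)
  by_contra hcon
  push Not at hcon
  nlinarith [norm_nonneg (x - y), norm_nonneg (a - b)]

lemma proj_eq_self (hne : K.Nonempty) (hc : IsClosed K) {x : Vec d} (hx : x ∈ K) :
    proj K x = x := by
  have := (proj_spec hne hc x).2 x hx
  rw [dist_self] at this
  exact (dist_le_zero.1 this).symm

lemma continuous_proj (hne : K.Nonempty) (hc : IsClosed K) (hconv : Convex ℝ K) :
    Continuous (proj K) := by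
  have : LipschitzWith 1 (proj K) := LipschitzWith.of_dist_le_mul fun x y => by
    simpa [dist_eq_norm] using norm_proj_sub_proj_le hne hc hconv x y
  exact this.continuous

end Projection

/-! ### Rényi divergence and densities -/

/-- The moment `∫ q (p / q)^α dμ`. -/
noncomputable def renyiMoment {Y : Type*} [MeasurableSpace Y] (μ : Measure Y) (p q : Y → ℝ)
    (α : ℝ) : ENNReal :=
  ∫⁻ y, ENNReal.ofReal (q y * (p y / q y) ^ α) ∂μ

/-- Positivity of `q` gives `P = (p / q) Q`. This supplies both the absolute continuity and the
Radon–Nikodym derivative in the divergence. -/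
lemma renyiDiv_withDensity_le {Y : Type*} [MeasurableSpace Y] (μ : Measure Y) [SigmaFinite μ]
    {p q : Y → ℝ} (hp : Measurable p) (hq : Measurable q) (hp0 : ∀ y, 0 < p y)
    (hq0 : ∀ y, 0 < q y) {α ε : ℝ} (hα : 1 < α)
    (h : renyiMoment μ p q α ≤ ENNReal.ofReal (Real.exp ((α - 1) * ε))) :
    renyiDiv α (μ.withDensity fun y => ENNReal.ofReal (p y))
      (μ.withDensity fun y => ENNReal.ofReal (q y)) ≤ (ε : EReal) := by
  have hpm := hp.ennreal_ofReal
  have hqm := hq.ennreal_ofReal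
  have hrm : Measurable fun y => ENNReal.ofReal (p y / q y) := (hp.div hq).ennreal_ofReal
  set Q := μ.withDensity fun y => ENNReal.ofReal (q y) with hQ
  have hPQ : (μ.withDensity fun y => ENNReal.ofReal (p y)) =
      Q.withDensity fun y => ENNReal.ofReal (p y / q y) := by
    rw [hQ, ← withDensity_mul _ hqm hrm]
    congr 1
    funext y
    rw [Pi.mul_apply, ← ENNReal.ofReal_mul (hq0 y).le, mul_div_cancel₀ _ (hq0 y).ne']
  have hsf : SigmaFinite Q := SigmaFinite.withDensity_of_ne_top
    (Filter.Eventually.of_forall fun y => ENNReal.ofReal_ne_top)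
  rw [hPQ, renyiDiv, if_pos (withDensity_absolutelyContinuous _ _)]
  have hint : ∫⁻ y, ((Q.withDensity fun y => ENNReal.ofReal (p y / q y)).rnDeriv Q y) ^ α ∂Q =
      renyiMoment μ p q α := by
    rw [lintegral_congr_ae ((Measure.rnDeriv_withDensity Q hrm).mono fun y hy => by rw [hy]), hQ,
      lintegral_withDensity_eq_lintegral_mul _ hqm (hrm.pow_const α)]
    refine lintegral_congr fun y => ?_
    rw [Pi.mul_apply, ENNReal.ofReal_rpow_of_pos (div_pos (hp0 y) (hq0 y)),
      ← ENNReal.ofReal_mul (hq0 y).le]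
  rw [hint]
  have h1 := ENNReal.log_monotone h
  rw [ENNReal.log_ofReal, if_neg (not_le.2 (Real.exp_pos _)), Real.log_exp] at h1
  have hα' : (0 : EReal) ≤ (((α - 1)⁻¹ : ℝ) : EReal) := by
    exact_mod_cast (inv_pos.2 (by linarith)).le
  refine (mul_le_mul_of_nonneg_left h1 hα').trans (le_of_eq ?_)
  rw [← EReal.coe_mul]
  congr 1
  have : α - 1 ≠ 0 := by linarith
  field_simp

/-- Young's inequality in the form used for the conversion of RDP to DP. -/
lemma le_exp_add_mul_rpow {α ρ δ x : ℝ} (hα : 1 < α) (hδ : 0 < δ) (hx : 0 < x) :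
    x ≤ Real.exp (ρ + Real.log (1 - 1 / α) + (Real.log (1 / δ) - Real.log α) / (α - 1)) +
      δ * Real.exp (-((α - 1) * ρ)) * x ^ α := by
  have hα0 : 0 < α := by linarith
  have hα1 : 0 < α - 1 := by linarith
  have hw1 : 0 < 1 - 1 / α := by
    rw [sub_pos, div_lt_one hα0]; exact hα
  set ε := ρ + Real.log (1 - 1 / α) + (Real.log (1 / δ) - Real.log α) / (α - 1) with hε
  -- The weights `1 - 1 / α` and `1 / α` are divided out of the two points, so the arithmetic mean
  -- is the right-hand side; `ε` is tuned so that the geometric mean is exactly `x`.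
  have h := Real.geom_mean_le_arith_mean2_weighted (w₁ := 1 - 1 / α) (w₂ := 1 / α)
    (p₁ := Real.exp ε / (1 - 1 / α)) (p₂ := α * (δ * Real.exp (-((α - 1) * ρ)) * x ^ α))
    hw1.le (by positivity) (by positivity) (by positivity) (by ring)
  have e1 : (1 - 1 / α) * (Real.exp ε / (1 - 1 / α)) +
      1 / α * (α * (δ * Real.exp (-((α - 1) * ρ)) * x ^ α)) =
      Real.exp ε + δ * Real.exp (-((α - 1) * ρ)) * x ^ α := by
    field_simp
  rw [e1] at h
  refine le_trans (le_of_eq ?_) h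
  rw [Real.rpow_def_of_pos (by positivity), Real.rpow_def_of_pos (by positivity),
    ← Real.exp_add, Real.log_div (Real.exp_pos _).ne' hw1.ne', Real.log_exp,
    Real.log_mul hα0.ne' (by positivity), Real.log_mul (by positivity) (by positivity),
    Real.log_mul hδ.ne' (Real.exp_pos _).ne', Real.log_exp, Real.log_rpow hx]
  nth_rewrite 1 [← Real.exp_log hx]
  congr 1
  rw [hε, Real.log_div one_ne_zero hδ.ne', Real.log_one]
  field_simp
  ring

/-- Apply the pointwise Young inequality to `x = p / q`, multiply by `q` and integrate over `A`. The
moment bound makes the last term contribute at most `δ`. -/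
lemma dp_of_renyiMoment_le {Y : Type*} [MeasurableSpace Y] (μ : Measure Y)
    {p q : Y → ℝ} (hp : Measurable p) (hq : Measurable q) (hp0 : ∀ y, 0 < p y)
    (hq0 : ∀ y, 0 < q y) {α ρ δ : ℝ} (hα : 1 < α) (hδ : 0 < δ)
    (h : renyiMoment μ p q α ≤ ENNReal.ofReal (Real.exp ((α - 1) * ρ))) {A : Set Y}
    (hA : MeasurableSet A) :
    (μ.withDensity fun y => ENNReal.ofReal (p y)) A ≤
      ENNReal.ofReal (Real.exp (ρ + Real.log (1 - 1 / α) +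
        (Real.log (1 / δ) - Real.log α) / (α - 1))) *
        (μ.withDensity fun y => ENNReal.ofReal (q y)) A + ENNReal.ofReal δ := by
  set ε := ρ + Real.log (1 - 1 / α) + (Real.log (1 / δ) - Real.log α) / (α - 1) with hε
  rw [withDensity_apply _ hA, withDensity_apply _ hA]
  have hpt : ∀ y, ENNReal.ofReal (p y) ≤ ENNReal.ofReal (Real.exp ε) * ENNReal.ofReal (q y) +
      ENNReal.ofReal (δ * Real.exp (-((α - 1) * ρ))) *
        ENNReal.ofReal (q y * (p y / q y) ^ α) := by
    intro y
    have hx : 0 < p y / q y := div_pos (hp0 y) (hq0 y)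
    have h1 := le_exp_add_mul_rpow (ρ := ρ) hα hδ hx
    rw [← ENNReal.ofReal_mul (Real.exp_pos _).le, ← ENNReal.ofReal_mul (by positivity),
      ← ENNReal.ofReal_add (mul_nonneg (Real.exp_pos _).le (hq0 y).le)
        (mul_nonneg (by positivity) (mul_nonneg (hq0 y).le (by positivity)))]
    refine ENNReal.ofReal_le_ofReal ?_
    have h2 := mul_le_mul_of_nonneg_left h1 (hq0 y).le
    rw [mul_div_cancel₀ _ (hq0 y).ne'] at h2
    refine h2.trans (le_of_eq ?_)
    ring
  have hmm : Measurable fun y => ENNReal.ofReal (q y * (p y / q y) ^ α) :=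
    (hq.mul ((hp.div hq).pow_const α)).ennreal_ofReal
  calc ∫⁻ y in A, ENNReal.ofReal (p y) ∂μ
      ≤ ∫⁻ y in A, (ENNReal.ofReal (Real.exp ε) * ENNReal.ofReal (q y) +
          ENNReal.ofReal (δ * Real.exp (-((α - 1) * ρ))) *
            ENNReal.ofReal (q y * (p y / q y) ^ α)) ∂μ := lintegral_mono hpt
    _ = ENNReal.ofReal (Real.exp ε) * ∫⁻ y in A, ENNReal.ofReal (q y) ∂μ +
          ENNReal.ofReal (δ * Real.exp (-((α - 1) * ρ))) *
            ∫⁻ y in A, ENNReal.ofReal (q y * (p y / q y) ^ α) ∂μ := by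
        rw [lintegral_add_left (hq.ennreal_ofReal.const_mul _),
          lintegral_const_mul _ hq.ennreal_ofReal, lintegral_const_mul _ hmm]
    _ ≤ ENNReal.ofReal (Real.exp ε) * ∫⁻ y in A, ENNReal.ofReal (q y) ∂μ +
          ENNReal.ofReal (δ * Real.exp (-((α - 1) * ρ))) *
            ENNReal.ofReal (Real.exp ((α - 1) * ρ)) := by
        gcongr
        exact (setLIntegral_le_lintegral _ _).trans h
    _ = _ := by
        rw [← ENNReal.ofReal_mul (by positivity), mul_assoc, ← Real.exp_add]
        simp

/-! ### One iteration -/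

/-- Separates signs from seeds, so that the moment of an iteration can be bounded for every fixed
choice of the seeds. -/
lemma lintegral_pi_msgBase {m : ℕ} {S : Type v} [MeasurableSpace S] (ν : Measure S)
    [IsProbabilityMeasure ν] {F : (Fin m → Compressed S) → ENNReal} (hF : Measurable F) :
    ∫⁻ x, F x ∂(Measure.pi fun _ : Fin m => msgBase ν) =
      ∫⁻ seed, ∑ ω : Fin m → Bool, F (fun b => (ω b, seed b)) ∂(Measure.pi fun _ : Fin m => ν) := by
  have h := (measurePreserving_arrowProdEquivProdArrow Bool S (Fin m)
    (fun _ => Measure.count) (fun _ => ν)).symm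
  have hF' := hF.comp (MeasurableEquiv.arrowProdEquivProdArrow Bool S (Fin m)).symm.measurable
  rw [Function.comp_def] at hF'
  rw [← h.lintegral_comp_emb (MeasurableEquiv.measurableEmbedding _), lintegral_prod_symm' _ hF']
  refine lintegral_congr fun seed => ?_
  rw [lintegral_fintype]
  refine Finset.sum_congr rfl fun ω _ => ?_
  rw [Measure.pi_singleton]
  simp only [Measure.count_singleton, Finset.prod_const_one, mul_one]
  rfl

section

variable {d n r k s : ℕ} {X : Type u} {S : Type v} [MeasurableSpace S]

/-- The constant in the RDP bound of an iteration, for local privacy levels up to `E`. -/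
noncomputable def rdpConst (E : ℝ) : ℝ :=
  768 * ((2 - 2 / (Real.exp E + 1)) / (2 / (Real.exp E + 1))) ^ 8 / (2 / (Real.exp E + 1)) ^ 3

lemma rdpConst_pos {E : ℝ} (hE : 0 < E) : 0 < rdpConst E := by
  have h := Real.one_lt_exp_iff.2 hE
  have : 0 < 2 - 2 / (Real.exp E + 1) := by
    rw [sub_pos, div_lt_iff₀ (by positivity)]; linarith
  unfold rdpConst
  positivity

lemma revealedDensity_pos (hk : k ≤ n) (hsr : s ≤ r) (task : Task d X S) (hε : 0 < task.ε₀)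
    (D : Dataset n r X) (p : Vec d × (Fin (k * s) → Compressed S)) :
    0 < revealedDensity hk task D p :=
  mixedLikelihood_pos hk hsr fun z b =>
    lt_of_lt_of_le (by positivity) (le_signProb task.expand hε.le task.L _ _)

lemma sum_revealedDensity_rpow_le (hk : k ≤ n) (h1k : 1 ≤ k) (h1s : 1 ≤ s) (hsr : s ≤ r)
    (task : Task d X S) {E : ℝ} (hε : 0 < task.ε₀) (hεE : task.ε₀ ≤ E) {D D' : Dataset n r X}
    (hD : Neighboring D D') (θ : Vec d) {α : ℝ} (hα : 1 < α) (seed : Fin (k * s) → S) :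
    ∑ ω : Fin (k * s) → Bool, revealedDensity hk task D' (θ, fun b => (ω b, seed b)) *
      (revealedDensity hk task D (θ, fun b => (ω b, seed b)) /
        revealedDensity hk task D' (θ, fun b => (ω b, seed b))) ^ α ≤
      Real.exp ((α - 1) * (α * (rdpConst E *
        (((k : ℝ) * s / (n * r)) * min task.ε₀ 1) ^ 2 / (k * s)))) := by
  obtain ⟨i, j, -, hrest⟩ := hD
  have hexp := Real.exp_pos task.ε₀
  have hexp1 := Real.one_lt_exp_iff.2 hε
  have hEexp := Real.exp_le_exp.2 hεE
  have hlow : ∀ x (m : Compressed S), (2 / (Real.exp E + 1)) / 2 ≤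
      signProb task.expand task.ε₀ task.L x m := by
    intro x m
    refine le_trans ?_ (le_signProb task.expand hε.le task.L x m)
    rw [div_right_comm, div_self two_ne_zero, ← one_div]
    gcongr
  refine sum_mixedLikelihood_rpow_le hk h1k h1s hsr (i, j)
    (fun z b sg => signProb task.expand task.ε₀ task.L (clippedGrad task (D z.1 z.2) θ)
      (sg, seed b))
    (fun z b sg => signProb task.expand task.ε₀ task.L (clippedGrad task (D' z.1 z.2) θ)
      (sg, seed b)) (fun z hz => ?_) (fun z b => signProb_add _ _ _ _ _)
    (fun z b => signProb_add _ _ _ _ _) (by positivity) ?_ (fun z b sg => hlow _ _)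
    (fun z b sg => hlow _ _) (fun b sg => ?_) hα
  · rw [hrest z.1 z.2 hz]
  · rw [div_lt_one (by positivity)]; linarith
  · have hbd : ∀ x, (Real.exp task.ε₀ + 1)⁻¹ ≤
        signProb task.expand task.ε₀ task.L x (sg, seed b) ∧
        signProb task.expand task.ε₀ task.L x (sg, seed b) ≤
          1 - (Real.exp task.ε₀ + 1)⁻¹ := by
      intro x
      have h1 := le_signProb task.expand hε.le task.L x (true, seed b)
      have h2 := le_signProb task.expand hε.le task.L x (false, seed b)
      have h3 := signProb_add task.expand task.ε₀ task.L x (seed b)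
      cases sg <;> constructor <;> linarith
    have h1 := hbd (clippedGrad task (D i j) θ)
    have h2 := hbd (clippedGrad task (D' i j) θ)
    -- Two sign probabilities in `[1 / (e^ε₀ + 1), 1 - 1 / (e^ε₀ + 1)]` differ by at most `(e^ε₀ -
    -- 1) / (e^ε₀ + 1)`. This is where `min {ε₀, 1}` comes from.
    have hτ : 1 - 2 * (Real.exp task.ε₀ + 1)⁻¹ ≤ min task.ε₀ 1 := by
      refine le_min ?_ ?_
      · have h3 := exp_sub_one_le_mul_exp task.ε₀
        have e : 1 - 2 * (Real.exp task.ε₀ + 1)⁻¹ =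
            (Real.exp task.ε₀ - 1) / (Real.exp task.ε₀ + 1) := by
          field_simp; ring
        rw [e, div_le_iff₀ (by positivity)]
        linarith
      · have : 0 < (Real.exp task.ε₀ + 1)⁻¹ := by positivity
        linarith
    rw [abs_le]
    constructor <;> simp only <;> linarith

lemma renyiMoment_revealedDensity_le (hk : k ≤ n) (h1k : 1 ≤ k) (h1s : 1 ≤ s) (hsr : s ≤ r)
    (task : Task d X S) [IsProbabilityMeasure task.seedLaw] (he : Measurable task.expand) {E : ℝ}
    (hε : 0 < task.ε₀) (hεE : task.ε₀ ≤ E) {D D' : Dataset n r X} (hD : Neighboring D D')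
    (θ : Vec d) {α : ℝ} (hα : 1 < α) :
    renyiMoment (Measure.pi fun _ : Fin (k * s) => msgBase task.seedLaw)
      (fun m => revealedDensity hk task D (θ, m)) (fun m => revealedDensity hk task D' (θ, m)) α ≤
      ENNReal.ofReal (Real.exp ((α - 1) * (α * (rdpConst E *
        (((k : ℝ) * s / (n * r)) * min task.ε₀ 1) ^ 2 / (k * s))))) := by
  have hm : ∀ D : Dataset n r X, Measurable fun m : Fin (k * s) → Compressed S =>
      revealedDensity hk task D (θ, m) := fun D => by
    have h := (measurable_revealedDensity (s := s) hk task he D).comp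
      (measurable_prodMk_left (x := θ))
    rw [Function.comp_def] at h
    exact h
  have hint : Measurable fun m : Fin (k * s) → Compressed S =>
      ENNReal.ofReal (revealedDensity hk task D' (θ, m) *
        (revealedDensity hk task D (θ, m) / revealedDensity hk task D' (θ, m)) ^ α) :=
    ((hm D').mul (((hm D).div (hm D')).pow_const α)).ennreal_ofReal
  have hnn : ∀ m, 0 ≤ revealedDensity (s := s) hk task D' (θ, m) *
      (revealedDensity hk task D (θ, m) / revealedDensity hk task D' (θ, m)) ^ α := fun m =>
    mul_nonneg (revealedDensity_pos hk hsr task hε D' (θ, m)).le (Real.rpow_nonneg (div_nonneg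
      (revealedDensity_pos hk hsr task hε D (θ, m)).le
      (revealedDensity_pos hk hsr task hε D' (θ, m)).le) _)
  rw [renyiMoment, lintegral_pi_msgBase _ hint]
  set B := ENNReal.ofReal (Real.exp ((α - 1) * (α * (rdpConst E *
    (((k : ℝ) * s / (n * r)) * min task.ε₀ 1) ^ 2 / (k * s)))))
  calc _ ≤ ∫⁻ _ : Fin (k * s) → S, B ∂(Measure.pi fun _ => task.seedLaw) := by
        refine lintegral_mono fun seed => ?_
        rw [← ENNReal.ofReal_sum_of_nonneg fun ω _ => hnn _]
        exact ENNReal.ofReal_le_ofReal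
          (sum_revealedDensity_rpow_le hk h1k h1s hsr task hε hεE hD θ hα seed)
    _ = B := by rw [lintegral_const, measure_univ, mul_one]

end

/-! ### The laws of the iterates -/

section

variable {d n r k s : ℕ} {X : Type u} {S : Type v} [MeasurableSpace S]

lemma measurable_noisyGradDcmp {expand : S → Vec d} (he : Measurable expand) (ε₀ L : ℝ) :
    Measurable (noisyGradDcmp expand ε₀ L) := by
  unfold noisyGradDcmp
  have h1 : Measurable fun m : Compressed S => expand m.2 := he.comp measurable_snd
  have h2 : Measurable fun m : Compressed S => (if m.1 then (1 : ℝ) else -1) :=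
    Measurable.ite (measurable_fst (measurableSet_singleton true)) measurable_const measurable_const
  have h3 : Measurable fun m : Compressed S => ‖expand m.2‖⁻¹ • expand m.2 := h1.norm.inv.smul h1
  exact h2.smul (h3.const_smul (radius d ε₀ L))

lemma measurable_update (task : Task d X S) (he : Measurable task.expand)
    (hne : task.feasible.Nonempty) (hc : IsClosed task.feasible) (hconv : Convex ℝ task.feasible)
    (t : ℕ) : Measurable fun p : Vec d × (Fin (k * s) → Compressed S) => update task t p.1 p.2 := by
  unfold update
  have h : Measurable fun p : Vec d × (Fin (k * s) → Compressed S) =>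
      ∑ b, noisyGradDcmp task.expand task.ε₀ task.L (p.2 b) :=
    Finset.measurable_sum _ fun b _ =>
      (measurable_noisyGradDcmp he _ _).comp ((measurable_pi_apply b).comp measurable_snd)
  exact (continuous_proj hne hc hconv).measurable.comp
    (measurable_fst.sub ((h.const_smul (((k * s : ℕ) : ℝ)⁻¹)).const_smul (task.stepSize t)))

lemma measurable_snoc {β : Type*} [MeasurableSpace β] (T : ℕ) :
    Measurable fun p : (Fin T → β) × β => (Fin.snoc p.1 p.2 : Fin (T + 1) → β) := by
  refine measurable_pi_lambda _ fun i => ?_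
  refine Fin.lastCases ?_ (fun j => ?_) i
  · simpa using measurable_snd
  · simpa [Function.comp_def] using (measurable_pi_apply (X := fun _ : Fin T => β) j).comp
      (measurable_fst (β := β))

/-- The transcript and the model after one more iteration in which `m` is revealed. -/
noncomputable def extendRun (task : Task d X S) (T : ℕ)
    (y : (Fin T → Fin (k * s) → Compressed S) × Vec d) (m : Fin (k * s) → Compressed S) :
    (Fin (T + 1) → Fin (k * s) → Compressed S) × Vec d :=
  (Fin.snoc y.1 m, update task (T + 1) y.2 m)

lemma measurable_extendRun (task : Task d X S) (he : Measurable task.expand)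
    (hne : task.feasible.Nonempty) (hc : IsClosed task.feasible) (hconv : Convex ℝ task.feasible)
    (T : ℕ) : Measurable fun p : ((Fin T → Fin (k * s) → Compressed S) × Vec d) ×
      (Fin (k * s) → Compressed S) => extendRun task T p.1 p.2 := by
  have h1 := (measurable_snoc (β := Fin (k * s) → Compressed S) T).comp
    ((measurable_fst.comp measurable_fst).prodMk measurable_snd :
      Measurable fun p : ((Fin T → Fin (k * s) → Compressed S) × Vec d) ×
        (Fin (k * s) → Compressed S) => (p.1.1, p.2))
  have h2 := (measurable_update (k := k) (s := s) task he hne hc hconv (T + 1)).comp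
    ((measurable_snd.comp measurable_fst).prodMk measurable_snd :
      Measurable fun p : ((Fin T → Fin (k * s) → Compressed S) × Vec d) ×
        (Fin (k * s) → Compressed S) => (p.1.2, p.2))
  rw [Function.comp_def] at h1 h2
  exact h1.prodMk h2

lemma isProbabilityMeasure_iterationLaw (hk : k ≤ n) (hsr : s ≤ r) (task : Task d X S)
    [IsProbabilityMeasure task.seedLaw] (he : Measurable task.expand) (θ : Vec d)
    (D : Dataset n r X) : IsProbabilityMeasure (iterationLaw hk s task θ D) := by
  have := isProbabilityMeasure_roundMeasure (n := n) hsr task.seedLaw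
  exact Measure.isProbabilityMeasure_map (measurable_revealed_right hk task he D θ).aemeasurable

lemma runLaw_succ_eq_map (hk : k ≤ n) (task : Task d X S) (D : Dataset n r X) (T : ℕ) :
    runLaw hk s task D (T + 1) =
      ((runLaw hk s task D T).prod (roundMeasure n r s task.seedLaw)).map fun z =>
        extendRun task T z.1 (revealed hk task D z.1.2 z.2) := rfl

lemma measurable_extendRun_revealed (hk : k ≤ n) (task : Task d X S)
    (he : Measurable task.expand) (hne : task.feasible.Nonempty) (hc : IsClosed task.feasible)
    (hconv : Convex ℝ task.feasible) (D : Dataset n r X) (T : ℕ) :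
    Measurable fun z : ((Fin T → Fin (k * s) → Compressed S) × Vec d) × Round n r s S =>
      extendRun task T z.1 (revealed hk task D z.1.2 z.2) := by
  have h1 := (measurable_revealed (s := s) hk task he D).comp
    ((measurable_snd.comp measurable_fst).prodMk measurable_snd :
      Measurable fun z : ((Fin T → Fin (k * s) → Compressed S) × Vec d) × Round n r s S =>
        (z.1.2, z.2))
  have h2 := (measurable_extendRun (k := k) (s := s) task he hne hc hconv T).comp
    (measurable_fst.prodMk h1)
  rw [Function.comp_def] at h2
  exact h2

lemma isProbabilityMeasure_runLaw (hk : k ≤ n) (hsr : s ≤ r) (task : Task d X S)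
    [IsProbabilityMeasure task.seedLaw] (he : Measurable task.expand)
    (hne : task.feasible.Nonempty) (hc : IsClosed task.feasible) (hconv : Convex ℝ task.feasible)
    (D : Dataset n r X) (T : ℕ) : IsProbabilityMeasure (runLaw hk s task D T) := by
  have := isProbabilityMeasure_roundMeasure (n := n) hsr task.seedLaw
  induction T with
  | zero => exact Measure.dirac.isProbabilityMeasure
  | succ T ih =>
    rw [runLaw_succ_eq_map]
    exact Measure.isProbabilityMeasure_map
      (measurable_extendRun_revealed hk task he hne hc hconv D T).aemeasurable

/-- Given the past, the messages revealed next follow the law of a single iteration at the current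
model. Through this identity the bound for one iteration enters the composition. -/
lemma lintegral_runLaw_succ (hk : k ≤ n) (hsr : s ≤ r) (task : Task d X S)
    [IsProbabilityMeasure task.seedLaw] (he : Measurable task.expand)
    (hne : task.feasible.Nonempty) (hc : IsClosed task.feasible) (hconv : Convex ℝ task.feasible)
    (D : Dataset n r X) (T : ℕ)
    {f : (Fin (T + 1) → Fin (k * s) → Compressed S) × Vec d → ENNReal} (hf : Measurable f) :
    ∫⁻ y, f y ∂(runLaw hk s task D (T + 1)) =
      ∫⁻ y, ∫⁻ m, f (extendRun task T y m) ∂(iterationLaw hk s task y.2 D)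
        ∂(runLaw hk s task D T) := by
  have := isProbabilityMeasure_roundMeasure (n := n) hsr task.seedLaw
  have hm := measurable_extendRun_revealed (s := s) hk task he hne hc hconv D T
  rw [runLaw_succ_eq_map, lintegral_map hf hm]
  have hfm := hf.comp hm
  rw [Function.comp_def] at hfm
  rw [lintegral_prod _ hfm.aemeasurable]
  refine lintegral_congr fun y => ?_
  have h3 := (measurable_extendRun (k := k) (s := s) task he hne hc hconv T).comp
    (measurable_prodMk_left (x := y))
  have h4 := hf.comp h3
  rw [Function.comp_def, Function.comp_def] at h4
  rw [iterationLaw, lintegral_map h4 (measurable_revealed_right hk task he D y.2)]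

/-- Two runs on neighbouring datasets are images, under the same map, of measures with densities
whose Rényi moment is at most the `T`-th power of that of an iteration. -/
lemma exists_density_runLaw (hk : k ≤ n) (hsr : s ≤ r) (task : Task d X S)
    [IsProbabilityMeasure task.seedLaw] (he : Measurable task.expand)
    (hne : task.feasible.Nonempty) (hc : IsClosed task.feasible) (hconv : Convex ℝ task.feasible)
    (hε : 0 < task.ε₀) (D D' : Dataset n r X) {α : ℝ} {b : ENNReal}
    (hb : ∀ θ, renyiMoment (Measure.pi fun _ : Fin (k * s) => msgBase task.seedLaw)
      (fun m => revealedDensity hk task D (θ, m)) (fun m => revealedDensity hk task D' (θ, m)) α ≤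
        b) (T : ℕ) :
    ∃ (Ω : Type v) (_ : MeasurableSpace Ω) (ν : Measure Ω) (_ : SigmaFinite ν) (p q : Ω → ℝ)
      (g : Ω → (Fin T → Fin (k * s) → Compressed S) × Vec d),
      Measurable p ∧ Measurable q ∧ Measurable g ∧ (∀ ω, 0 < p ω) ∧ (∀ ω, 0 < q ω) ∧
      runLaw hk s task D T = (ν.withDensity fun ω => ENNReal.ofReal (p ω)).map g ∧
      runLaw hk s task D' T = (ν.withDensity fun ω => ENNReal.ofReal (q ω)).map g ∧
      renyiMoment ν p q α ≤ b ^ T := by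
  -- The model is a deterministic function of the transcript, so the output itself need not have a
  -- density. The density lives on a space `Ω` of transcripts, and `g` recovers the output from it.
  induction T with
  | zero =>
    refine ⟨PUnit, inferInstance, Measure.dirac PUnit.unit, inferInstance, fun _ => 1, fun _ => 1,
      fun _ => (Fin.elim0, task.init), measurable_const, measurable_const, measurable_const,
      fun _ => one_pos, fun _ => one_pos, ?_, ?_, ?_⟩
    · simp [runLaw, Measure.map_dirac' measurable_const]
    · simp [runLaw, Measure.map_dirac' measurable_const]
    · simp [renyiMoment]
  | succ T ih =>
    obtain ⟨Ω, mΩ, ν, hν, p, q, g, hp, hq, hg, hp0, hq0, hP, hQ, hM⟩ := ih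
    have hd : ∀ D : Dataset n r X, Measurable fun z : Ω × (Fin (k * s) → Compressed S) =>
        revealedDensity hk task D ((g z.1).2, z.2) := fun D => by
      have h := (measurable_revealedDensity (s := s) hk task he D).comp
        ((hg.snd.comp measurable_fst).prodMk measurable_snd :
          Measurable fun z : Ω × (Fin (k * s) → Compressed S) => ((g z.1).2, z.2))
      rw [Function.comp_def] at h
      exact h
    have hg' : Measurable fun z : Ω × (Fin (k * s) → Compressed S) =>
        extendRun task T (g z.1) z.2 := by
      have h := (measurable_extendRun (k := k) (s := s) task he hne hc hconv T).comp
        ((hg.comp measurable_fst).prodMk measurable_snd :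
          Measurable fun z : Ω × (Fin (k * s) → Compressed S) => (g z.1, z.2))
      rw [Function.comp_def] at h
      exact h
    have hdθ : ∀ (D : Dataset n r X) θ, Measurable fun m : Fin (k * s) → Compressed S =>
        revealedDensity hk task D (θ, m) := fun D θ => by
      have h := (measurable_revealedDensity (s := s) hk task he D).comp
        (measurable_prodMk_left (x := θ))
      rw [Function.comp_def] at h
      exact h
    have key : ∀ (D : Dataset n r X) (p : Ω → ℝ), Measurable p → (∀ ω, 0 < p ω) →
        runLaw hk s task D T = (ν.withDensity fun ω => ENNReal.ofReal (p ω)).map g →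
        runLaw hk s task D (T + 1) =
          ((ν.prod (Measure.pi fun _ : Fin (k * s) => msgBase task.seedLaw)).withDensity fun z =>
            ENNReal.ofReal (p z.1 * revealedDensity hk task D ((g z.1).2, z.2))).map
            (fun z => extendRun task T (g z.1) z.2) := by
      intro D p hp hp0 hP
      have hext := fun y => (measurable_extendRun (k := k) (s := s) task he hne hc hconv T).comp
        (measurable_prodMk_left (x := y))
      refine Measure.ext_of_lintegral _ fun f hf => ?_
      have hfg := hf.comp hg'
      rw [Function.comp_def] at hfg
      have hpd : Measurable fun z : Ω × (Fin (k * s) → Compressed S) =>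
          ENNReal.ofReal (p z.1 * revealedDensity hk task D ((g z.1).2, z.2)) :=
        ((hp.comp measurable_fst).mul (hd D)).ennreal_ofReal
      have hinner : ∀ y, ∫⁻ m, f (extendRun task T y m) ∂(iterationLaw hk s task y.2 D) =
          ∫⁻ m, ENNReal.ofReal (revealedDensity hk task D (y.2, m)) * f (extendRun task T y m)
            ∂(Measure.pi fun _ : Fin (k * s) => msgBase task.seedLaw) := by
        intro y
        have h4 := hf.comp (hext y)
        rw [Function.comp_def, Function.comp_def] at h4
        rw [iterationLaw_eq_withDensity hk hsr task he,
          lintegral_withDensity_eq_lintegral_mul _ (hdθ D y.2).ennreal_ofReal h4]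
        rfl
      have hjoint : Measurable fun z : ((Fin T → Fin (k * s) → Compressed S) × Vec d) ×
          (Fin (k * s) → Compressed S) => ENNReal.ofReal (revealedDensity hk task D (z.1.2, z.2)) *
            f (extendRun task T z.1 z.2) := by
        have h5 := (measurable_revealedDensity (s := s) hk task he D).comp
          ((measurable_snd.comp measurable_fst).prodMk measurable_snd :
            Measurable fun z : ((Fin T → Fin (k * s) → Compressed S) × Vec d) ×
              (Fin (k * s) → Compressed S) => (z.1.2, z.2))
        have h6 := hf.comp (measurable_extendRun (k := k) (s := s) task he hne hc hconv T)
        rw [Function.comp_def] at h5 h6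
        exact h5.ennreal_ofReal.mul h6
      have hint := hjoint.lintegral_prod_right'
        (ν := Measure.pi fun _ : Fin (k * s) => msgBase task.seedLaw)
      have hint' := hint.comp hg
      rw [Function.comp_def] at hint'
      rw [lintegral_runLaw_succ hk hsr task he hne hc hconv D T hf, lintegral_congr hinner, hP,
        lintegral_map hint hg, lintegral_withDensity_eq_lintegral_mul _ hp.ennreal_ofReal hint',
        lintegral_map hf hg', lintegral_withDensity_eq_lintegral_mul _ hpd hfg,
        lintegral_prod _ (hpd.mul hfg).aemeasurable]
      refine lintegral_congr fun ω => ?_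
      have h7 := hjoint.comp (measurable_prodMk_left (x := g ω))
      rw [Function.comp_def] at h7
      rw [Pi.mul_apply, ← lintegral_const_mul _ h7]
      refine lintegral_congr fun m => ?_
      rw [Pi.mul_apply, ← mul_assoc, ← ENNReal.ofReal_mul (hp0 ω).le]
    refine ⟨Ω × (Fin (k * s) → Compressed S), inferInstance,
      ν.prod (Measure.pi fun _ : Fin (k * s) => msgBase task.seedLaw), inferInstance,
      fun z => p z.1 * revealedDensity hk task D ((g z.1).2, z.2),
      fun z => q z.1 * revealedDensity hk task D' ((g z.1).2, z.2),
      fun z => extendRun task T (g z.1) z.2, (hp.comp measurable_fst).mul (hd D),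
      (hq.comp measurable_fst).mul (hd D'), hg',
      fun z => mul_pos (hp0 _) (revealedDensity_pos hk hsr task hε D _),
      fun z => mul_pos (hq0 _) (revealedDensity_pos hk hsr task hε D' _),
      key D p hp hp0 hP, key D' q hq hq0 hQ, ?_⟩
    have hmeas : Measurable fun z : Ω × (Fin (k * s) → Compressed S) => ENNReal.ofReal
        (q z.1 * revealedDensity hk task D' ((g z.1).2, z.2) *
          (p z.1 * revealedDensity hk task D ((g z.1).2, z.2) /
            (q z.1 * revealedDensity hk task D' ((g z.1).2, z.2))) ^ α) := by
      have h1 := (hp.comp measurable_fst).mul (hd D)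
      have h2 := (hq.comp measurable_fst).mul (hd D')
      exact (h2.mul ((h1.div h2).pow_const α)).ennreal_ofReal
    rw [renyiMoment, lintegral_prod _ hmeas.aemeasurable]
    calc _ ≤ ∫⁻ ω, ENNReal.ofReal (q ω * (p ω / q ω) ^ α) * b ∂ν := by
          refine lintegral_mono fun ω => ?_
          -- Adaptive composition: for a fixed past, the inner integral is the moment of one
          -- iteration at the model reached, and `b` bounds it whatever that model is.
          refine le_trans (le_of_eq ?_) (mul_le_mul_right (hb (g ω).2) _)
          have hmm : Measurable fun m : Fin (k * s) → Compressed S => ENNReal.ofReal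
              (revealedDensity hk task D' ((g ω).2, m) *
                (revealedDensity hk task D ((g ω).2, m) /
                  revealedDensity hk task D' ((g ω).2, m)) ^ α) :=
            ((hdθ D' _).mul (((hdθ D _).div (hdθ D' _)).pow_const α)).ennreal_ofReal
          rw [renyiMoment, ← lintegral_const_mul _ hmm]
          refine lintegral_congr fun m => ?_
          have e1 := revealedDensity_pos hk hsr task hε D ((g ω).2, m)
          have e2 := revealedDensity_pos hk hsr task hε D' ((g ω).2, m)
          have e3 := hp0 ω
          have e4 := hq0 ω
          rw [← ENNReal.ofReal_mul (by positivity), mul_div_mul_comm,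
            Real.mul_rpow (by positivity) (by positivity)]
          congr 1
          ring
      _ = renyiMoment ν p q α * b := lintegral_mul_const _
          (hq.mul ((hp.div hq).pow_const α)).ennreal_ofReal
      _ ≤ b ^ T * b := mul_le_mul_left hM _
      _ = b ^ (T + 1) := (pow_succ b T).symm

end

/-! ### The privacy guarantee -/

/-- Convexity of `exp` between `0` and `x`. The amplified privacy level is therefore at least linear
in `γ`, which is all that the RDP bound requires of it. -/
lemma mul_le_log_one_add_mul_exp {γ x : ℝ} (hγ : 0 ≤ γ) (hγ1 : γ ≤ 1) (hx : 0 ≤ x) :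
    γ * x ≤ Real.log (1 + γ * (Real.exp x - 1)) := by
  have h := convexOn_exp.2 (Set.mem_univ x) (Set.mem_univ 0) hγ (sub_nonneg.2 hγ1) (by ring)
  simp only [smul_eq_mul, mul_zero, add_zero, Real.exp_zero, mul_one] at h
  have h1 := Real.one_le_exp hx
  rw [Real.le_log_iff_exp_le (by nlinarith)]
  linarith

/-- The objective of the conversion from RDP to DP attains its minimum. -/
lemma exists_isLeast_conversion {c Λ : ℝ} (hc : 0 < c) (hΛ : 0 < Λ) :
    ∃ a : ℝ, 1 < a ∧ ∀ x : ℝ, 1 < x →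
      c * a + Real.log (1 - 1 / a) + (Λ - Real.log a) / (a - 1) ≤
        c * x + Real.log (1 - 1 / x) + (Λ - Real.log x) / (x - 1) := by
  set f : ℝ → ℝ := fun x => c * x + Real.log (1 - 1 / x) + (Λ - Real.log x) / (x - 1) with hf
  have hcont : ContinuousOn f (Set.Ioi 1) := by
    intro x hx
    have hx : 1 < x := hx
    have h0 : x ≠ 0 := by linarith
    have h1 : x - 1 ≠ 0 := by linarith
    have h2 : (1 : ℝ) - 1 / x ≠ 0 := by
      rw [one_sub_div h0]; exact div_ne_zero h1 h0
    refine ContinuousAt.continuousWithinAt ?_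
    refine ((continuousAt_const.mul continuousAt_id).add (ContinuousAt.log (continuousAt_const.sub
      (continuousAt_const.div continuousAt_id h0)) h2)).add ((continuousAt_const.sub
      (Real.continuousAt_log h0)).div (continuousAt_id.sub continuousAt_const) h1)
  set m := |f 2| with hm
  have hm0 : 0 ≤ m := abs_nonneg _
  have hfm : f 2 ≤ m := le_abs_self _
  -- Thresholds beyond which the objective exceeds its value at `2`, so that compactness of `[1 + 1
  -- / W², b]` gives a minimizer. `W` is chosen with `Λ W = m + 4 + Λ`, and `b` so that `c b ≥ m +
  -- 2`.
  set W := (m + 4) / Λ + 1 with hW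
  have hW1 : 1 < W := by
    have : 0 < (m + 4) / Λ := by positivity
    linarith
  set b := (m + 2) / c + 2 with hb
  have hb2 : 2 ≤ b := by
    have : 0 < (m + 2) / c := by positivity
    linarith
  have ha1 : 1 < 1 + 1 / W ^ 2 := by
    have : 0 < 1 / W ^ 2 := by positivity
    linarith
  have ha2 : 1 + 1 / W ^ 2 ≤ 2 := by
    have : 1 / W ^ 2 ≤ 1 := by
      rw [div_le_one (by positivity)]; nlinarith
    linarith
  obtain ⟨a, ha, hmin⟩ := (isCompact_Icc (a := 1 + 1 / W ^ 2) (b := b)).exists_isMinOn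
    ⟨2, ha2, hb2⟩ (hcont.mono fun x hx => lt_of_lt_of_le ha1 hx.1)
  have hfa : f a ≤ f 2 := hmin ⟨ha2, hb2⟩
  refine ⟨a, lt_of_lt_of_le ha1 ha.1, fun x hx => ?_⟩
  change f a ≤ f x
  have hx0 : 0 < x := by linarith
  have hu : 0 < x - 1 := by linarith
  have hlogx : Real.log x ≤ x - 1 := Real.log_le_sub_one_of_pos hx0
  have hquot : -1 ≤ (Λ - Real.log x) / (x - 1) - Λ / (x - 1) := by
    rw [← sub_div, le_div_iff₀ hu]; linarith
  by_cases h1 : x < 1 + 1 / W ^ 2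
  · refine (hfa.trans hfm).trans ?_
    -- Near `1` the term `Λ / (x - 1) = Λ w²` has to beat `log (x - 1)`, which is at least `-2 w`.
    set w := (√(x - 1))⁻¹ with hw
    have hs : 0 < √(x - 1) := Real.sqrt_pos.2 hu
    have hw0 : 0 < w := inv_pos.2 hs
    have hww : w ^ 2 = (x - 1)⁻¹ := by rw [hw, inv_pow, Real.sq_sqrt hu.le]
    have hWw : W ≤ w := by
      have : W ^ 2 ≤ w ^ 2 := by
        rw [hww, ← one_div, le_div_iff₀ hu]
        have h2 : x - 1 < 1 / W ^ 2 := by linarith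
        rw [lt_div_iff₀ (by positivity)] at h2
        linarith
      exact (pow_le_pow_iff_left₀ (by linarith) hw0.le two_ne_zero).1 this
    have hlog : -(2 * w) ≤ Real.log (x - 1) := by
      have h2 : Real.log (x - 1) = -(2 * Real.log w) := by
        rw [hw, Real.log_inv, Real.log_sqrt hu.le]; ring
      rw [h2]
      have := Real.log_le_sub_one_of_pos hw0
      linarith
    have hl : Real.log (1 - 1 / x) = Real.log (x - 1) - Real.log x := by
      rw [one_sub_div hx0.ne', Real.log_div hu.ne' hx0.ne']
    have hΛw : Λ / (x - 1) = Λ * w ^ 2 := by rw [hww, div_eq_mul_inv]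
    have h3 : m + 4 ≤ Λ * w - Λ + Λ := by
      have : Λ * W = m + 4 + Λ := by rw [hW]; field_simp
      nlinarith
    have h4 : (Λ * w - 2) * w ≥ m + 2 := by nlinarith
    have hcx : 0 < c * x := by positivity
    rw [hf]
    simp only
    rw [hl]
    have : x < 2 := by linarith
    nlinarith
  · by_cases h2 : x ≤ b
    · exact hmin ⟨not_lt.1 h1, h2⟩
    · push Not at h2
      refine (hfa.trans hfm).trans ?_
      have hx2 : 2 < x := by linarith
      have hlog : -1 ≤ Real.log (1 - 1 / x) := by
        have h3 : (1 - 1 / x)⁻¹ ≤ 2 := by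
          rw [one_sub_div hx0.ne', inv_div, div_le_iff₀ hu]; linarith
        have h4 : 0 < 1 - 1 / x := by
          rw [one_sub_div hx0.ne']; positivity
        have h5 := Real.log_le_sub_one_of_pos (inv_pos.2 h4)
        rw [Real.log_inv] at h5
        linarith
      have hΛ' : 0 < Λ / (x - 1) := by positivity
      have hcx : m + 2 ≤ c * x := by
        have : c * b = m + 2 + 2 * c := by rw [hb]; field_simp
        nlinarith
      rw [hf]
      simp only
      linarith

section

variable {d n r k s : ℕ} {X : Type u} {S : Type v} [MeasurableSpace S]

lemma samplingRate_mul_totalPoints (hn : 1 ≤ n) (hr : 1 ≤ r) :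
    samplingRate n r k s * totalPoints n r = (k : ℝ) * s := by
  have : (0 : ℝ) < n := by exact_mod_cast hn
  have : (0 : ℝ) < r := by exact_mod_cast hr
  unfold samplingRate totalPoints
  field_simp

lemma samplingRate_pos (hn : 1 ≤ n) (hr : 1 ≤ r) (hk : 1 ≤ k) (hs : 1 ≤ s) :
    0 < samplingRate n r k s := by
  have : (0 : ℝ) < n := by exact_mod_cast hn
  have : (0 : ℝ) < r := by exact_mod_cast hr
  have : (0 : ℝ) < k := by exact_mod_cast hk
  have : (0 : ℝ) < s := by exact_mod_cast hs
  unfold samplingRate totalPoints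
  positivity

lemma samplingRate_le_one (hk : k ≤ n) (hs : s ≤ r) : samplingRate n r k s ≤ 1 := by
  unfold samplingRate totalPoints
  refine div_le_one_of_le₀ ?_ (by positivity)
  exact_mod_cast Nat.mul_le_mul hk hs

/-- The constant in the privacy level after shuffling. -/
noncomputable def shuffleConst (E δ₁ : ℝ) : ℝ := √(2 * rdpConst E / Real.log (1 / δ₁))

lemma log_one_div_pos {δ : ℝ} (h0 : 0 < δ) (h1 : δ < 1) : 0 < Real.log (1 / δ) :=
  Real.log_pos (by rw [lt_div_iff₀ h0]; linarith)

lemma shuffleConst_pos {E δ₁ : ℝ} (hE : 0 < E) (h0 : 0 < δ₁) (h1 : δ₁ < 1) :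
    0 < shuffleConst E δ₁ := by
  have := rdpConst_pos hE
  have := log_one_div_pos h0 h1
  unfold shuffleConst
  positivity

lemma shuffledEps_pos {C ε₀ δ m : ℝ} (hC : 0 < C) (hε : 0 < ε₀) (h0 : 0 < δ) (h1 : δ < 1)
    (hm : 0 < m) : 0 < shuffledEps C ε₀ δ m := by
  have := log_one_div_pos h0 h1
  unfold shuffledEps
  positivity

/-- Since `γ x ≤ log (1 + γ (e^x - 1))`, it suffices that `x² ≥ 2 · rdpConst E · (min ε₀ 1)² / m`.
This holds because the constant squared is `2 · rdpConst E / log (1 / δ₁)`, while `log (1 / δ') ≥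
log (1 / δ₁)` and `e^ε₀ ≥ 1`. -/
lemma mul_rdpConst_le_iterationRDP {E δ₁ ε₀ δ' γ m α : ℝ} (hE : 0 < E) (h0 : 0 < δ₁)
    (h1 : δ₁ < 1) (hε : 0 < ε₀) (hδ0 : 0 < δ') (hδ1 : δ' ≤ δ₁) (hγ : 0 < γ) (hγ1 : γ ≤ 1)
    (hm : 0 < m) (hα : 0 < α) :
    α * (rdpConst E * (γ * min ε₀ 1) ^ 2 / m) ≤
      iterationRDP γ (shuffledEps (shuffleConst E δ₁) ε₀ δ' m) α := by
  have hK := rdpConst_pos hE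
  have hl := log_one_div_pos h0 h1
  have hle : Real.log (1 / δ₁) ≤ Real.log (1 / δ') :=
    Real.log_le_log (by positivity) (one_div_le_one_div_of_le hδ0 hδ1)
  have hpos := shuffledEps_pos (shuffleConst_pos hE h0 h1) hε hδ0 (hδ1.trans_lt h1) hm
  set x := shuffledEps (shuffleConst E δ₁) ε₀ δ' m with hx
  have h2 := mul_le_log_one_add_mul_exp hγ.le hγ1 hpos.le
  have hsq : 2 * rdpConst E * (min ε₀ 1) ^ 2 / m ≤ x ^ 2 := by
    have e : x ^ 2 = 2 * rdpConst E * (min ε₀ 1) ^ 2 / m * ((Real.exp ε₀) ^ 2 *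
        (Real.log (1 / δ') / Real.log (1 / δ₁))) := by
      rw [hx, shuffledEps, shuffleConst, mul_pow, mul_pow, mul_pow,
        Real.sq_sqrt (by positivity), Real.sq_sqrt (div_nonneg (hl.le.trans hle) hm.le)]
      field_simp
    rw [e]
    have he := Real.one_le_exp hε.le
    refine le_mul_of_one_le_right (by positivity) (one_le_mul_of_one_le_of_one_le ?_ ?_)
    · nlinarith
    · rwa [le_div_iff₀ hl, one_mul]
  have h3 : (γ * x) ^ 2 ≤ (Real.log (1 + γ * (Real.exp x - 1))) ^ 2 :=
    pow_le_pow_left₀ (by positivity) h2 2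
  unfold iterationRDP
  rw [mul_div_assoc α (Real.log _ ^ 2)]
  refine mul_le_mul_of_nonneg_left ?_ hα.le
  rw [le_div_iff₀ two_pos]
  refine le_trans ?_ h3
  calc rdpConst E * (γ * min ε₀ 1) ^ 2 / m * 2 = γ ^ 2 * (2 * rdpConst E * (min ε₀ 1) ^ 2 / m) := by
        ring
    _ ≤ γ ^ 2 * x ^ 2 := by gcongr
    _ = _ := by ring

theorem privacy_of_camel {E δ₁ : ℝ} (hE : 0 < E) (h0 : 0 < δ₁) (h1 : δ₁ < 1)
    (task : Task d X S) (hk : k ≤ n) (h1k : 1 ≤ k) (h1s : 1 ≤ s) (hsr : s ≤ r)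
    (hprob : IsProbabilityMeasure task.seedLaw) (he : Measurable task.expand)
    (hne : task.feasible.Nonempty) (hc : IsClosed task.feasible)
    (hconv : Convex ℝ task.feasible) (hε : 0 < task.ε₀) (hεE : task.ε₀ ≤ E) {δ' : ℝ}
    (hδ0 : 0 < δ') (hδ1 : δ' ≤ δ₁) {γ M ε' : ℝ} (hM : M = totalPoints n r)
    (hγ : γ = samplingRate n r k s)
    (hε' : ε' = shuffledEps (shuffleConst E δ₁) task.ε₀ δ' (γ * M)) :
    (∀ (θ : Vec d) (α : ℝ), 1 < α → IsRDP α (iterationRDP γ ε' α)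
      (fun D : Dataset n r X => iterationLaw hk s task θ D)) ∧
    (∀ (T : ℕ) (δ : ℝ), 1 ≤ T → 0 < δ → δ < 1 →
      ∃ ε : ℝ, IsLeast (convertedEps T γ ε' δ '' Set.Ioi 1) ε ∧
        IsDP ε δ (fun D : Dataset n r X => runLaw hk s task D T)) := by
  have hγM : γ * M = (k : ℝ) * s := by
    rw [hγ, hM, samplingRate_mul_totalPoints (h1k.trans hk) (h1s.trans hsr)]
  have hγ0 : 0 < γ := hγ ▸ samplingRate_pos (h1k.trans hk) (h1s.trans hsr) h1k h1s
  have hγ1 : γ ≤ 1 := hγ ▸ samplingRate_le_one hk hsr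
  have hks : (0 : ℝ) < k * s := by
    have : (0 : ℝ) < k := by exact_mod_cast h1k
    have : (0 : ℝ) < s := by exact_mod_cast h1s
    positivity
  rw [hγM] at hε'
  have hmoment : ∀ (θ : Vec d) (α : ℝ), 1 < α → ∀ D D' : Dataset n r X, Neighboring D D' →
      renyiMoment (Measure.pi fun _ : Fin (k * s) => msgBase task.seedLaw)
        (fun m => revealedDensity hk task D (θ, m))
        (fun m => revealedDensity hk task D' (θ, m)) α ≤
        ENNReal.ofReal (Real.exp ((α - 1) * iterationRDP γ ε' α)) := by
    intro θ α hα D D' hD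
    refine (renyiMoment_revealedDensity_le hk h1k h1s hsr task he hε hεE hD θ hα).trans
      (ENNReal.ofReal_le_ofReal (Real.exp_le_exp.2
        (mul_le_mul_of_nonneg_left ?_ (by linarith))))
    rw [hε']
    have h := mul_rdpConst_le_iterationRDP hE h0 h1 hε hδ0 hδ1 hγ0 hγ1 hks
      (α := α) (by linarith)
    rw [hγ, samplingRate, totalPoints] at h ⊢
    exact h
  refine ⟨fun θ α hα D D' hD => ?_, fun T δ hT hδ hδ' => ?_⟩
  · have hm : ∀ D : Dataset n r X, Measurable fun m : Fin (k * s) → Compressed S =>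
        revealedDensity hk task D (θ, m) := fun D => by
      have h := (measurable_revealedDensity (s := s) hk task he D).comp
        (measurable_prodMk_left (x := θ))
      rw [Function.comp_def] at h
      exact h
    simp only
    rw [iterationLaw_eq_withDensity hk hsr task he, iterationLaw_eq_withDensity hk hsr task he]
    exact renyiDiv_withDensity_le _ (hm D) (hm D')
      (fun m => revealedDensity_pos hk hsr task hε D _)
      (fun m => revealedDensity_pos hk hsr task hε D' _) hα (hmoment θ α hα D D' hD)
  · have hεpos : 0 < ε' :=
      hε' ▸ shuffledEps_pos (shuffleConst_pos hE h0 h1) hε hδ0 (hδ1.trans_lt h1) hks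
    have hT0 : (0 : ℝ) < T := by exact_mod_cast hT
    have hlog : 0 < Real.log (1 + γ * (Real.exp ε' - 1)) :=
      lt_of_lt_of_le (mul_pos hγ0 hεpos) (mul_le_log_one_add_mul_exp hγ0.le hγ1 hεpos.le)
    obtain ⟨a, ha, hmin⟩ := exists_isLeast_conversion
      (c := T * (Real.log (1 + γ * (Real.exp ε' - 1)) ^ 2 / 2)) (by positivity)
      (log_one_div_pos hδ hδ')
    have hconvEq : ∀ x, convertedEps T γ ε' δ x =
        T * (Real.log (1 + γ * (Real.exp ε' - 1)) ^ 2 / 2) * x + Real.log (1 - 1 / x) +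
          (Real.log (1 / δ) - Real.log x) / (x - 1) := by
      intro x
      unfold convertedEps iterationRDP
      ring
    refine ⟨convertedEps T γ ε' δ a, ⟨⟨a, ha, rfl⟩, ?_⟩, ?_⟩
    · rintro _ ⟨x, hx, rfl⟩
      rw [hconvEq, hconvEq]
      exact hmin x hx
    · intro D D' hD A hA
      obtain ⟨Ω, mΩ, ν, hν, p, q, g, hp, hq, hg, hp0, hq0, hP, hQ, hMom⟩ :=
        exists_density_runLaw hk hsr task he hne hc hconv hε D D'
          (fun θ => hmoment θ a ha D D' hD) T
      have hMom' : renyiMoment ν p q a ≤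
          ENNReal.ofReal (Real.exp ((a - 1) * (T * iterationRDP γ ε' a))) := by
        refine hMom.trans (le_of_eq ?_)
        rw [← ENNReal.ofReal_pow (Real.exp_pos _).le, ← Real.exp_nat_mul]
        congr 2
        ring
      simp only
      -- Post-processing: an event for the output is the event `g ⁻¹' A` for the underlying
      -- densities.
      rw [hP, hQ, Measure.map_apply hg hA, Measure.map_apply hg hA]
      exact dp_of_renyiMoment_le ν hp hq hp0 hq0 ha hδ hMom' (hg hA)

end

/-! ### Communication -/

section

variable {n p κ d e l N : ℕ}

/-- The number of bits of all messages. -/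
def totalBits (ms : List (Msg n p κ d e)) : ℕ := (ms.map fun m => m.payload.bits).sum

lemma totalBits_append (a b : List (Msg n p κ d e)) :
    totalBits (a ++ b) = totalBits a + totalBits b := by
  simp [totalBits]

lemma totalBits_flatMap_finRange (m c : ℕ) (f : Fin m → List (Msg n p κ d e))
    (h : ∀ q, totalBits (f q) = c) : totalBits ((List.finRange m).flatMap f) = m * c := by
  have key : ∀ xs : List (Fin m), totalBits (xs.flatMap f) = xs.length * c := by
    intro xs
    induction xs with
    | nil => simp [totalBits]
    | cons a xs ih => rw [List.flatMap_cons, totalBits_append, ih, h, List.length_cons]; ring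
  rw [key, List.length_finRange]

lemma sum_filter_bits_le (f : Msg n p κ d e → Bool) (ms : List (Msg n p κ d e)) :
    ((ms.filter f).map fun m => m.payload.bits).sum ≤ totalBits ms :=
  List.Sublist.sum_le_sum ((List.filter_sublist).map _) fun _ _ => Nat.zero_le _

lemma clientServerBits_append (a b : List (Msg n p κ d e)) :
    clientServerBits (a ++ b) = clientServerBits a + clientServerBits b := by
  simp [clientServerBits]

lemma interServerBits_append (a b : List (Msg n p κ d e)) :
    interServerBits (a ++ b) = interServerBits a + interServerBits b := by
  simp [interServerBits]

lemma clientServerBits_eq_zero {ms : List (Msg n p κ d e)}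
    (h : ∀ m ∈ ms, (m.src.isServer = true ∧ m.dst.isServer = true) ∨ m.payload.isModel = true) :
    clientServerBits ms = 0 := by
  rw [clientServerBits, List.filter_eq_nil_iff.2]
  · rfl
  · intro m hm
    rcases h m hm with ⟨h1, h2⟩ | h1
    · simp [h1, h2]
    · simp [h1]

lemma interServerBits_eq_zero {ms : List (Msg n p κ d e)}
    (h : ∀ m ∈ ms, m.src.isServer = false ∨ m.dst.isServer = false) :
    interServerBits ms = 0 := by
  rw [interServerBits, List.filter_eq_nil_iff.2]
  · rfl
  · intro m hm
    rcases h m hm with h1 | h1 <;> simp [h1]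

lemma length_tableWords (x : Table p l N) : (Table.words x).length = N * (2 * l + 1) := by
  have : ∀ q, (Rec.words (x q)).length = 2 * l + 1 := fun q => by
    simp [Rec.words]; ring
  simp [Table.words, this]

lemma totalBits_beaverMsgs (P Q R : Party n) (τ : Triple p) (x₁ x₂ y₁ y₂ : ZMod p) :
    totalBits (beaverMsgs P Q R τ x₁ x₂ y₁ y₂ : List (Msg n p κ d e)) = 10 * seedBits p := by
  simp [totalBits, beaverMsgs, Payload.bits]
  ring

/-- `N l` multiplications at ten words each; the final multiplication and the two opened shares make
up the `12 = 10 + 2` words, and two hashes commit to the shares. -/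
lemma totalBits_macMsgs (hash : List (ZMod p) → Fin κ → Bool) (P Q R : Party n)
    (c : MacCoins p l N) (x₁ x₂ : Table p l N) :
    totalBits (macMsgs hash P Q R c x₁ x₂ : List (Msg n p κ d e)) =
      N * (l * (10 * seedBits p)) + 12 * seedBits p + 2 * κ := by
  rw [macMsgs, totalBits_append, totalBits_append, totalBits_beaverMsgs,
    totalBits_flatMap_finRange N (l * (10 * seedBits p)) _ fun q =>
      totalBits_flatMap_finRange l (10 * seedBits p) _ fun j => totalBits_beaverMsgs _ _ _ _ _ _ _ _]
  simp [totalBits, Payload.bits]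
  ring

/-- Seven tables and three MAC verifications travel; the three seeds and `3 · 12` words make `39`.
-/
lemma totalBits_shuffleMsgs (pub : Public p κ l N) (c : ProtocolCoins p l N)
    (x₁ x₂ : Table p l N) :
    totalBits (shuffleMsgs pub c x₁ x₂ : List (Msg n p κ d e)) =
      7 * (N * (2 * l + 1) * seedBits p) + 30 * (N * l * seedBits p) + 39 * seedBits p +
        6 * κ := by
  simp only [shuffleMsgs, totalBits_append, totalBits_macMsgs]
  simp [totalBits, Payload.bits, length_tableWords]
  ring

lemma totalBits_reconstructMsgs {B : ℕ} (hB : B ≤ N) (hash : List (ZMod p) → Fin κ → Bool)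
    (y₁ y₂ : Table p l N) :
    totalBits (reconstructMsgs hB hash y₁ y₂ : List (Msg n p κ d e)) =
      2 * (B * (2 * l + 1) * seedBits p) + 2 * κ := by
  simp [reconstructMsgs, totalBits, Payload.bits, length_tableWords]
  ring

lemma totalBits_uploadMsgs (owner : Fin N → Fin n) (pub : Public p κ l N)
    (c : ProtocolCoins p l N) (x : Fin N → Compressed (ZMod p)) :
    totalBits (uploadMsgs owner pub c x : List (Msg n p κ d e)) =
      N * (2 * ((l + 2) * seedBits p)) := by
  rw [uploadMsgs, totalBits_flatMap_finRange N (2 * ((l + 2) * seedBits p))]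
  intro q
  simp [totalBits, Payload.bits]
  ring

lemma isServer_of_mem_beaverMsgs {P Q R : Party n} (hP : P.isServer = true)
    (hQ : Q.isServer = true) (hR : R.isServer = true) {τ : Triple p} {x₁ x₂ y₁ y₂ : ZMod p}
    {m : Msg n p κ d e} (hm : m ∈ (beaverMsgs P Q R τ x₁ x₂ y₁ y₂ : List (Msg n p κ d e))) :
    m.src.isServer = true ∧ m.dst.isServer = true := by
  simp only [beaverMsgs, List.mem_cons, List.not_mem_nil, or_false] at hm
  rcases hm with rfl | rfl | rfl | rfl <;> simp [hP, hQ, hR]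

lemma isServer_of_mem_macMsgs {hash : List (ZMod p) → Fin κ → Bool} {P Q R : Party n}
    (hP : P.isServer = true) (hQ : Q.isServer = true) (hR : R.isServer = true)
    {c : MacCoins p l N} {x₁ x₂ : Table p l N} {m : Msg n p κ d e}
    (hm : m ∈ (macMsgs hash P Q R c x₁ x₂ : List (Msg n p κ d e))) :
    m.src.isServer = true ∧ m.dst.isServer = true := by
  rw [macMsgs, List.mem_append, List.mem_append] at hm
  rcases hm with (hm | hm) | hm
  · simp only [List.mem_flatMap] at hm
    obtain ⟨q, -, j, -, hm⟩ := hm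
    exact isServer_of_mem_beaverMsgs hP hQ hR hm
  · exact isServer_of_mem_beaverMsgs hP hQ hR hm
  · simp only [List.mem_cons, List.not_mem_nil, or_false] at hm
    rcases hm with rfl | rfl | rfl | rfl <;> simp [hP, hQ]

lemma isServer_of_mem_shuffleMsgs {pub : Public p κ l N} {c : ProtocolCoins p l N}
    {x₁ x₂ : Table p l N} {m : Msg n p κ d e}
    (hm : m ∈ (shuffleMsgs pub c x₁ x₂ : List (Msg n p κ d e))) :
    m.src.isServer = true ∧ m.dst.isServer = true := by
  simp only [shuffleMsgs, List.mem_append] at hm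
  rcases hm with (((hm | hm) | hm) | hm) | hm
  · simp only [List.mem_cons, List.not_mem_nil, or_false] at hm
    rcases hm with rfl | rfl | rfl | rfl | rfl | rfl | rfl <;> exact ⟨rfl, rfl⟩
  · exact isServer_of_mem_macMsgs rfl rfl rfl hm
  · simp only [List.mem_cons, List.not_mem_nil, or_false] at hm
    rcases hm with rfl | rfl | rfl <;> exact ⟨rfl, rfl⟩
  · exact isServer_of_mem_macMsgs rfl rfl rfl hm
  · exact isServer_of_mem_macMsgs rfl rfl rfl hm

lemma clientServerBits_iterationMsgs_le {k s : ℕ} (hk : k ≤ n) (pub : Public p κ l (n * s))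
    (c : ProtocolCoins p l (n * s)) (x : Fin (n * s) → Compressed (ZMod p))
    (digest : Fin κ → Bool) (θ : Fin d → Fin e → Bool) :
    clientServerBits (iterationMsgs hk pub c x digest θ) ≤
      n * s * (2 * ((l + 2) * seedBits p)) := by
  simp only [iterationMsgs, clientServerBits_append]
  rw [clientServerBits_eq_zero (ms := shuffleMsgs _ _ _ _)
    fun m hm => Or.inl (isServer_of_mem_shuffleMsgs hm),
    clientServerBits_eq_zero (ms := reconstructMsgs _ _ _ _),
    clientServerBits_eq_zero (ms := modelMsgs _ _)]
  · exact (sum_filter_bits_le _ _).trans (totalBits_uploadMsgs _ _ _ _).le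
  · intro m hm
    simp only [modelMsgs, List.mem_append, List.mem_flatMap, List.mem_cons, List.not_mem_nil,
      or_false] at hm
    rcases hm with (rfl | rfl) | ⟨i, -, rfl | rfl⟩
    · exact Or.inl ⟨rfl, rfl⟩
    · exact Or.inl ⟨rfl, rfl⟩
    · exact Or.inr rfl
    · exact Or.inr rfl
  · intro m hm
    simp only [reconstructMsgs, List.mem_cons, List.not_mem_nil, or_false] at hm
    rcases hm with rfl | rfl | rfl | rfl <;> exact Or.inl ⟨rfl, rfl⟩

/-- The last `2 κ` bits are the digests of the new model; the broadcast itself goes to clients and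
does not count here. -/
lemma interServerBits_iterationMsgs_le {k s : ℕ} (hk : k ≤ n) (pub : Public p κ l (n * s))
    (c : ProtocolCoins p l (n * s)) (x : Fin (n * s) → Compressed (ZMod p))
    (digest : Fin κ → Bool) (θ : Fin d → Fin e → Bool) :
    interServerBits (iterationMsgs hk pub c x digest θ) ≤
      (7 * (n * s * (2 * l + 1) * seedBits p) + 30 * (n * s * l * seedBits p) + 39 * seedBits p +
        6 * κ) + (2 * (k * s * (2 * l + 1) * seedBits p) + 2 * κ) + 2 * κ := by
  simp only [iterationMsgs, interServerBits_append]
  rw [interServerBits_eq_zero (ms := uploadMsgs _ _ _ _), zero_add]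
  · refine Nat.add_le_add (Nat.add_le_add ((sum_filter_bits_le _ _).trans
      (totalBits_shuffleMsgs _ _ _ _).le) ((sum_filter_bits_le _ _).trans
      (totalBits_reconstructMsgs _ _ _ _).le)) ?_
    rw [modelMsgs, interServerBits_append, interServerBits_eq_zero (ms := List.flatMap _ _),
      add_zero]
    · refine (sum_filter_bits_le _ _).trans (le_of_eq ?_)
      simp [totalBits, Payload.bits]
      ring
    · intro m hm
      simp only [List.mem_flatMap, List.mem_cons, List.not_mem_nil, or_false] at hm
      obtain ⟨i, -, rfl | rfl⟩ := hm <;> exact Or.inr rfl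
  · intro m hm
    simp only [uploadMsgs, List.mem_flatMap, List.mem_cons, List.not_mem_nil, or_false] at hm
    obtain ⟨i, -, rfl | rfl⟩ := hm <;> exact Or.inl rfl

theorem communication_of_camel {k s : ℕ} (hk : k ≤ n) (h1k : 1 ≤ k) (h1s : 1 ≤ s) (hl : 2 ≤ l)
    (pub : Public p κ l (n * s)) (c : ProtocolCoins p l (n * s))
    (x : Fin (n * s) → Compressed (ZMod p)) (digest : Fin κ → Bool) (θ : Fin d → Fin e → Bool) :
    clientServerBits (iterationMsgs hk pub c x digest θ) ≤
      100 * (l * (seedBits p + 1)) * (n * s) ∧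
    interServerBits (iterationMsgs hk pub c x digest θ) ≤
      100 * (l * (seedBits p + 1) + κ) * (n * s) := by
  have hN : 1 ≤ n * s := Nat.mul_pos (h1k.trans hk) h1s
  have hB : k * s ≤ n * s := Nat.mul_le_mul_right s hk
  refine ⟨(clientServerBits_iterationMsgs_le hk pub c x digest θ).trans ?_,
    (interServerBits_iterationMsgs_le hk pub c x digest θ).trans ?_⟩
  · clear pub c x
    generalize n * s = N at *
    have h1 : (l + 2) * seedBits p ≤ 2 * l * (seedBits p + 1) := by nlinarith
    calc N * (2 * ((l + 2) * seedBits p)) ≤ N * (2 * (2 * l * (seedBits p + 1))) := by gcongr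
      _ = 4 * (l * (seedBits p + 1)) * N := by ring
      _ ≤ 100 * (l * (seedBits p + 1)) * N := by gcongr; norm_num
  · clear pub c x
    generalize n * s = N at *
    generalize k * s = B at *
    generalize seedBits p = b
    -- With `B ≤ N` and `2 l + 1 ≤ 3 l`, the coefficient of `N l b` adds up to `21 + 30 + 39 + 6 =
    -- 96`, and that of `κ N` to `10`; the constant `100` covers both.
    have h1 : (2 * l + 1) * b ≤ 3 * (l * b) := by nlinarith
    have h2 : N * (2 * l + 1) * b ≤ 3 * (N * l * b) := by nlinarith
    have h3 : B * (2 * l + 1) * b ≤ 3 * (N * l * b) := by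
      calc B * (2 * l + 1) * b ≤ N * (2 * l + 1) * b := by gcongr
        _ ≤ _ := h2
    have h4 : b ≤ N * l * b := Nat.le_mul_of_pos_left b (Nat.mul_pos hN (by omega))
    have h5 : κ ≤ κ * N := Nat.le_mul_of_pos_right κ hN
    have h6 : 100 * (l * (b + 1) + κ) * N = 100 * (N * l * b) + 100 * (l * N) + 100 * (κ * N) := by
      ring
    rw [h6]
    omega

end

/-! ### The uniform distribution on the sphere -/

section Sphere

variable {d : ℕ}

/-- Integration in polar coordinates of a homogeneous function against a Gaussian weight. -/
lemma integral_homogeneous_mul_exp (hd : 1 ≤ d) (j : ℕ) {h : Vec d → ℝ}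
    (hh : ∀ (r : ℝ) (v : Vec d), 0 < r → h (r • v) = r ^ j * h v) :
    ∫ x : Vec d, h x * Real.exp (-‖x‖ ^ 2) =
      (∫ v, h v.1 ∂(volume : Measure (Vec d)).toSphere) *
        (1 / 2 * Real.Gamma ((d + j) / 2)) := by
  -- The radial factor: the Jacobian gives `r^(d - 1)`, homogeneity another `r^j`, and the Gaussian
  -- weight turns this into a Gamma value.
  have hrad : ∫ x : Set.Ioi (0 : ℝ), x.1 ^ j * Real.exp (-x.1 ^ 2)
      ∂Measure.volumeIoiPow (d - 1) = 1 / 2 * Real.Gamma ((d + j) / 2) := by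
    simp only [Measure.volumeIoiPow, ENNReal.ofReal]
    rw [integral_withDensity_eq_integral_smul
      ((measurable_subtype_coe.pow_const _).real_toNNReal),
      integral_subtype_comap measurableSet_Ioi fun a : ℝ =>
        Real.toNNReal (a ^ (d - 1)) • (a ^ j * Real.exp (-a ^ 2))]
    have h1 := integral_rpow_mul_exp_neg_rpow (p := 2) (q := ((d - 1 + j : ℕ) : ℝ)) two_pos
      (by linarith [Nat.cast_nonneg (α := ℝ) (d - 1 + j)])
    have h2 : (((d - 1 + j : ℕ) : ℝ) + 1) / 2 = (d + j) / 2 := by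
      rw [Nat.cast_add, Nat.cast_sub hd]; push_cast; ring
    rw [h2] at h1
    rw [← h1]
    refine setIntegral_congr_fun measurableSet_Ioi fun x hx => ?_
    have hx : 0 < x := hx
    rw [NNReal.smul_def, Real.coe_toNNReal _ (pow_nonneg hx.le _), smul_eq_mul, ← mul_assoc,
      ← pow_add, Real.rpow_natCast, Real.rpow_two]
  have hfin : Module.finrank ℝ (Vec d) = d := by simp
  have hmp := (volume : Measure (Vec d)).measurePreserving_homeomorphUnitSphereProd
  rw [hfin] at hmp
  have hne : Nonempty (Fin d) := ⟨⟨0, hd⟩⟩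
  calc ∫ x : Vec d, h x * Real.exp (-‖x‖ ^ 2)
      = ∫ x : ({(0 : Vec d)}ᶜ : Set (Vec d)), h x.1 * Real.exp (-‖x.1‖ ^ 2)
          ∂((volume : Measure (Vec d)).comap (↑)) := by
        rw [integral_subtype_comap (measurableSet_singleton _).compl
          fun x => h x * Real.exp (-‖x‖ ^ 2), restrict_compl_singleton]
    _ = ∫ z : Metric.sphere (0 : Vec d) 1 × Set.Ioi (0 : ℝ),
          h z.1.1 * (z.2.1 ^ j * Real.exp (-z.2.1 ^ 2))
          ∂((volume : Measure (Vec d)).toSphere.prod (Measure.volumeIoiPow (d - 1))) := by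
        rw [← hmp.integral_comp (Homeomorph.measurableEmbedding _)]
        refine integral_congr_ae (Filter.Eventually.of_forall fun x => ?_)
        have hx : 0 < ‖x.1‖ := norm_pos_iff.2 x.2
        simp only [homeomorphUnitSphereProd_apply_fst_coe, homeomorphUnitSphereProd_apply_snd_coe]
        have := hh ‖x.1‖ (‖x.1‖⁻¹ • x.1) hx
        rw [smul_smul, mul_inv_cancel₀ hx.ne', one_smul] at this
        rw [this]
        ring
    _ = _ := by
        rw [← hrad]
        exact integral_prod_mul (fun v : Metric.sphere (0 : Vec d) 1 => h v.1)
          (fun x : Set.Ioi (0 : ℝ) => x.1 ^ j * Real.exp (-x.1 ^ 2))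

lemma integral_abs_mul_exp_neg_sq : ∫ x : ℝ, |x| * Real.exp (-x ^ 2) = 1 := by
  have h := integral_comp_abs (f := fun x : ℝ => x * Real.exp (-x ^ 2))
  simp only [sq_abs] at h
  rw [h]
  have h1 := integral_rpow_mul_exp_neg_rpow (p := 2) (q := 1) two_pos (by norm_num)
  simp only [Real.rpow_one, Real.rpow_two] at h1
  rw [h1]
  norm_num

lemma integral_exp_neg_sq : ∫ x : ℝ, Real.exp (-x ^ 2) = √Real.pi := by
  have h := integral_gaussian 1
  simpa using h

lemma integral_prod_coord_euclidean (f : Fin d → ℝ → ℝ) :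
    ∫ x : Vec d, ∏ i, f i (x i) = ∏ i, ∫ t, f i t := by
  have h := (PiLp.volume_preserving_ofLp (Fin d)).integral_comp
    (MeasurableEquiv.toLp 2 (Fin d → ℝ)).symm.measurableEmbedding (fun x => ∏ i, f i (x i))
  rw [← integral_fintype_prod_volume_eq_prod, ← h]

lemma exp_neg_norm_sq_eq_prod (x : Vec d) : Real.exp (-‖x‖ ^ 2) = ∏ i, Real.exp (-(x i) ^ 2) := by
  rw [EuclideanSpace.real_norm_sq_eq, ← Real.exp_sum, Finset.sum_neg_distrib]

lemma integral_exp_neg_norm_sq : ∫ x : Vec d, Real.exp (-‖x‖ ^ 2) = √Real.pi ^ d := by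
  simp_rw [exp_neg_norm_sq_eq_prod]
  rw [integral_prod_coord_euclidean fun _ t => Real.exp (-t ^ 2)]
  simp [integral_exp_neg_sq]

/-- Extending `u` to an orthonormal basis turns `⟨x, u⟩` into a coordinate; the Gaussian weight then
factorizes. -/
lemma integral_abs_inner_mul_exp {u : Vec d} (hu : ‖u‖ = 1) (hd : 1 ≤ d) :
    ∫ x : Vec d, |inner ℝ x u| * Real.exp (-‖x‖ ^ 2) = √Real.pi ^ (d - 1) := by
  set i₀ : Fin d := ⟨0, hd⟩
  have hortho : Orthonormal ℝ (({i₀} : Set (Fin d)).domRestrict fun _ => u) := by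
    rw [orthonormal_iff_ite]
    rintro ⟨i, rfl⟩ ⟨j, rfl⟩
    simp [hu]
  obtain ⟨b, hb⟩ := hortho.exists_orthonormalBasis_extension_of_card_eq (by simp)
  have hb0 : b i₀ = u := hb i₀ rfl
  have hmp := b.repr.measurePreserving
  have e : ∀ x : Vec d, |inner ℝ x u| * Real.exp (-‖x‖ ^ 2) =
      (fun y : Vec d => ∏ i, (if i = i₀ then |y i| else 1) * Real.exp (-(y i) ^ 2)) (b.repr x) := by
    intro x
    simp only
    rw [Finset.prod_mul_distrib, ← exp_neg_norm_sq_eq_prod, b.repr.norm_map,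
      Finset.prod_ite_eq' Finset.univ i₀, if_pos (Finset.mem_univ _), b.repr_apply_apply, hb0,
      real_inner_comm]
  refine (integral_congr_ae (Filter.Eventually.of_forall e)).trans
    ((hmp.integral_comp b.repr.toHomeomorph.measurableEmbedding
      (fun y : Vec d => ∏ i, (if i = i₀ then |y i| else 1) * Real.exp (-(y i) ^ 2))).trans ?_)
  rw [integral_prod_coord_euclidean fun i t => (if i = i₀ then |t| else 1) * Real.exp (-t ^ 2),
    ← Finset.mul_prod_erase Finset.univ _ (Finset.mem_univ i₀)]
  simp only [if_true]
  rw [integral_abs_mul_exp_neg_sq, one_mul, Finset.prod_congr rfl (g := fun _ => √Real.pi)]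
  · simp
  · intro i hi
    simp [Finset.ne_of_mem_erase hi, integral_exp_neg_sq]

/-- The mean of `|⟨v, u⟩|` over the unit sphere, for a unit vector `u`. -/
noncomputable def sphereConst (d : ℕ) : ℝ :=
  Real.Gamma (d / 2) / (√Real.pi * Real.Gamma ((d + 1) / 2))

/-- The sign of `⟨x, y⟩`, where the sign of `0` is `1`. -/
noncomputable def innerSign (x y : Vec d) : ℝ := if inner ℝ x y < 0 then -1 else 1

lemma abs_innerSign (x y : Vec d) : |innerSign x y| = 1 := by
  unfold innerSign
  split_ifs <;> simp

lemma innerSign_mul_self (x y : Vec d) : innerSign x y * inner ℝ x y = |inner ℝ x y| := by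
  unfold innerSign
  split_ifs with h
  · rw [abs_of_neg h]; ring
  · rw [abs_of_nonneg (not_lt.1 h), one_mul]

lemma innerSign_smul_left {r : ℝ} (hr : 0 < r) (x y : Vec d) :
    innerSign (r • x) y = innerSign x y := by
  unfold innerSign
  rw [real_inner_smul_left]
  simp only [mul_neg_iff, hr, hr.not_gt, true_and, false_and, or_false]

lemma innerSign_smul_right {r : ℝ} (hr : 0 < r) (x y : Vec d) :
    innerSign x (r • y) = innerSign x y := by
  unfold innerSign
  rw [real_inner_smul_right]
  simp only [mul_neg_iff, hr, hr.not_gt, true_and, false_and, or_false]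

lemma measurable_innerSign (y : Vec d) : Measurable fun x : Vec d => innerSign x y := by
  unfold innerSign
  refine Measurable.ite (measurableSet_lt ?_ measurable_const) measurable_const measurable_const
  fun_prop

lemma integral_sphere_innerSign_orthogonal (hd : 1 ≤ d) {u w : Vec d} (h : inner ℝ u w = 0) :
    ∫ v, innerSign v.1 u * inner ℝ v.1 w ∂(volume : Measure (Vec d)).toSphere = 0 := by
  have h1 := integral_homogeneous_mul_exp hd 1
    (h := fun x => innerSign x u * inner ℝ x w) fun r v hr => by
      rw [innerSign_smul_left hr, real_inner_smul_left]; ring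
  -- The reflection in the line of `u` keeps the sign of `⟨x, u⟩` and reverses `⟨x, w⟩`, so the
  -- Gaussian integral equals its own negative; polar coordinates carry this back to the sphere.
  set R := (Submodule.span ℝ {u}).reflection with hR
  have hRu : R u = u := Submodule.reflection_mem_subspace_eq_self (Submodule.mem_span_singleton_self u)
  have hRw : R w = -w := by
    refine Submodule.reflection_mem_subspace_orthogonalComplement_eq_neg ?_
    rw [Submodule.mem_orthogonal_singleton_iff_inner_right]
    exact h
  have hRR : ∀ x, R (R x) = x := Submodule.reflection_reflection _
  have hin : ∀ x z, inner ℝ (R x) z = inner ℝ x (R z) := fun x z => by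
    rw [← R.inner_map_map x (R z), hRR]
  have h2 := R.measurePreserving.integral_comp R.toHomeomorph.measurableEmbedding
    (fun x => innerSign x u * inner ℝ x w * Real.exp (-‖x‖ ^ 2))
  have e : ∀ x, innerSign (R x) u * inner ℝ (R x) w * Real.exp (-‖R x‖ ^ 2) =
      -(innerSign x u * inner ℝ x w * Real.exp (-‖x‖ ^ 2)) := by
    intro x
    rw [innerSign, hin, hin, hRu, hRw, R.norm_map, inner_neg_right, innerSign]
    ring
  simp_rw [e] at h2
  rw [integral_neg] at h2
  have h3 : ∫ x : Vec d, innerSign x u * inner ℝ x w * Real.exp (-‖x‖ ^ 2) = 0 := by linarith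
  rw [h3] at h1
  have hd0 : (0 : ℝ) < d := by exact_mod_cast hd
  have hG : 0 < 1 / 2 * Real.Gamma (((d : ℝ) + (1 : ℕ)) / 2) :=
    mul_pos (by norm_num) (Real.Gamma_pos_of_pos (by positivity))
  exact (mul_eq_zero.1 h1.symm).resolve_right hG.ne'

/-- Quotient of the polar formulas of degree one, for `|⟨x, u⟩|`, and of degree zero, for the
constant `1`. -/
lemma integral_sphere_abs_inner (hd : 1 ≤ d) {u : Vec d} (hu : ‖u‖ = 1) :
    ∫ v, |inner ℝ v.1 u| ∂(volume : Measure (Vec d)).toSphere =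
      (volume : Measure (Vec d)).toSphere.real Set.univ * sphereConst d := by
  have h1 := integral_homogeneous_mul_exp hd 1
    (h := fun x => |inner ℝ x u|) fun r v hr => by
      rw [real_inner_smul_left, abs_mul, abs_of_pos hr, pow_one]
  have h2 := integral_homogeneous_mul_exp hd 0 (h := fun _ => 1) fun r v hr => by simp
  simp only [one_mul] at h2
  rw [integral_abs_inner_mul_exp hu hd] at h1
  rw [integral_exp_neg_norm_sq, integral_const, smul_eq_mul, mul_one] at h2
  have hd0 : (0 : ℝ) < d := by exact_mod_cast hd
  have hG1 : 0 < Real.Gamma (((d : ℝ) + 1) / 2) := Real.Gamma_pos_of_pos (by positivity)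
  have hG0 : 0 < Real.Gamma ((d : ℝ) / 2) := Real.Gamma_pos_of_pos (by positivity)
  have hpi : 0 < √Real.pi := Real.sqrt_pos.2 Real.pi_pos
  simp only [Nat.cast_one, Nat.cast_zero, add_zero] at h1 h2
  obtain ⟨d', rfl⟩ : ∃ d', d = d' + 1 := ⟨d - 1, by omega⟩
  rw [Nat.add_sub_cancel] at h1
  rw [pow_succ, h1] at h2
  unfold sphereConst
  field_simp
  field_simp at h2
  linarith

lemma integral_uniformSphere {f : Vec d → ℝ} (hf : Measurable f) :
    ∫ v, f v ∂(uniformSphere d) = ((volume : Measure (Vec d)).toSphere.real Set.univ)⁻¹ *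
      ∫ v, f v.1 ∂(volume : Measure (Vec d)).toSphere := by
  rw [uniformSphere, integral_smul_measure, integral_map measurable_subtype_coe.aemeasurable
    hf.aestronglyMeasurable, ENNReal.toReal_inv, smul_eq_mul]
  rfl

lemma integral_uniformSphere_innerSign (hd : 1 ≤ d) (y w : Vec d) :
    ∫ v, innerSign v y * inner ℝ v w ∂(uniformSphere d) =
      sphereConst d * inner ℝ (‖y‖⁻¹ • y) w := by
  have hne : Nonempty (Fin d) := ⟨⟨0, hd⟩⟩
  have hmeas : ∀ y w : Vec d, Measurable fun v : Vec d => innerSign v y * inner ℝ v w := fun y w =>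
    (measurable_innerSign y).mul (by fun_prop)
  rw [integral_uniformSphere (hmeas y w)]
  -- For `y = 0` the sign is constantly `1` and normalization returns `0`, so the orthogonal case
  -- applies.
  by_cases hy : y = 0
  · have h0 : inner ℝ y w = 0 := by rw [hy, inner_zero_left]
    rw [integral_sphere_innerSign_orthogonal hd h0, hy]
    simp
  · have hy0 : 0 < ‖y‖ := norm_pos_iff.2 hy
    set u := ‖y‖⁻¹ • y with hu
    have hu1 : ‖u‖ = 1 := by rw [hu, norm_smul, norm_inv, norm_norm, inv_mul_cancel₀ hy0.ne']
    have hsgn : ∀ v, innerSign v y = innerSign v u := fun v =>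
      (innerSign_smul_right (inv_pos.2 hy0) v y).symm
    -- Only the component of `w` along `u` survives the integration.
    set w' := w - inner ℝ u w • u with hw'
    have hort : inner ℝ u w' = 0 := by
      rw [hw', inner_sub_right, real_inner_smul_right, real_inner_self_eq_norm_sq, hu1]; ring
    have e : ∀ v : Metric.sphere (0 : Vec d) 1, innerSign v.1 y * inner ℝ v.1 w =
        inner ℝ u w * |inner ℝ v.1 u| + innerSign v.1 u * inner ℝ v.1 w' := by
      intro v
      rw [hsgn, ← innerSign_mul_self, hw', inner_sub_right,
        real_inner_smul_right v.1 u (inner ℝ u w)]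
      ring
    have hbound : ∀ z : Vec d, Integrable (fun v : Metric.sphere (0 : Vec d) 1 =>
        innerSign v.1 u * inner ℝ v.1 z) (volume : Measure (Vec d)).toSphere := by
      intro z
      refine Integrable.of_bound ((hmeas u z).comp measurable_subtype_coe).aestronglyMeasurable ‖z‖
        (Filter.Eventually.of_forall fun v => ?_)
      rw [norm_mul, Real.norm_eq_abs, abs_innerSign, one_mul]
      refine (norm_inner_le_norm _ _).trans ?_
      rw [mem_sphere_zero_iff_norm.1 v.2, one_mul]
    have hb1 : Integrable (fun v : Metric.sphere (0 : Vec d) 1 =>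
        inner ℝ u w * |inner ℝ v.1 u|) (volume : Measure (Vec d)).toSphere := by
      refine Integrable.const_mul ?_ _
      simpa only [innerSign_mul_self] using hbound u
    simp_rw [e]
    rw [integral_add hb1 (hbound w'), integral_sphere_innerSign_orthogonal hd hort,
      integral_const_mul, integral_sphere_abs_inner hd hu1]
    have hpos : (volume : Measure (Vec d)).toSphere.real Set.univ ≠ 0 := by
      rw [measureReal_def, ENNReal.toReal_ne_zero]
      refine ⟨?_, measure_ne_top _ _⟩
      rw [Ne, Measure.measure_univ_eq_zero]
      exact Measure.toSphere_ne_zero _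
    field_simp
    ring

end Sphere

/-! ### Decompression is unbiased -/

section

variable {d : ℕ} {S : Type v}

lemma integral_threshold_sign {κ : ℝ} (h0 : 0 ≤ κ) (h1 : κ ≤ 1) :
    ∫ b : I, (if (b : ℝ) ≤ κ then (1 : ℝ) else -1) = 2 * κ - 1 := by
  have hm : MeasurableSet {b : I | (b : ℝ) ≤ κ} :=
    measurableSet_le (by fun_prop) (by fun_prop)
  have e : ∀ b : I, (if (b : ℝ) ≤ κ then (1 : ℝ) else -1) =
      {b : I | (b : ℝ) ≤ κ}.indicator (fun _ => (2 : ℝ)) b - 1 := by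
    intro b
    by_cases hb : (b : ℝ) ≤ κ
    · rw [if_pos hb, Set.indicator_of_mem (by exact hb)]; norm_num
    · rw [if_neg hb, Set.indicator_of_notMem (by exact hb)]; norm_num
  simp_rw [e]
  rw [integral_sub ((integrable_const _).indicator hm) (integrable_const _),
    integral_indicator_const _ hm, measureReal_def, volume_Iic_keep κ h0 h1,
    ENNReal.toReal_ofReal h0]
  simp [mul_comm]

lemma radius_nonneg {ε₀ L : ℝ} (hε : 0 < ε₀) (hL : 0 ≤ L) : 0 ≤ radius d ε₀ L := by
  have h1 := Real.one_lt_exp_iff.2 hε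
  have h2 : 0 ≤ (Real.exp ε₀ + 1) / (Real.exp ε₀ - 1) :=
    div_nonneg (by linarith) (by linarith)
  have h3 : 0 ≤ Real.Gamma ((d : ℝ) / 2 + 1) := (Real.Gamma_pos_of_pos (by positivity)).le
  have h4 : 0 ≤ Real.Gamma (((d : ℝ) - 1) / 2 + 1) := by
    refine (Real.Gamma_pos_of_pos ?_).le
    have : (0 : ℝ) ≤ d := Nat.cast_nonneg d
    linarith
  unfold radius
  positivity

/-- The reason for the formula of `R`: one compression shrinks the mean by `E|⟨v, u⟩|` and by the
bias `2 p - 1` of the randomized sign, and `R` brings it back to length `L`. -/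
lemma radius_mul_sphereConst (hd : 1 ≤ d) {ε₀ L : ℝ} (hε : 0 < ε₀) :
    radius d ε₀ L * sphereConst d * (2 * (Real.exp ε₀ / (Real.exp ε₀ + 1)) - 1) = L := by
  have h1 := Real.one_lt_exp_iff.2 hε
  have hd0 : (0 : ℝ) < d := by exact_mod_cast hd
  have h2 : Real.Gamma ((d : ℝ) / 2 + 1) = d / 2 * Real.Gamma (d / 2) :=
    Real.Gamma_add_one (by positivity)
  have h3 : ((d : ℝ) - 1) / 2 + 1 = (d + 1) / 2 := by ring
  have hG1 : 0 < Real.Gamma (((d : ℝ) + 1) / 2) := Real.Gamma_pos_of_pos (by positivity)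
  have hG0 : 0 < Real.Gamma ((d : ℝ) / 2) := Real.Gamma_pos_of_pos (by positivity)
  have hpi : 0 < √Real.pi := Real.sqrt_pos.2 Real.pi_pos
  have h4 : Real.exp ε₀ - 1 ≠ 0 := by linarith
  unfold radius sphereConst
  rw [h2, h3]
  field_simp
  ring

/-- Log-convexity of Gamma at the midpoint of `d / 2` and `d / 2 + 1` gives `Γ((d + 1) / 2)² ≤ (d /
2) Γ(d / 2)²`. This yields `2 d` and, with `π / 4 ≤ 1`, more than the stated `14 d`. -/
lemma radius_sq_le (hd : 1 ≤ d) {ε₀ L : ℝ} :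
    radius d ε₀ L ^ 2 ≤ L ^ 2 * (14 * d) * ldpFactor ε₀ ^ 2 := by
  have hd0 : (0 : ℝ) < d := by exact_mod_cast hd
  have h2 : Real.Gamma ((d : ℝ) / 2 + 1) = d / 2 * Real.Gamma (d / 2) :=
    Real.Gamma_add_one (by positivity)
  have h3 : ((d : ℝ) - 1) / 2 + 1 = (d + 1) / 2 := by ring
  have hG1 : 0 < Real.Gamma (((d : ℝ) + 1) / 2) := Real.Gamma_pos_of_pos (by positivity)
  have hG0 : 0 < Real.Gamma ((d : ℝ) / 2) := Real.Gamma_pos_of_pos (by positivity)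
  have hconv := Real.Gamma_mul_add_mul_le_rpow_Gamma_mul_rpow_Gamma (s := (d : ℝ) / 2)
    (t := (d : ℝ) / 2 + 1) (a := 1 / 2) (b := 1 / 2) (by positivity) (by positivity)
    (by norm_num) (by norm_num) (by norm_num)
  rw [show 1 / 2 * ((d : ℝ) / 2) + 1 / 2 * ((d : ℝ) / 2 + 1) = (d + 1) / 2 by ring, h2,
    ← Real.sqrt_eq_rpow, ← Real.sqrt_eq_rpow] at hconv
  have hsq : Real.Gamma (((d : ℝ) + 1) / 2) ^ 2 ≤ d / 2 * Real.Gamma (d / 2) ^ 2 := by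
    refine (pow_le_pow_left₀ hG1.le hconv 2).trans (le_of_eq ?_)
    rw [mul_pow, Real.sq_sqrt hG0.le, Real.sq_sqrt (by positivity)]
    ring
  have hratio : ((d : ℝ) * Real.Gamma ((d + 1) / 2) / (d / 2 * Real.Gamma (d / 2))) ^ 2 ≤ 2 * d := by
    rw [div_pow, div_le_iff₀ (by positivity)]
    calc ((d : ℝ) * Real.Gamma ((d + 1) / 2)) ^ 2 = d ^ 2 * Real.Gamma ((d + 1) / 2) ^ 2 := by ring
      _ ≤ d ^ 2 * (d / 2 * Real.Gamma (d / 2) ^ 2) := by gcongr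
      _ = _ := by ring
  have hpi : (√Real.pi / 2) ^ 2 ≤ 1 := by
    rw [div_pow, Real.sq_sqrt Real.pi_pos.le]
    linarith [Real.pi_le_four]
  unfold radius ldpFactor
  rw [h2, h3, mul_pow, mul_pow, mul_pow]
  calc L ^ 2 * (√Real.pi / 2) ^ 2 *
        ((d : ℝ) * Real.Gamma ((d + 1) / 2) / (d / 2 * Real.Gamma (d / 2))) ^ 2 *
        ((Real.exp ε₀ + 1) / (Real.exp ε₀ - 1)) ^ 2
      ≤ L ^ 2 * 1 * (2 * d) * ((Real.exp ε₀ + 1) / (Real.exp ε₀ - 1)) ^ 2 := by gcongr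
    _ ≤ _ := by
        rw [mul_one]
        gcongr
        norm_num

lemma norm_noisyGradDcmp_le {expand : S → Vec d} {ε₀ L : ℝ} (hε : 0 < ε₀) (hL : 0 ≤ L)
    (m : Compressed S) : ‖noisyGradDcmp expand ε₀ L m‖ ≤ radius d ε₀ L := by
  have hR := radius_nonneg (d := d) hε hL
  have h1 : ‖(if m.1 then (1 : ℝ) else -1)‖ = 1 := by split_ifs <;> simp
  have h2 : ‖‖expand m.2‖⁻¹ • expand m.2‖ ≤ 1 := by
    rw [norm_smul, norm_inv, norm_norm]
    exact inv_mul_le_one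
  rw [noisyGradDcmp, norm_smul, norm_smul, h1, one_mul, Real.norm_eq_abs, abs_of_nonneg hR]
  exact mul_le_of_le_one_right hR h2

lemma innerSign_normalize (x y : Vec d) : innerSign (‖x‖⁻¹ • x) y = innerSign x y := by
  by_cases hx : x = 0
  · simp [hx]
  · exact innerSign_smul_left (inv_pos.2 (norm_pos_iff.2 hx)) x y

/-- Exhibits the message as a product in which the coin `U` is separated from the direction. The
direction enters only through its normalization, whose law is known. -/
lemma noisyGradDcmp_noisyGradCmpr (expand : S → Vec d) (ε₀ L : ℝ) (c : LocalCoins S) (x : Vec d) :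
    noisyGradDcmp expand ε₀ L (noisyGradCmpr expand ε₀ L c x) =
      (if (c.2.1 : ℝ) ≤ Real.exp ε₀ / (Real.exp ε₀ + 1) then (1 : ℝ) else -1) •
        radius d ε₀ L • innerSign (‖expand c.2.2‖⁻¹ • expand c.2.2) (roundToSphere L c.1 x) •
          (‖expand c.2.2‖⁻¹ • expand c.2.2) := by
  rw [innerSign_normalize, innerSign, noisyGradDcmp, noisyGradCmpr, keepSign]
  by_cases h1 : inner ℝ (expand c.2.2) (roundToSphere L c.1 x) < 0 <;>
    by_cases h2 : (c.2.1 : ℝ) ≤ Real.exp ε₀ / (Real.exp ε₀ + 1) <;> simp [h1, h2]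

lemma normalize_roundToSphere {L : ℝ} (hL : 0 < L) (a : I) (x : Vec d) :
    ‖roundToSphere L a x‖⁻¹ • roundToSphere L a x =
      (if (a : ℝ) ≤ 1 / 2 + ‖x‖ / (2 * L) then (1 : ℝ) else -1) • (‖x‖⁻¹ • x) := by
  by_cases hx : x = 0
  · simp [hx, roundToSphere]
  · have hx0 : 0 < ‖x‖ := norm_pos_iff.2 hx
    have hn : ‖(L / ‖x‖) • x‖ = L := by
      rw [norm_smul, norm_div, norm_norm, Real.norm_eq_abs, abs_of_pos hL,
        div_mul_cancel₀ _ hx0.ne']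
    have hs : L⁻¹ • (L / ‖x‖) • x = ‖x‖⁻¹ • x := by
      rw [smul_smul]; congr 1; field_simp
    unfold roundToSphere
    split_ifs
    · rw [hn, hs, one_smul]
    · rw [norm_neg, hn, smul_neg, hs, neg_one_smul]

/-- The average of the decompressed messages. -/
noncomputable def averagedGradient {m : ℕ} (expand : S → Vec d) (ε₀ L : ℝ)
    (x : Fin m → Compressed S) : Vec d :=
  (m : ℝ)⁻¹ • ∑ b, noisyGradDcmp expand ε₀ L (x b)

lemma norm_averagedGradient_le {m : ℕ} (hm : 1 ≤ m) {expand : S → Vec d} {ε₀ L : ℝ} (hε : 0 < ε₀)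
    (hL : 0 ≤ L) (x : Fin m → Compressed S) :
    ‖averagedGradient expand ε₀ L x‖ ≤ radius d ε₀ L := by
  have hm0 : (0 : ℝ) < m := by exact_mod_cast hm
  rw [averagedGradient, norm_smul, norm_inv, Real.norm_natCast, inv_mul_le_iff₀ hm0]
  refine (norm_sum_le _ _).trans ((Finset.sum_le_sum fun b _ =>
    norm_noisyGradDcmp_le hε hL (x b)).trans (le_of_eq ?_))
  simp

variable [MeasurableSpace S]

/-- The three sources of randomness are integrated in turn: the seed gives `sphereConst` times the
rounded direction, the coin gives `2 p - 1`, and the rounding gives `‖x‖ / L`. The radius cancels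
all of these except `x`. -/
lemma integral_inner_noisyGradDcmp (hd : 1 ≤ d) {expand : S → Vec d} (he : Measurable expand)
    {ν : Measure S} [IsProbabilityMeasure ν] (hideal : IsIdealPRG ν expand) {ε₀ L : ℝ}
    (hε : 0 < ε₀) (hL : 0 < L) {x : Vec d} (hx : ‖x‖ ≤ L) (w : Vec d) :
    ∫ m, inner ℝ (noisyGradDcmp expand ε₀ L m) w ∂(msgLaw expand ε₀ L ν x) = inner ℝ x w := by
  have hdm := measurable_noisyGradDcmp he ε₀ L
  have hin : Measurable fun m : Compressed S => inner ℝ (noisyGradDcmp expand ε₀ L m) w := by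
    fun_prop
  have hcm := measurable_noisyGradCmpr_left he ε₀ L x
  have hcomp := hin.comp hcm
  rw [Function.comp_def] at hcomp
  rw [msgLaw, integral_map hcm.aemeasurable hin.aestronglyMeasurable]
  have hint : Integrable (fun c : LocalCoins S =>
      inner ℝ (noisyGradDcmp expand ε₀ L (noisyGradCmpr expand ε₀ L c x)) w)
      ((volume : Measure I).prod ((volume : Measure I).prod ν)) := by
    refine Integrable.of_bound hcomp.aestronglyMeasurable (radius d ε₀ L * ‖w‖)
      (Filter.Eventually.of_forall fun c => (norm_inner_le_norm _ _).trans ?_)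
    gcongr
    exact norm_noisyGradDcmp_le hε hL.le _
  rw [integral_prod _ hint]
  have hnm : Measurable fun seed => ‖expand seed‖⁻¹ • expand seed := he.norm.inv.smul he
  have hseed : ∀ y : Vec d, ∫ seed, innerSign (‖expand seed‖⁻¹ • expand seed) y *
      inner ℝ (‖expand seed‖⁻¹ • expand seed) w ∂ν =
        sphereConst d * inner ℝ (‖y‖⁻¹ • y) w := by
    intro y
    have hm : Measurable fun v : Vec d => innerSign v y * inner ℝ v w :=
      (measurable_innerSign y).mul (by fun_prop)
    have h := integral_map (μ := ν) hnm.aemeasurable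
      (f := fun v : Vec d => innerSign v y * inner ℝ v w) hm.aestronglyMeasurable
    rw [← h, hideal, integral_uniformSphere_innerSign hd]
  have hinner : ∀ a : I, ∫ bs : I × S, inner ℝ (noisyGradDcmp expand ε₀ L
      (noisyGradCmpr expand ε₀ L (a, bs) x)) w ∂((volume : Measure I).prod ν) =
      (if (a : ℝ) ≤ 1 / 2 + ‖x‖ / (2 * L) then (1 : ℝ) else -1) *
        ((2 * (Real.exp ε₀ / (Real.exp ε₀ + 1)) - 1) * (radius d ε₀ L * (sphereConst d *
          inner ℝ (‖x‖⁻¹ • x) w))) := by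
    intro a
    have e : ∀ bs : I × S, inner ℝ (noisyGradDcmp expand ε₀ L
        (noisyGradCmpr expand ε₀ L (a, bs) x)) w =
        (if (bs.1 : ℝ) ≤ Real.exp ε₀ / (Real.exp ε₀ + 1) then (1 : ℝ) else -1) *
          (radius d ε₀ L * (innerSign (‖expand bs.2‖⁻¹ • expand bs.2) (roundToSphere L a x) *
            inner ℝ (‖expand bs.2‖⁻¹ • expand bs.2) w)) := by
      intro bs
      rw [noisyGradDcmp_noisyGradCmpr, real_inner_smul_left, real_inner_smul_left,
        real_inner_smul_left]
    rw [integral_congr_ae (Filter.Eventually.of_forall e),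
      integral_prod_mul (fun b : I =>
        (if (b : ℝ) ≤ Real.exp ε₀ / (Real.exp ε₀ + 1) then (1 : ℝ) else -1))
        (fun seed => radius d ε₀ L * (innerSign (‖expand seed‖⁻¹ • expand seed)
          (roundToSphere L a x) * inner ℝ (‖expand seed‖⁻¹ • expand seed) w)),
      integral_threshold_sign (keep_prob_mem ε₀).1 (keep_prob_mem ε₀).2, integral_const_mul, hseed,
      normalize_roundToSphere hL, real_inner_smul_left]
    ring
  rw [integral_congr_ae (Filter.Eventually.of_forall hinner), integral_mul_const,
    integral_threshold_sign (by positivity) ?_]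
  · have h1 := radius_mul_sphereConst (L := L) hd hε
    calc _ = (radius d ε₀ L * sphereConst d * (2 * (Real.exp ε₀ / (Real.exp ε₀ + 1)) - 1)) *
          (‖x‖ / L * inner ℝ (‖x‖⁻¹ • x) w) := by ring
      _ = ‖x‖ * inner ℝ (‖x‖⁻¹ • x) w := by rw [h1]; field_simp
      _ = inner ℝ x w := by
        rw [real_inner_smul_left]
        by_cases hx0 : x = 0
        · simp [hx0]
        · have : ‖x‖ ≠ 0 := norm_ne_zero_iff.2 hx0
          field_simp
  · have : ‖x‖ / (2 * L) ≤ 1 / 2 := by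
      rw [div_le_iff₀ (by positivity)]; linarith
    linarith

lemma measurable_averagedGradient {m : ℕ} {expand : S → Vec d} (he : Measurable expand)
    (ε₀ L : ℝ) : Measurable (averagedGradient (m := m) expand ε₀ L) := by
  have h : Measurable fun x : Fin m → Compressed S => ∑ b, noisyGradDcmp expand ε₀ L (x b) :=
    Finset.measurable_sum _ fun b _ =>
      (measurable_noisyGradDcmp he _ _).comp (measurable_pi_apply b)
  exact h.const_smul (m : ℝ)⁻¹

lemma integral_inner_averagedGradient {m : ℕ} {expand : S → Vec d} (he : Measurable expand)
    {ε₀ L : ℝ} (hε : 0 < ε₀) (hL : 0 < L) (μ : Fin m → Measure (Compressed S))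
    [∀ b, IsProbabilityMeasure (μ b)] (g : Fin m → Vec d)
    (hg : ∀ b w, ∫ y, inner ℝ (noisyGradDcmp expand ε₀ L y) w ∂(μ b) = inner ℝ (g b) w)
    (w : Vec d) :
    ∫ x, inner ℝ (averagedGradient expand ε₀ L x) w ∂(Measure.pi μ) =
      (m : ℝ)⁻¹ * ∑ b, inner ℝ (g b) w := by
  have hdm := measurable_noisyGradDcmp he ε₀ L
  have hin : Measurable fun y : Compressed S => inner ℝ (noisyGradDcmp expand ε₀ L y) w := by
    fun_prop
  simp_rw [averagedGradient, real_inner_smul_left, sum_inner]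
  rw [integral_const_mul, integral_finsetSum]
  · congr 1
    refine Finset.sum_congr rfl fun b _ => ?_
    rw [← hg b w]
    exact integral_comp_eval (μ := μ) (i := b) hin.aestronglyMeasurable
  · intro b _
    refine Integrable.of_bound (hin.comp (measurable_pi_apply b)).aestronglyMeasurable
      (radius d ε₀ L * ‖w‖) (Filter.Eventually.of_forall fun c => (norm_inner_le_norm _ _).trans ?_)
    gcongr
    exact norm_noisyGradDcmp_le hε hL.le _

end

section

variable {d : ℕ} {S : Type v} [MeasurableSpace S]

/-- Coordinatewise, second moment is variance plus squared mean. Variances of independent messages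
add up, which gives `R² / m`; the mean is an average of vectors of norm at most `L`. -/
lemma integral_norm_averagedGradient_sq_le {m : ℕ} (hm : 1 ≤ m) {expand : S → Vec d}
    (he : Measurable expand) {ε₀ L : ℝ} (hε : 0 < ε₀) (hL : 0 < L)
    (μ : Fin m → Measure (Compressed S)) [∀ b, IsProbabilityMeasure (μ b)] (g : Fin m → Vec d)
    (hg : ∀ b w, ∫ y, inner ℝ (noisyGradDcmp expand ε₀ L y) w ∂(μ b) = inner ℝ (g b) w)
    (hgL : ∀ b, ‖g b‖ ≤ L) :
    ∫ x, ‖averagedGradient expand ε₀ L x‖ ^ 2 ∂(Measure.pi μ) ≤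
      L ^ 2 + radius d ε₀ L ^ 2 / m := by
  have hm0 : (0 : ℝ) < m := by exact_mod_cast hm
  have hdm := measurable_noisyGradDcmp he ε₀ L
  have hbd : ∀ y, ‖noisyGradDcmp expand ε₀ L y‖ ≤ radius d ε₀ L :=
    fun y => norm_noisyGradDcmp_le hε hL.le y
  have hcoordm : ∀ i, Measurable fun y : Compressed S => noisyGradDcmp expand ε₀ L y i := fun i =>
    (by fun_prop : Measurable fun x : Vec d => x i).comp hdm
  have hcoord : ∀ i y, ‖noisyGradDcmp expand ε₀ L y i‖ ≤ radius d ε₀ L := fun i y =>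
    (PiLp.norm_apply_le _ i).trans (hbd y)
  have hmem : ∀ i b, MemLp (fun y : Compressed S => noisyGradDcmp expand ε₀ L y i) 2 (μ b) :=
    fun i b => MemLp.of_bound (hcoordm i).aestronglyMeasurable _
      (Filter.Eventually.of_forall (hcoord i))
  have hmean : ∀ i b, ∫ y, noisyGradDcmp expand ε₀ L y i ∂(μ b) = g b i := by
    intro i b
    have h := hg b (EuclideanSpace.single i 1)
    simpa [EuclideanSpace.inner_single_right] using h
  set Z : Fin d → (Fin m → Compressed S) → ℝ :=
    fun i => ∑ b, fun x => noisyGradDcmp expand ε₀ L (x b) i with hZ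
  have hZapp : ∀ i x, Z i x = ∑ b, noisyGradDcmp expand ε₀ L (x b) i := fun i x => by
    rw [hZ]; simp
  have hmemZ : ∀ i, MemLp (Z i) 2 (Measure.pi μ) := by
    intro i
    rw [hZ]
    refine memLp_finsetSum' _ fun b _ => MemLp.of_bound
      ((hcoordm i).comp (measurable_pi_apply b)).aestronglyMeasurable (radius d ε₀ L)
      (Filter.Eventually.of_forall fun x => hcoord i (x b))
  have hZmean : ∀ i, ∫ x, Z i x ∂(Measure.pi μ) = ∑ b, g b i := by
    intro i
    simp_rw [hZapp]
    rw [integral_finsetSum]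
    · refine Finset.sum_congr rfl fun b _ => ?_
      rw [← hmean i b]
      exact integral_comp_eval (μ := μ) (i := b) (hcoordm i).aestronglyMeasurable
    · intro b _
      exact Integrable.of_bound ((hcoordm i).comp (measurable_pi_apply b)).aestronglyMeasurable _
        (Filter.Eventually.of_forall fun x => hcoord i (x b))
  have hZsq : ∀ i, ∫ x, Z i x ^ 2 ∂(Measure.pi μ) ≤
      ∑ b, ∫ y, noisyGradDcmp expand ε₀ L y i ^ 2 ∂(μ b) + (∑ b, g b i) ^ 2 := by
    intro i
    have h1 := variance_eq_sub (hmemZ i)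
    rw [hZmean i] at h1
    have h2 : variance (Z i) (Measure.pi μ) = _ :=
      variance_sum_pi (μ := μ) (X := fun _ y => noisyGradDcmp expand ε₀ L y i) (hmem i)
    have h3 : ∀ b, variance (fun y => noisyGradDcmp expand ε₀ L y i) (μ b) ≤
        ∫ y, noisyGradDcmp expand ε₀ L y i ^ 2 ∂(μ b) := fun b => by
      have := variance_le_expectation_sq (μ := μ b) (hmem i b).aestronglyMeasurable
      simpa using this
    have h4 := Finset.sum_le_sum fun b (_ : b ∈ Finset.univ) => h3 b
    simp only [Pi.pow_apply] at h1
    linarith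
  have hsq : ∀ x, ‖averagedGradient expand ε₀ L x‖ ^ 2 = ((m : ℝ) ^ 2)⁻¹ * ∑ i, Z i x ^ 2 := by
    intro x
    rw [averagedGradient, norm_smul, mul_pow, norm_inv, Real.norm_natCast, inv_pow,
      EuclideanSpace.real_norm_sq_eq]
    congr 1
    refine Finset.sum_congr rfl fun i _ => ?_
    rw [hZapp]
    simp
  have htot : ∑ i, ∑ b, ∫ y, noisyGradDcmp expand ε₀ L y i ^ 2 ∂(μ b) ≤
      m * radius d ε₀ L ^ 2 := by
    rw [Finset.sum_comm]
    calc _ ≤ ∑ _b : Fin m, radius d ε₀ L ^ 2 := by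
          refine Finset.sum_le_sum fun b _ => ?_
          rw [← integral_finsetSum _ fun i _ => (hmem i b).integrable_sq]
          simp_rw [← EuclideanSpace.real_norm_sq_eq]
          calc _ ≤ ∫ _y, radius d ε₀ L ^ 2 ∂(μ b) := by
                refine integral_mono_of_nonneg (Filter.Eventually.of_forall fun y => sq_nonneg _)
                  (integrable_const _) (Filter.Eventually.of_forall fun y => ?_)
                exact pow_le_pow_left₀ (norm_nonneg _) (hbd y) 2
            _ = _ := by simp
      _ = _ := by simp
  have hmeans : ∑ i, (∑ b, g b i) ^ 2 ≤ (m * L) ^ 2 := by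
    have h1 : ‖∑ b, g b‖ ^ 2 = ∑ i, (∑ b, g b i) ^ 2 := by
      rw [EuclideanSpace.real_norm_sq_eq]; simp
    rw [← h1]
    refine pow_le_pow_left₀ (norm_nonneg _) ((norm_sum_le _ _).trans
      ((Finset.sum_le_sum fun b _ => hgL b).trans (le_of_eq ?_))) 2
    simp
  simp_rw [hsq]
  rw [integral_const_mul, integral_finsetSum _ fun i _ => (hmemZ i).integrable_sq,
    inv_mul_le_iff₀ (by positivity)]
  calc _ ≤ ∑ i, (∑ b, ∫ y, noisyGradDcmp expand ε₀ L y i ^ 2 ∂(μ b) + (∑ b, g b i) ^ 2) :=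
        Finset.sum_le_sum fun i _ => hZsq i
    _ ≤ m * radius d ε₀ L ^ 2 + (m * L) ^ 2 := by
        rw [Finset.sum_add_distrib]; exact add_le_add htot hmeans
    _ = _ := by field_simp; ring

end

/-! ### The revealed points are uniformly distributed -/

lemma card_mul_sum_perm {ι : Type*} [Fintype ι] [DecidableEq ι] (F : ι → ℝ) (a : ι) :
    (Fintype.card ι : ℝ) * ∑ π : Equiv.Perm ι, F (π a) =
      Fintype.card (Equiv.Perm ι) * ∑ q, F q := by
  have h1 : ∀ c : ι, ∑ π : Equiv.Perm ι, F (π c) = ∑ π : Equiv.Perm ι, F (π a) := by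
    intro c
    refine Fintype.sum_equiv (Equiv.mulRight (Equiv.swap a c)) _ _ fun π => ?_
    simp
  have h2 : ∑ c : ι, ∑ π : Equiv.Perm ι, F (π c) = Fintype.card (Equiv.Perm ι) * ∑ q, F q := by
    rw [Finset.sum_comm, Finset.sum_congr rfl fun π _ => Equiv.sum_comp π F]
    simp
  rw [← h2, Finset.sum_congr rfl fun c _ => h1 c]
  simp

/-- Each data point is selected in the same number of configurations as any other point of its
client, by the exchange involution, and a selection has `s` points. -/
lemma mul_sum_slotPoint {n r s : ℕ} (f : Fin n × Fin r → ℝ) :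
    (r : ℝ) * ∑ U : Fin n → ClientSample r s, ∑ q, f (slotPoint U q) =
      s * Fintype.card (Fin n → ClientSample r s) * ∑ z, f z := by
  classical
  have h1 : ∀ U : Fin n → ClientSample r s, ∑ q, f (slotPoint U q) =
      ∑ z : Fin n × Fin r, if z.2 ∈ (U z.1).1 then f z else 0 := by
    intro U
    rw [← Finset.sum_filter, ← Finset.sum_image (f := f) (g := slotPoint U)
      fun a _ b _ h => slotPoint_injective U h]
    refine Finset.sum_congr ?_ fun _ _ => rfl
    ext z
    simp [← exists_slotPoint_eq_iff]
  have h2 : ∀ (z : Fin n × Fin r) (c : Fin r),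
      (∑ U : Fin n → ClientSample r s, if z.2 ∈ (U z.1).1 then (1 : ℝ) else 0) =
        ∑ U : Fin n → ClientSample r s, if c ∈ (U z.1).1 then (1 : ℝ) else 0 := by
    intro z c
    refine Fintype.sum_equiv (selectionSwap_involutive z.1 z.2 c).toPerm _ _ fun U => ?_
    have := mem_selectionSwap z.1 z.2 c U (z.1, c)
    simp only [Equiv.swap_apply_right] at this
    simp only [Function.Involutive.coe_toPerm, this]
  have h3 : ∀ z : Fin n × Fin r,
      (r : ℝ) * (∑ U : Fin n → ClientSample r s, if z.2 ∈ (U z.1).1 then (1 : ℝ) else 0) =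
        s * Fintype.card (Fin n → ClientSample r s) := by
    intro z
    calc _ = ∑ c : Fin r, ∑ U : Fin n → ClientSample r s, if c ∈ (U z.1).1 then (1 : ℝ) else 0 := by
          rw [← Finset.sum_congr rfl fun c _ => h2 z c]; simp
      _ = _ := by
          rw [Finset.sum_comm]
          have : ∀ U : Fin n → ClientSample r s,
              (∑ c : Fin r, if c ∈ (U z.1).1 then (1 : ℝ) else 0) = s := by
            intro U
            rw [Finset.sum_ite_mem, Finset.univ_inter, Finset.sum_const, (U z.1).2]
            simp
          rw [Finset.sum_congr rfl fun U _ => this U]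
          simp [mul_comm]
  simp_rw [h1]
  rw [Finset.sum_comm, Finset.mul_sum, Finset.mul_sum]
  refine Finset.sum_congr rfl fun z _ => ?_
  rw [← h3 z, mul_assoc, Finset.sum_mul]
  congr 1
  refine Finset.sum_congr rfl fun U _ => ?_
  split_ifs <;> simp

lemma mean_slotPoint_perm {n r s : ℕ} (hn : 1 ≤ n) (hs : 1 ≤ s) (hsr : s ≤ r)
    (f : Fin n × Fin r → ℝ) (q : Fin (n * s)) :
    ((Fintype.card (Fin n → ClientSample r s) : ℝ) *
        Fintype.card (Equiv.Perm (Fin (n * s))))⁻¹ *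
      ∑ U : Fin n → ClientSample r s, ∑ π : Equiv.Perm (Fin (n * s)), f (slotPoint U (π q)) =
      (n * r : ℝ)⁻¹ * ∑ z, f z := by
  have := ClientSample.nonempty hsr
  have hA : (0 : ℝ) < Fintype.card (Fin n → ClientSample r s) := by
    exact_mod_cast Fintype.card_pos
  have hP : (0 : ℝ) < Fintype.card (Equiv.Perm (Fin (n * s))) := by
    exact_mod_cast Fintype.card_pos
  have hn0 : (0 : ℝ) < n := by exact_mod_cast hn
  have hs0 : (0 : ℝ) < s := by exact_mod_cast hs
  have hr0 : (0 : ℝ) < r := by exact_mod_cast hs.trans hsr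
  have h1 : ∀ U : Fin n → ClientSample r s,
      ∑ π : Equiv.Perm (Fin (n * s)), f (slotPoint U (π q)) =
        Fintype.card (Equiv.Perm (Fin (n * s))) / (n * s) * ∑ q, f (slotPoint U q) := by
    intro U
    have h := card_mul_sum_perm (fun q => f (slotPoint U q)) q
    rw [Fintype.card_fin] at h
    push_cast at h
    field_simp
    linarith
  rw [Finset.sum_congr rfl fun U _ => h1 U, ← Finset.mul_sum]
  have h2 := mul_sum_slotPoint (s := s) f
  generalize (∑ U : Fin n → ClientSample r s, ∑ q, f (slotPoint U q)) = Y at h2 ⊢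
  generalize (∑ z, f z) = W at h2 ⊢
  field_simp
  linarith

/-! ### Gradients of convex Lipschitz functions -/

section

variable {d : ℕ}

lemma norm_clip_le {L : ℝ} (hL : 0 < L) (g : Vec d) : ‖clip L g‖ ≤ L := by
  have h1 : 0 < max 1 (‖g‖ / L) := lt_max_of_lt_left one_pos
  rw [clip, norm_smul, norm_inv, Real.norm_eq_abs, abs_of_pos h1, inv_mul_le_iff₀ h1]
  have := mul_le_mul_of_nonneg_right (le_max_right 1 (‖g‖ / L)) hL.le
  rwa [div_mul_cancel₀ _ hL.ne'] at this

lemma clip_eq_self {L : ℝ} (hL : 0 < L) {g : Vec d} (hg : ‖g‖ ≤ L) : clip L g = g := by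
  rw [clip, max_eq_left (by rw [div_le_one hL]; exact hg), inv_one, one_smul]

lemma norm_gradient_le {f : Vec d → ℝ} {L : ℝ} (hL : 0 ≤ L) {U : Set (Vec d)} (hU : IsOpen U)
    (h : ∀ x ∈ U, ∀ y ∈ U, |f x - f y| ≤ L * ‖x - y‖) {θ : Vec d} (hθ : θ ∈ U) :
    ‖gradient f θ‖ ≤ L := by
  rw [gradient, LinearIsometryEquiv.norm_map]
  refine norm_fderiv_le_of_lip' ℝ hL ?_
  filter_upwards [hU.mem_nhds hθ] with x hx
  rw [Real.norm_eq_abs]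
  exact h x hx θ hθ

/-- The gradient inequality, from the slope of a convex function on the segment from `θ` to `x`.
Differentiability at `θ` is in the ambient space, so boundary points of `K` cause no trouble. -/
lemma sub_le_inner_gradient {f : Vec d → ℝ} {K : Set (Vec d)} (hf : ConvexOn ℝ K f) {θ x : Vec d}
    (hθ : θ ∈ K) (hx : x ∈ K) (hd : DifferentiableAt ℝ f θ) :
    f θ - f x ≤ inner ℝ (gradient f θ) (θ - x) := by
  have hc := (hf.comp_affineMap (AffineMap.lineMap θ x)).subset (s := Set.Icc (0 : ℝ) 1)
    (fun t ht => hf.1.lineMap_mem hθ hx ht) (convex_Icc 0 1)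
  have hd' : HasFDerivAt f (fderiv ℝ f θ) (AffineMap.lineMap θ x (0 : ℝ)) := by
    rw [AffineMap.lineMap_apply_zero]; exact hd.hasFDerivAt
  have hder := hd'.comp_hasDerivAt (0 : ℝ) (AffineMap.hasDerivAt_lineMap (a := θ) (b := x) (x := (0 : ℝ)))
  have h := hc.le_slope_of_hasDerivAt (Set.left_mem_Icc.2 zero_le_one)
    (Set.right_mem_Icc.2 zero_le_one) one_pos hder
  simp only [slope_def_field, Function.comp_apply, AffineMap.lineMap_apply_zero,
    AffineMap.lineMap_apply_one, sub_zero, div_one] at h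
  have e : inner ℝ (gradient f θ) (x - θ) = fderiv ℝ f θ (x - θ) := by
    rw [gradient, InnerProductSpace.toDual_symm_apply]
  rw [← neg_sub x θ, inner_neg_right, e]
  linarith

end

/-! ### One step of the projected stochastic gradient method -/

section

variable {d n r k s : ℕ} {X : Type u} {S : Type v} [MeasurableSpace S]

/-- The assumptions of the convergence theorem on a training task. -/
structure IsConvexTask (task : Task d X S) : Prop where
  one_le_dim : 1 ≤ d
  isProbabilityMeasure : IsProbabilityMeasure task.seedLaw
  measurable_expand : Measurable task.expand
  isIdeal : IsIdealPRG task.seedLaw task.expand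
  isClosed : IsClosed task.feasible
  convex : Convex ℝ task.feasible
  isBounded : Bornology.IsBounded task.feasible
  init_mem : task.init ∈ task.feasible
  L_pos : 0 < task.L
  ε₀_pos : 0 < task.ε₀
  convexOn_loss : ∀ x, ConvexOn ℝ task.feasible fun θ => task.loss θ x
  differentiableAt_loss : ∀ x, ∀ θ ∈ task.feasible,
    DifferentiableAt ℝ (fun θ' => task.loss θ' x) θ
  lipschitz_loss : ∀ x, ∃ U : Set (Vec d), IsOpen U ∧ task.feasible ⊆ U ∧
    ∀ θ₁ ∈ U, ∀ θ₂ ∈ U, |task.loss θ₁ x - task.loss θ₂ x| ≤ task.L * ‖θ₁ - θ₂‖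

lemma IsConvexTask.nonempty {task : Task d X S} (h : IsConvexTask task) :
    task.feasible.Nonempty := ⟨_, h.init_mem⟩

lemma norm_clippedGrad_le {task : Task d X S} (hL : 0 < task.L) (x : X) (θ : Vec d) :
    ‖clippedGrad task x θ‖ ≤ task.L := norm_clip_le hL _

/-- The Lipschitz bound on an open neighbourhood limits the gradient by `L`, also at boundary
points, so clipping does nothing and introduces no bias. -/
lemma IsConvexTask.clippedGrad_eq {task : Task d X S} (h : IsConvexTask task) (x : X) {θ : Vec d}
    (hθ : θ ∈ task.feasible) :
    clippedGrad task x θ = gradient (fun θ' => task.loss θ' x) θ := by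
  obtain ⟨U, hU, hKU, hlip⟩ := h.lipschitz_loss x
  exact clip_eq_self h.L_pos (norm_gradient_le h.L_pos.le hU hlip (hKU hθ))

/-- The mean of the clipped gradients over all data points. -/
noncomputable def meanGrad (task : Task d X S) (D : Dataset n r X) (θ : Vec d) : Vec d :=
  (n * r : ℝ)⁻¹ • ∑ z : Fin n × Fin r, clippedGrad task (D z.1 z.2) θ

lemma risk_eq (task : Task d X S) (D : Dataset n r X) (θ : Vec d) :
    risk task D θ = (n * r : ℝ)⁻¹ * ∑ z : Fin n × Fin r, task.loss θ (D z.1 z.2) := by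
  rw [risk, ← Finset.mul_sum, Fintype.sum_prod_type, mul_inv, mul_assoc]

lemma IsConvexTask.risk_sub_le {task : Task d X S} (h : IsConvexTask task) (D : Dataset n r X)
    {θ x : Vec d} (hθ : θ ∈ task.feasible) (hx : x ∈ task.feasible) :
    risk task D θ - risk task D x ≤ inner ℝ (meanGrad task D θ) (θ - x) := by
  rw [risk_eq, risk_eq, ← mul_sub, ← Finset.sum_sub_distrib, meanGrad, real_inner_smul_left,
    sum_inner]
  refine mul_le_mul_of_nonneg_left (Finset.sum_le_sum fun z _ => ?_) (by positivity)
  rw [h.clippedGrad_eq _ hθ]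
  exact sub_le_inner_gradient (h.convexOn_loss _) hθ hx (h.differentiableAt_loss _ θ hθ)

lemma IsConvexTask.abs_risk_sub_le {task : Task d X S} (h : IsConvexTask task) (hn : 1 ≤ n)
    (hr : 1 ≤ r) (D : Dataset n r X) {θ x : Vec d} (hθ : θ ∈ task.feasible)
    (hx : x ∈ task.feasible) : |risk task D θ - risk task D x| ≤ task.L * ‖θ - x‖ := by
  have hn0 : (0 : ℝ) < n := by exact_mod_cast hn
  have hr0 : (0 : ℝ) < r := by exact_mod_cast hr
  rw [risk_eq, risk_eq, ← mul_sub, ← Finset.sum_sub_distrib, abs_mul, abs_of_pos (by positivity),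
    inv_mul_le_iff₀ (by positivity)]
  refine (Finset.abs_sum_le_sum_abs _ _).trans ((Finset.sum_le_sum
    (g := fun _ => task.L * ‖θ - x‖) fun z _ => ?_).trans (le_of_eq ?_))
  · obtain ⟨U, hU, hKU, hlip⟩ := h.lipschitz_loss (D z.1 z.2)
    exact hlip θ (hKU hθ) x (hKU hx)
  · simp

lemma integral_iterationLaw (hk : k ≤ n) (hsr : s ≤ r) (task : Task d X S)
    [IsProbabilityMeasure task.seedLaw] (he : Measurable task.expand) (θ : Vec d)
    (D : Dataset n r X) {f : (Fin (k * s) → Compressed S) → ℝ} (hf : Measurable f) {c : ℝ}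
    (hc : ∀ m, |f m| ≤ c) :
    ∫ m, f m ∂(iterationLaw hk s task θ D) =
      ((Fintype.card (Fin n → ClientSample r s) : ℝ) *
        Fintype.card (Equiv.Perm (Fin (n * s))))⁻¹ *
      ∑ U : Fin n → ClientSample r s, ∑ π : Equiv.Perm (Fin (n * s)),
        ∫ m, f m ∂(Measure.pi fun b : Fin (k * s) =>
          msgLaw task.expand task.ε₀ task.L task.seedLaw
            (clippedGrad task (D (slotPoint U (π (Fin.castLE (Nat.mul_le_mul_right s hk) b))).1
              (slotPoint U (π (Fin.castLE (Nat.mul_le_mul_right s hk) b))).2) θ)) := by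
  have hprob : ∀ x, IsProbabilityMeasure (msgLaw task.expand task.ε₀ task.L task.seedLaw x) :=
    fun x => isProbabilityMeasure_msgLaw he _ _ _ x
  have hint : ∀ (μ : Measure (Fin (k * s) → Compressed S)) [IsFiniteMeasure μ], Integrable f μ :=
    fun μ _ => Integrable.of_bound hf.aestronglyMeasurable c (Filter.Eventually.of_forall hc)
  rw [iterationLaw_eq hk hsr task he, integral_smul_measure, integral_finsetSum_measure,
    ENNReal.toReal_inv, ENNReal.toReal_mul, ENNReal.toReal_natCast, ENNReal.toReal_natCast,
    smul_eq_mul]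
  · congr 1
    refine Finset.sum_congr rfl fun U _ => ?_
    rw [integral_finsetSum_measure fun π _ => hint _]
  · intro U _
    exact integrable_finsetSum_measure.2 fun π _ => hint _

lemma update_eq (task : Task d X S) (t : ℕ) (θ : Vec d) (m : Fin (k * s) → Compressed S) :
    update task t θ m = proj task.feasible
      (θ - task.stepSize t • averagedGradient task.expand task.ε₀ task.L m) := rfl

lemma IsConvexTask.integral_inner_averagedGradient {task : Task d X S} (h : IsConvexTask task)
    (hk : k ≤ n) (h1k : 1 ≤ k) (h1s : 1 ≤ s) (hsr : s ≤ r) (θ : Vec d) (D : Dataset n r X)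
    (w : Vec d) :
    ∫ m, inner ℝ (averagedGradient task.expand task.ε₀ task.L m) w
      ∂(iterationLaw hk s task θ D) = inner ℝ (meanGrad task D θ) w := by
  have := h.isProbabilityMeasure
  have he := h.measurable_expand
  have hks : 1 ≤ k * s := Nat.mul_pos h1k h1s
  have hks0 : ((k * s : ℕ) : ℝ) ≠ 0 := by exact_mod_cast (Nat.mul_pos h1k h1s).ne'
  have hprob : ∀ x, IsProbabilityMeasure (msgLaw task.expand task.ε₀ task.L task.seedLaw x) :=
    fun x => isProbabilityMeasure_msgLaw he _ _ _ x
  have hm := measurable_averagedGradient (m := k * s) he task.ε₀ task.L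
  rw [integral_iterationLaw hk hsr task he θ D
    (f := fun m => inner ℝ (averagedGradient task.expand task.ε₀ task.L m) w) (by fun_prop)
    (c := radius d task.ε₀ task.L * ‖w‖) fun m => (abs_real_inner_le_norm _ _).trans
      (mul_le_mul_of_nonneg_right (norm_averagedGradient_le hks h.ε₀_pos h.L_pos.le m)
        (norm_nonneg _))]
  have h1 : ∀ (U : Fin n → ClientSample r s) (π : Equiv.Perm (Fin (n * s))),
      ∫ m, inner ℝ (averagedGradient task.expand task.ε₀ task.L m) w
        ∂(Measure.pi fun b : Fin (k * s) => msgLaw task.expand task.ε₀ task.L task.seedLaw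
          (clippedGrad task (D (slotPoint U (π (Fin.castLE (Nat.mul_le_mul_right s hk) b))).1
            (slotPoint U (π (Fin.castLE (Nat.mul_le_mul_right s hk) b))).2) θ)) =
      ((k * s : ℕ) : ℝ)⁻¹ * ∑ b : Fin (k * s), inner ℝ
        (clippedGrad task (D (slotPoint U (π (Fin.castLE (Nat.mul_le_mul_right s hk) b))).1
          (slotPoint U (π (Fin.castLE (Nat.mul_le_mul_right s hk) b))).2) θ) w := by
    intro U π
    exact Camel.integral_inner_averagedGradient he h.ε₀_pos h.L_pos _ _
      (fun b w => integral_inner_noisyGradDcmp h.one_le_dim he h.isIdeal h.ε₀_pos h.L_pos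
        (norm_clippedGrad_le h.L_pos _ _) w) w
  simp_rw [h1]
  have h2 := fun q => mean_slotPoint_perm (s := s) (h1k.trans hk) h1s hsr
    (fun z : Fin n × Fin r => inner ℝ (clippedGrad task (D z.1 z.2) θ) w) q
  rw [meanGrad, real_inner_smul_left, sum_inner]
  generalize ((Fintype.card (Fin n → ClientSample r s) : ℝ) *
    Fintype.card (Equiv.Perm (Fin (n * s))))⁻¹ = A at h2 ⊢
  have h3 : ∀ U : Fin n → ClientSample r s, ∑ π : Equiv.Perm (Fin (n * s)),
      ((k * s : ℕ) : ℝ)⁻¹ * ∑ b : Fin (k * s), inner ℝ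
        (clippedGrad task (D (slotPoint U (π (Fin.castLE (Nat.mul_le_mul_right s hk) b))).1
          (slotPoint U (π (Fin.castLE (Nat.mul_le_mul_right s hk) b))).2) θ) w =
      ((k * s : ℕ) : ℝ)⁻¹ * ∑ b : Fin (k * s), ∑ π : Equiv.Perm (Fin (n * s)), inner ℝ
        (clippedGrad task (D (slotPoint U (π (Fin.castLE (Nat.mul_le_mul_right s hk) b))).1
          (slotPoint U (π (Fin.castLE (Nat.mul_le_mul_right s hk) b))).2) θ) w := fun U => by
    rw [← Finset.mul_sum, Finset.sum_comm]
  rw [Finset.sum_congr rfl fun U _ => h3 U, ← Finset.mul_sum, Finset.sum_comm, mul_left_comm,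
    Finset.mul_sum, Finset.sum_congr rfl fun b _ => h2 (Fin.castLE (Nat.mul_le_mul_right s hk) b),
    Finset.sum_const, Finset.card_univ, Fintype.card_fin, nsmul_eq_mul, ← mul_assoc,
    inv_mul_cancel₀ hks0, one_mul]

/-- The revealed messages are independent only after conditioning on selections and permutation; the
conditional bound is the same for all of these and hence survives the average. -/
lemma IsConvexTask.integral_norm_averagedGradient_sq_le {task : Task d X S}
    (h : IsConvexTask task) (hk : k ≤ n) (h1k : 1 ≤ k) (h1s : 1 ≤ s) (hsr : s ≤ r) (θ : Vec d)
    (D : Dataset n r X) :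
    ∫ m, ‖averagedGradient task.expand task.ε₀ task.L m‖ ^ 2 ∂(iterationLaw hk s task θ D) ≤
      gradBound d ((k : ℝ) * s) task.L task.ε₀ ^ 2 := by
  have := h.isProbabilityMeasure
  have he := h.measurable_expand
  have hks : 1 ≤ k * s := Nat.mul_pos h1k h1s
  have hks0 : (0 : ℝ) < (k : ℝ) * s := by exact_mod_cast (Nat.mul_pos h1k h1s)
  have hprob : ∀ x, IsProbabilityMeasure (msgLaw task.expand task.ε₀ task.L task.seedLaw x) :=
    fun x => isProbabilityMeasure_msgLaw he _ _ _ x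
  have hm := measurable_averagedGradient (m := k * s) he task.ε₀ task.L
  have hA := mixedLikelihood_const_pos (n := n) hsr
  have hne := ClientSample.nonempty hsr
  have hbound : task.L ^ 2 + radius d task.ε₀ task.L ^ 2 / (k * s : ℕ) ≤
      gradBound d ((k : ℝ) * s) task.L task.ε₀ ^ 2 := by
    rw [gradBound, mul_pow, Real.sq_sqrt (by positivity), mul_add, mul_one]
    have h1 := radius_sq_le (L := task.L) (ε₀ := task.ε₀) h.one_le_dim
    have h2 : task.L ^ 2 * (14 * d / (k * s) * ldpFactor task.ε₀ ^ 2) =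
        task.L ^ 2 * (14 * d) * ldpFactor task.ε₀ ^ 2 / (k * s) := by ring
    rw [h2]
    push_cast
    gcongr
  rw [integral_iterationLaw hk hsr task he θ D
    (f := fun m => ‖averagedGradient task.expand task.ε₀ task.L m‖ ^ 2) (by fun_prop)
    (c := radius d task.ε₀ task.L ^ 2) fun m => by
      rw [abs_of_nonneg (sq_nonneg _)]
      exact pow_le_pow_left₀ (norm_nonneg _)
        (norm_averagedGradient_le hks h.ε₀_pos h.L_pos.le m) 2]
  refine le_trans (mul_le_mul_of_nonneg_left (Finset.sum_le_sum fun U _ =>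
    Finset.sum_le_sum fun π _ => (Camel.integral_norm_averagedGradient_sq_le hks he h.ε₀_pos h.L_pos
      _ _ (fun b w => integral_inner_noisyGradDcmp h.one_le_dim he h.isIdeal h.ε₀_pos h.L_pos
        (norm_clippedGrad_le h.L_pos _ _) w) fun b => norm_clippedGrad_le h.L_pos _ _).trans
        hbound) hA.le) (le_of_eq ?_)
  have hA' : (0 : ℝ) < Fintype.card (Fin n → ClientSample r s) := by
    exact_mod_cast Fintype.card_pos
  have hP : (0 : ℝ) < Fintype.card (Equiv.Perm (Fin (n * s))) := by
    exact_mod_cast Fintype.card_pos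
  simp only [Finset.sum_const, Finset.card_univ, nsmul_eq_mul]
  field_simp

/-- The expected squared distance to a feasible point after one iteration. -/
lemma IsConvexTask.integral_norm_update_sub_sq_le {task : Task d X S} (h : IsConvexTask task)
    (hk : k ≤ n) (h1k : 1 ≤ k) (h1s : 1 ≤ s) (hsr : s ≤ r) (D : Dataset n r X) (t : ℕ)
    (hη : 0 ≤ task.stepSize t) {θ x : Vec d} (hθ : θ ∈ task.feasible) (hx : x ∈ task.feasible) :
    ∫ m, ‖update task t θ m - x‖ ^ 2 ∂(iterationLaw hk s task θ D) ≤
      ‖θ - x‖ ^ 2 - 2 * task.stepSize t * (risk task D θ - risk task D x) +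
        task.stepSize t ^ 2 * gradBound d ((k : ℝ) * s) task.L task.ε₀ ^ 2 := by
  have := h.isProbabilityMeasure
  have he := h.measurable_expand
  have hks : 1 ≤ k * s := Nat.mul_pos h1k h1s
  have hprob := isProbabilityMeasure_iterationLaw hk hsr task he θ D
  have hm := measurable_averagedGradient (m := k * s) he task.ε₀ task.L
  have hbd : ∀ m, ‖averagedGradient (m := k * s) task.expand task.ε₀ task.L m‖ ≤
      radius d task.ε₀ task.L := fun m => norm_averagedGradient_le hks h.ε₀_pos h.L_pos.le m
  set η := task.stepSize t
  have hpt : ∀ m, ‖update task t θ m - x‖ ^ 2 ≤ ‖θ - x‖ ^ 2 -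
      2 * η * inner ℝ (averagedGradient (m := k * s) task.expand task.ε₀ task.L m) (θ - x) +
      η ^ 2 * ‖averagedGradient (m := k * s) task.expand task.ε₀ task.L m‖ ^ 2 := by
    intro m
    -- The feasible point `x` is its own projection, so projecting does not increase the distance to
    -- it.
    have h1 := norm_proj_sub_proj_le h.nonempty h.isClosed h.convex
      (θ - η • averagedGradient task.expand task.ε₀ task.L m) x
    rw [proj_eq_self h.nonempty h.isClosed hx, ← update_eq] at h1
    refine (pow_le_pow_left₀ (norm_nonneg _) h1 2).trans (le_of_eq ?_)
    rw [sub_right_comm, norm_sub_sq_real, real_inner_smul_right, norm_smul, mul_pow,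
      Real.norm_eq_abs, sq_abs, real_inner_comm]
    ring
  have i1 : Integrable (fun m => inner ℝ
      (averagedGradient (m := k * s) task.expand task.ε₀ task.L m) (θ - x))
      (iterationLaw hk s task θ D) :=
    Integrable.of_bound (by fun_prop : Measurable _).aestronglyMeasurable
      (radius d task.ε₀ task.L * ‖θ - x‖) (Filter.Eventually.of_forall fun m =>
        (norm_inner_le_norm _ _).trans (mul_le_mul_of_nonneg_right (hbd m) (norm_nonneg _)))
  have i2 : Integrable (fun m =>
      ‖averagedGradient (m := k * s) task.expand task.ε₀ task.L m‖ ^ 2)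
      (iterationLaw hk s task θ D) :=
    Integrable.of_bound (by fun_prop : Measurable _).aestronglyMeasurable
      (radius d task.ε₀ task.L ^ 2) (Filter.Eventually.of_forall fun m => by
        rw [norm_pow, norm_norm]
        exact pow_le_pow_left₀ (norm_nonneg _) (hbd m) 2)
  have i3 : Integrable (fun m => ‖θ - x‖ ^ 2 - 2 * η *
      inner ℝ (averagedGradient (m := k * s) task.expand task.ε₀ task.L m) (θ - x))
      (iterationLaw hk s task θ D) := (integrable_const _).sub (i1.const_mul _)
  calc _ ≤ ∫ m, (‖θ - x‖ ^ 2 - 2 * η *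
          inner ℝ (averagedGradient (m := k * s) task.expand task.ε₀ task.L m) (θ - x) +
          η ^ 2 * ‖averagedGradient (m := k * s) task.expand task.ε₀ task.L m‖ ^ 2)
          ∂(iterationLaw hk s task θ D) :=
        integral_mono_of_nonneg (Filter.Eventually.of_forall fun m => sq_nonneg _)
          (i3.add (i2.const_mul _))
          (Filter.Eventually.of_forall hpt)
    _ = ‖θ - x‖ ^ 2 - 2 * η * inner ℝ (meanGrad task D θ) (θ - x) + η ^ 2 *
          ∫ m, ‖averagedGradient (m := k * s) task.expand task.ε₀ task.L m‖ ^ 2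
            ∂(iterationLaw hk s task θ D) := by
        rw [integral_add i3 (i2.const_mul _),
          integral_sub (integrable_const _) (i1.const_mul _), integral_const_mul,
          integral_const_mul, h.integral_inner_averagedGradient hk h1k h1s hsr]
        simp
    _ ≤ _ := by
        have h1 := h.risk_sub_le D hθ hx
        have h2 := h.integral_norm_averagedGradient_sq_le hk h1k h1s hsr θ D
        gcongr

end

/-! ### The last iterate of a stochastic gradient method: recursions for real sequences -/

/-- Summation of the one-step inequalities with step sizes `Δ / (G √t)`, from time `m` on. -/
lemma sum_sub_le_of_step {f b : ℕ → ℝ} {v G Δ : ℝ} (hG : 0 < G) (hΔ : 0 < Δ) (m : ℕ)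
    (hb : ∀ t, b t ≤ Δ ^ 2)
    (hstep : ∀ t, m ≤ t → b (t + 1) ≤ b t - 2 * (Δ / (G * √((t + 1 : ℕ) : ℝ))) * (f t - v) +
      (Δ / (G * √((t + 1 : ℕ) : ℝ))) ^ 2 * G ^ 2) (e : ℕ) (he : m ≤ e) :
    ∑ t ∈ Finset.Ico m e, (f t - v) + G / (2 * Δ) * (√(e : ℝ) * b e) ≤
      G / (2 * Δ) * (√(m : ℝ) * b m) + 3 / 2 * (G * Δ) * (√(e : ℝ) - √(m : ℝ)) := by
  induction e, he using Nat.le_induction with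
  | base => simp
  | succ e he ih =>
    rw [Finset.sum_Ico_succ_top he]
    have h1 := hstep e he
    set q := √((e + 1 : ℕ) : ℝ) with hq
    set p := √(e : ℝ) with hp
    have hq0 : 0 < q := Real.sqrt_pos.2 (by positivity)
    have hpq : p ≤ q := Real.sqrt_le_sqrt (by push_cast; linarith)
    have hqq : q ^ 2 = e + 1 := by rw [hq, Real.sq_sqrt (by positivity)]; push_cast; ring
    have hpp : p ^ 2 = e := by rw [hp, Real.sq_sqrt (by positivity)]
    have hp0 : 0 ≤ p := Real.sqrt_nonneg _
    -- `√(e + 1) - √e ≥ 1 / (2 √(e + 1))` lets the noise terms telescope. They contribute `G Δ` to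
    -- the coefficient `3 / 2`; summation by parts of the growing weights contributes the other
    -- half.
    have hinv : 1 / (2 * q) ≤ q - p := by
      rw [div_le_iff₀ (by positivity)]
      nlinarith [sq_nonneg (q - p)]
    have h2 : f e - v ≤ G / (2 * Δ) * (q * b e - q * b (e + 1)) + G * Δ * (1 / (2 * q)) := by
      have e1 : (Δ / (G * q)) ^ 2 * G ^ 2 = Δ ^ 2 / q ^ 2 := by field_simp
      rw [e1] at h1
      have h3 : 2 * (Δ / (G * q)) * (f e - v) ≤ b e - b (e + 1) + Δ ^ 2 / q ^ 2 := by linarith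
      have h4 := mul_le_mul_of_nonneg_left h3 (by positivity : 0 ≤ G * q / (2 * Δ))
      have e2 : G * q / (2 * Δ) * (2 * (Δ / (G * q)) * (f e - v)) = f e - v := by field_simp
      have e3 : G * q / (2 * Δ) * (b e - b (e + 1) + Δ ^ 2 / q ^ 2) =
          G / (2 * Δ) * (q * b e - q * b (e + 1)) + G * Δ * (1 / (2 * q)) := by field_simp
      rwa [e2, e3] at h4
    have h5 : G / (2 * Δ) * ((q - p) * b e) ≤ 1 / 2 * (G * Δ) * (q - p) := by
      have := mul_le_mul_of_nonneg_left (hb e) (sub_nonneg.2 hpq)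
      calc G / (2 * Δ) * ((q - p) * b e) ≤ G / (2 * Δ) * ((q - p) * Δ ^ 2) := by gcongr
        _ = _ := by field_simp
    have h6 : G * Δ * (1 / (2 * q)) ≤ G * Δ * (q - p) := by gcongr
    have h7 : G / (2 * Δ) * (q * b e - q * b (e + 1)) =
        G / (2 * Δ) * ((q - p) * b e) + G / (2 * Δ) * (p * b e) -
          G / (2 * Δ) * (q * b (e + 1)) := by ring
    linarith

/-- The bound for the last iterate, from the bounds for the averages over the last iterates. -/
lemma last_le_of_averages {f : ℕ → ℝ} {c : ℝ} (T : ℕ)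
    (h0 : ∑ t ∈ Finset.Ico 0 (T + 1), f t ≤ (T + 1) * c)
    (h : ∀ k ≤ T, ∑ t ∈ Finset.Ico (T - k) (T + 1), (f t - f (T - k)) ≤ (k + 1) * c) :
    f T ≤ c * (1 + harmonic T) := by
  have key : ∀ k ≤ T, f T ≤ (k + 1 : ℝ)⁻¹ * ∑ t ∈ Finset.Ico (T - k) (T + 1), f t +
      c * harmonic k := by
    intro k
    induction k with
    | zero => intro _; simp
    | succ k ih =>
      intro hk
      have h1 := ih (by omega)
      have h2 := h (k + 1) hk
      have e1 : ∑ t ∈ Finset.Ico (T - (k + 1)) (T + 1), f t =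
          f (T - (k + 1)) + ∑ t ∈ Finset.Ico (T - k) (T + 1), f t := by
        rw [Finset.sum_eq_sum_Ico_succ_bot (by omega)]
        congr 3
        omega
      rw [Finset.sum_sub_distrib, Finset.sum_const, Nat.card_Ico, nsmul_eq_mul,
        show T + 1 - (T - (k + 1)) = k + 2 by omega] at h2
      rw [harmonic_succ]
      push_cast at h2 ⊢
      set x := f (T - (k + 1))
      set Y := ∑ t ∈ Finset.Ico (T - k) (T + 1), f t
      rw [e1] at h2 ⊢
      -- Comparison of the averages over the last `k + 1` and the last `k + 2` terms: their
      -- difference is controlled by the regret against the oldest term `x`, which `h2` bounds.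
      -- Summing `c / (k + 1)` yields the harmonic number.
      have h3 : (k + 1 : ℝ)⁻¹ * Y ≤ (k + 1 + 1 : ℝ)⁻¹ * (x + Y) + c * (k + 1 : ℝ)⁻¹ := by
        rw [← sub_nonneg]
        have e2 : (k + 1 + 1 : ℝ)⁻¹ * (x + Y) + c * (k + 1 : ℝ)⁻¹ - (k + 1 : ℝ)⁻¹ * Y =
            ((k + 1 : ℝ) * (k + 1 + 1))⁻¹ * ((k + 1 + 1) * c - (Y - (k + 1) * x)) := by
          field_simp
          ring
        rw [e2]
        refine mul_nonneg (by positivity) ?_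
        linarith
      rw [mul_add]
      linarith
  have h1 := key T le_rfl
  rw [Nat.sub_self] at h1
  have h2 : (T + 1 : ℝ)⁻¹ * ∑ t ∈ Finset.Ico 0 (T + 1), f t ≤ c := by
    rw [inv_mul_le_iff₀ (by positivity)]; exact h0
  linarith

/-- The convergence rate of the last iterate, in terms of the expected suboptimalities `f t`, the
expected squared distances `a t` to a minimizer and `b m t` to the `m`-th iterate. -/
lemma last_iterate_le {f a : ℕ → ℝ} {b : ℕ → ℕ → ℝ} {G Δ : ℝ} (hG : 0 < G) (hΔ : 0 < Δ)
    (ha0 : ∀ t, 0 ≤ a t) (ha : ∀ t, a t ≤ Δ ^ 2) (hb0 : ∀ m t, 0 ≤ b m t)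
    (hb : ∀ m t, b m t ≤ Δ ^ 2) (hbm : ∀ m, b m m = 0)
    (hastep : ∀ t, a (t + 1) ≤ a t - 2 * (Δ / (G * √((t + 1 : ℕ) : ℝ))) * f t +
      (Δ / (G * √((t + 1 : ℕ) : ℝ))) ^ 2 * G ^ 2)
    (hbstep : ∀ m t, m ≤ t → b m (t + 1) ≤
      b m t - 2 * (Δ / (G * √((t + 1 : ℕ) : ℝ))) * (f t - f m) +
      (Δ / (G * √((t + 1 : ℕ) : ℝ))) ^ 2 * G ^ 2) (T : ℕ) :
    f T ≤ 3 / 2 * (G * Δ) / √((T + 1 : ℕ) : ℝ) * (2 + Real.log T) := by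
  set q := √((T + 1 : ℕ) : ℝ) with hq
  have hq0 : 0 < q := Real.sqrt_pos.2 (by positivity)
  have hqq : q * q = T + 1 := by rw [hq, Real.mul_self_sqrt (by positivity)]; push_cast; ring
  have hmain : f T ≤ 3 / 2 * (G * Δ) / q * (1 + harmonic T) := by
    refine last_le_of_averages T ?_ fun k hk => ?_
    · have h1 := sum_sub_le_of_step (v := 0) hG hΔ 0 ha (fun t _ => by simpa using hastep t)
        (T + 1) (Nat.zero_le _)
      simp only [sub_zero, Nat.cast_zero, Real.sqrt_zero, zero_mul, mul_zero, zero_add] at h1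
      rw [← hq] at h1
      have h2 : 0 ≤ G / (2 * Δ) * (q * a (T + 1)) := by
        have := ha0 (T + 1)
        positivity
      have e1 : (T + 1 : ℝ) * (3 / 2 * (G * Δ) / q) = 3 / 2 * (G * Δ) * q := by
        rw [← hqq]; field_simp
      rw [e1]
      linarith
    · have h1 := sum_sub_le_of_step (v := f (T - k)) hG hΔ (T - k) (hb (T - k))
        (hbstep (T - k)) (T + 1) (by omega)
      rw [hbm, mul_zero, mul_zero, zero_add, ← hq] at h1
      have h2 : 0 ≤ G / (2 * Δ) * (q * b (T - k) (T + 1)) := by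
        have := hb0 (T - k) (T + 1)
        positivity
      refine (le_trans (by linarith) h1).trans ?_
      set p := √((T - k : ℕ) : ℝ) with hp
      have hp0 : 0 ≤ p := Real.sqrt_nonneg _
      have hpp : p * p = T - k := by
        rw [hp, Real.mul_self_sqrt (by positivity), Nat.cast_sub hk]
      have hpq : p ≤ q := Real.sqrt_le_sqrt (by
        have : T - k ≤ T + 1 := by omega
        exact_mod_cast this)
      -- `q² - p q ≤ q² - p² = k + 1`, using `p ≤ q`.
      have h3 : (q - p) * q ≤ k + 1 := by nlinarith
      have h4 : q - p ≤ (k + 1) / q := by rwa [le_div_iff₀ hq0]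
      calc 3 / 2 * (G * Δ) * (q - p) ≤ 3 / 2 * (G * Δ) * ((k + 1) / q) := by gcongr
        _ = _ := by ring
  refine hmain.trans ?_
  have hh := harmonic_le_one_add_log T
  exact mul_le_mul_of_nonneg_left (by linarith) (by positivity)

/-! ### The laws of the models -/

section

variable {d n r k s : ℕ} {X : Type u} {S : Type v} [MeasurableSpace S]

/-- The law of the model after `t` iterations. -/
noncomputable def modelLaw (hk : k ≤ n) (s : ℕ) (task : Task d X S) (D : Dataset n r X) (t : ℕ) :
    Measure (Vec d) :=
  (runLaw hk s task D t).map Prod.snd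

/-- The model after iteration `t`, from the model before it and the randomness of the
iteration. -/
noncomputable def stepModel (hk : k ≤ n) (task : Task d X S) (D : Dataset n r X) (t : ℕ)
    (z : Vec d × Round n r s S) : Vec d :=
  update task t z.1 (revealed hk task D z.1 z.2)

/-- The joint law of `h (θ_m)` and `θ_{m+j}`. -/
noncomputable def pairLaw (hk : k ≤ n) (s : ℕ) (task : Task d X S) (D : Dataset n r X) (m : ℕ)
    (h : Vec d → Vec d) : ℕ → Measure (Vec d × Vec d)
  | 0 => (modelLaw hk s task D m).map fun θ => (h θ, θ)
  | j + 1 => ((pairLaw hk s task D m h j).prod (roundMeasure n r s task.seedLaw)).map fun z =>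
      (z.1.1, stepModel hk task D (m + j + 1) (z.1.2, z.2))

variable {task : Task d X S}

lemma IsConvexTask.measurable_stepModel (ht : IsConvexTask task) (hk : k ≤ n)
    (D : Dataset n r X) (t : ℕ) : Measurable (stepModel (s := s) hk task D t) := by
  have h1 := measurable_revealed (s := s) hk task ht.measurable_expand D
  have h2 := (measurable_update (k := k) (s := s) task ht.measurable_expand ht.nonempty
    ht.isClosed ht.convex t).comp (measurable_fst.prodMk h1)
  rw [Function.comp_def] at h2
  exact h2

lemma IsConvexTask.isProbabilityMeasure_modelLaw (ht : IsConvexTask task) (hk : k ≤ n)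
    (hsr : s ≤ r) (D : Dataset n r X) (t : ℕ) :
    IsProbabilityMeasure (modelLaw hk s task D t) := by
  have := ht.isProbabilityMeasure
  have := isProbabilityMeasure_runLaw hk hsr task ht.measurable_expand ht.nonempty ht.isClosed
    ht.convex D t
  exact Measure.isProbabilityMeasure_map measurable_snd.aemeasurable

lemma IsConvexTask.modelLaw_succ (ht : IsConvexTask task) (hk : k ≤ n) (hsr : s ≤ r)
    (D : Dataset n r X) (t : ℕ) :
    modelLaw hk s task D (t + 1) =
      ((modelLaw hk s task D t).prod (roundMeasure n r s task.seedLaw)).map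
        (stepModel hk task D (t + 1)) := by
  have := ht.isProbabilityMeasure
  have := isProbabilityMeasure_runLaw hk hsr task ht.measurable_expand ht.nonempty ht.isClosed
    ht.convex D t
  have := isProbabilityMeasure_roundMeasure (n := n) hsr task.seedLaw
  rw [modelLaw, modelLaw, runLaw_succ_eq_map, Measure.map_map measurable_snd
    (measurable_extendRun_revealed hk task ht.measurable_expand ht.nonempty ht.isClosed
      ht.convex D t)]
  nth_rewrite 2 [← Measure.map_id (μ := roundMeasure n r s task.seedLaw)]
  rw [Measure.map_prod_map _ _ measurable_snd measurable_id,
    Measure.map_map (ht.measurable_stepModel hk D _) (measurable_snd.prodMap measurable_id)]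
  rfl

lemma IsConvexTask.ae_mem_modelLaw (ht : IsConvexTask task) (hk : k ≤ n) (hsr : s ≤ r)
    (D : Dataset n r X) (t : ℕ) : ∀ᵐ θ ∂(modelLaw hk s task D t), θ ∈ task.feasible := by
  have hK : MeasurableSet {θ | θ ∈ task.feasible} := ht.isClosed.measurableSet
  cases t with
  | zero =>
    rw [modelLaw, runLaw, Measure.map_dirac' measurable_snd, ae_dirac_iff hK]
    exact ht.init_mem
  | succ t =>
    rw [ht.modelLaw_succ hk hsr, ae_map_iff (ht.measurable_stepModel hk D _).aemeasurable hK]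
    exact Filter.Eventually.of_forall fun z => proj_mem ht.nonempty ht.isClosed _

lemma IsConvexTask.measurable_pairStep (ht : IsConvexTask task) (hk : k ≤ n)
    (D : Dataset n r X) (t : ℕ) : Measurable fun z : (Vec d × Vec d) × Round n r s S =>
      (z.1.1, stepModel hk task D t (z.1.2, z.2)) := by
  have h := (ht.measurable_stepModel (s := s) hk D t).comp
    ((measurable_snd.comp measurable_fst).prodMk measurable_snd :
      Measurable fun z : (Vec d × Vec d) × Round n r s S => (z.1.2, z.2))
  rw [Function.comp_def] at h
  exact (measurable_fst.comp measurable_fst).prodMk h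

lemma IsConvexTask.isProbabilityMeasure_pairLaw (ht : IsConvexTask task) (hk : k ≤ n)
    (hsr : s ≤ r) (D : Dataset n r X) (m : ℕ) {h : Vec d → Vec d} (hh : Measurable h) (j : ℕ) :
    IsProbabilityMeasure (pairLaw hk s task D m h j) := by
  have := ht.isProbabilityMeasure
  have := ht.isProbabilityMeasure_modelLaw hk hsr D m
  have := isProbabilityMeasure_roundMeasure (n := n) hsr task.seedLaw
  induction j with
  | zero => exact Measure.isProbabilityMeasure_map (hh.prodMk measurable_id).aemeasurable
  | succ j ih =>
    exact Measure.isProbabilityMeasure_map (ht.measurable_pairStep hk D _).aemeasurable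

lemma IsConvexTask.pairLaw_map_fst (ht : IsConvexTask task) (hk : k ≤ n)
    (hsr : s ≤ r) (D : Dataset n r X) (m : ℕ) {h : Vec d → Vec d} (hh : Measurable h) (j : ℕ) :
    (pairLaw hk s task D m h j).map Prod.fst = (modelLaw hk s task D m).map h := by
  have := ht.isProbabilityMeasure
  have := isProbabilityMeasure_roundMeasure (n := n) hsr task.seedLaw
  induction j with
  | zero =>
    rw [pairLaw, Measure.map_map measurable_fst (hh.prodMk measurable_id')]
    rfl
  | succ j ih =>
    have := ht.isProbabilityMeasure_pairLaw hk hsr D m hh j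
    rw [pairLaw, Measure.map_map measurable_fst (ht.measurable_pairStep hk D _), ← ih]
    have e := Measure.fst_prod (μ := pairLaw hk s task D m h j)
      (ν := roundMeasure n r s task.seedLaw)
    nth_rewrite 2 [← e]
    rw [Measure.fst, Measure.map_map measurable_fst measurable_fst]
    rfl

lemma IsConvexTask.pairLaw_map_snd (ht : IsConvexTask task) (hk : k ≤ n)
    (hsr : s ≤ r) (D : Dataset n r X) (m : ℕ) {h : Vec d → Vec d} (hh : Measurable h) (j : ℕ) :
    (pairLaw hk s task D m h j).map Prod.snd = modelLaw hk s task D (m + j) := by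
  have := ht.isProbabilityMeasure
  have := isProbabilityMeasure_roundMeasure (n := n) hsr task.seedLaw
  induction j with
  | zero =>
    rw [pairLaw, Measure.map_map measurable_snd (hh.prodMk measurable_id')]
    exact Measure.map_id
  | succ j ih =>
    have := ht.isProbabilityMeasure_pairLaw hk hsr D m hh j
    rw [pairLaw, Measure.map_map measurable_snd (ht.measurable_pairStep hk D _), ← add_assoc,
      ht.modelLaw_succ hk hsr, ← ih]
    nth_rewrite 2 [← Measure.map_id (μ := roundMeasure n r s task.seedLaw)]
    rw [Measure.map_prod_map _ _ measurable_snd measurable_id,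
      Measure.map_map (ht.measurable_stepModel hk D _) (measurable_snd.prodMap measurable_id)]
    rfl

lemma IsConvexTask.ae_mem_pairLaw (ht : IsConvexTask task) (hk : k ≤ n) (hsr : s ≤ r)
    (D : Dataset n r X) (m : ℕ) {h : Vec d → Vec d} (hh : Measurable h)
    (hK : ∀ θ ∈ task.feasible, h θ ∈ task.feasible) (j : ℕ) :
    ∀ᵐ z ∂(pairLaw hk s task D m h j), z.1 ∈ task.feasible ∧ z.2 ∈ task.feasible := by
  have hm : MeasurableSet {θ | θ ∈ task.feasible} := ht.isClosed.measurableSet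
  have h1 : ∀ᵐ θ ∂((pairLaw hk s task D m h j).map Prod.fst), θ ∈ task.feasible := by
    rw [ht.pairLaw_map_fst hk hsr D m hh, ae_map_iff hh.aemeasurable hm]
    exact (ht.ae_mem_modelLaw hk hsr D m).mono hK
  have h2 : ∀ᵐ θ ∂((pairLaw hk s task D m h j).map Prod.snd), θ ∈ task.feasible := by
    rw [ht.pairLaw_map_snd hk hsr D m hh]
    exact ht.ae_mem_modelLaw hk hsr D _
  exact (ae_of_ae_map measurable_fst.aemeasurable h1).and
    (ae_of_ae_map measurable_snd.aemeasurable h2)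

/-! ### The risk and the squared distance, extended by the projection -/

/-- Nothing is known about the loss away from the feasible set. Composing with the projection gives
a function that is Lipschitz everywhere and agrees with the risk at feasible models, where the laws
are concentrated. -/
lemma IsConvexTask.continuous_risk_proj (ht : IsConvexTask task) (hn : 1 ≤ n) (hr : 1 ≤ r)
    (D : Dataset n r X) : Continuous fun θ => risk task D (proj task.feasible θ) := by
  refine (LipschitzWith.of_dist_le_mul (K := ⟨task.L, ht.L_pos.le⟩) fun x y => ?_).continuous
  rw [Real.dist_eq, dist_eq_norm]
  refine (ht.abs_risk_sub_le hn hr D (proj_mem ht.nonempty ht.isClosed x)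
    (proj_mem ht.nonempty ht.isClosed y)).trans ?_
  exact mul_le_mul_of_nonneg_left (norm_proj_sub_proj_le ht.nonempty ht.isClosed ht.convex x y)
    ht.L_pos.le

lemma IsConvexTask.norm_proj_sub_le_diam (ht : IsConvexTask task) (x y : Vec d) :
    ‖proj task.feasible x - proj task.feasible y‖ ≤ Metric.diam task.feasible := by
  rw [← dist_eq_norm]
  exact Metric.dist_le_diam_of_mem ht.isBounded (proj_mem ht.nonempty ht.isClosed x)
    (proj_mem ht.nonempty ht.isClosed y)

lemma IsConvexTask.integrable_risk_proj (ht : IsConvexTask task) (hn : 1 ≤ n) (hr : 1 ≤ r)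
    (D : Dataset n r X) {Y : Type*} [MeasurableSpace Y] (μ : Measure Y) [IsFiniteMeasure μ]
    {g : Y → Vec d} (hg : Measurable g) :
    Integrable (fun y => risk task D (proj task.feasible (g y))) μ := by
  refine Integrable.of_bound ((ht.continuous_risk_proj hn hr D).measurable.comp
    hg).aestronglyMeasurable (|risk task D task.init| + task.L * Metric.diam task.feasible)
    (Filter.Eventually.of_forall fun y => ?_)
  have h1 := ht.abs_risk_sub_le hn hr D (proj_mem ht.nonempty ht.isClosed (g y)) ht.init_mem
  have h2 := ht.norm_proj_sub_le_diam (g y) task.init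
  rw [proj_eq_self ht.nonempty ht.isClosed ht.init_mem] at h2
  have h3 := mul_le_mul_of_nonneg_left h2 ht.L_pos.le
  rw [Real.norm_eq_abs]
  have h4 := abs_sub_abs_le_abs_sub (risk task D (proj task.feasible (g y)))
    (risk task D task.init)
  linarith

/-- The expected squared distance under a joint law. -/
noncomputable def meanSqDist (task : Task d X S) (μ : Measure (Vec d × Vec d)) : ℝ :=
  ∫ z, ‖proj task.feasible z.2 - proj task.feasible z.1‖ ^ 2 ∂μ

lemma IsConvexTask.measurable_sqDist (ht : IsConvexTask task) :
    Measurable fun z : Vec d × Vec d =>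
      ‖proj task.feasible z.2 - proj task.feasible z.1‖ ^ 2 := by
  have h := continuous_proj ht.nonempty ht.isClosed ht.convex
  exact (by fun_prop : Continuous fun z : Vec d × Vec d =>
    ‖proj task.feasible z.2 - proj task.feasible z.1‖ ^ 2).measurable

lemma IsConvexTask.integrable_sqDist (ht : IsConvexTask task) {Y : Type*} [MeasurableSpace Y]
    (μ : Measure Y) [IsFiniteMeasure μ] {g : Y → Vec d × Vec d} (hg : Measurable g) :
    Integrable (fun y => ‖proj task.feasible (g y).2 - proj task.feasible (g y).1‖ ^ 2) μ := by
  refine Integrable.of_bound (ht.measurable_sqDist.comp hg).aestronglyMeasurable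
    (Metric.diam task.feasible ^ 2) (Filter.Eventually.of_forall fun y => ?_)
  rw [norm_pow, norm_norm]
  exact pow_le_pow_left₀ (norm_nonneg _) (ht.norm_proj_sub_le_diam _ _) 2

lemma meanSqDist_nonneg (task : Task d X S) (μ : Measure (Vec d × Vec d)) :
    0 ≤ meanSqDist task μ := integral_nonneg fun _ => sq_nonneg _

lemma IsConvexTask.meanSqDist_le (ht : IsConvexTask task) (μ : Measure (Vec d × Vec d))
    [IsProbabilityMeasure μ] : meanSqDist task μ ≤ Metric.diam task.feasible ^ 2 := by
  calc meanSqDist task μ ≤ ∫ _z, Metric.diam task.feasible ^ 2 ∂μ :=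
        integral_mono (ht.integrable_sqDist μ measurable_id) (integrable_const _) fun z =>
          pow_le_pow_left₀ (norm_nonneg _) (ht.norm_proj_sub_le_diam _ _) 2
    _ = _ := by simp

/-- The expected risk of the model after `t` iterations. -/
noncomputable def meanRisk (hk : k ≤ n) (s : ℕ) (task : Task d X S) (D : Dataset n r X) (t : ℕ) :
    ℝ :=
  ∫ θ, risk task D (proj task.feasible θ) ∂(modelLaw hk s task D t)

/-- A general `h` serves two comparison points at once: a constant `h` gives the distance to a
minimizer, and `h = id` the distance to the earlier iterate `θ_m`. -/
lemma IsConvexTask.meanSqDist_pairLaw_succ_le (ht : IsConvexTask task) (hk : k ≤ n)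
    (h1k : 1 ≤ k) (h1s : 1 ≤ s) (hsr : s ≤ r) (D : Dataset n r X) (m : ℕ) {h : Vec d → Vec d}
    (hh : Measurable h) (hK : ∀ θ ∈ task.feasible, h θ ∈ task.feasible) (j : ℕ)
    (hη : 0 ≤ task.stepSize (m + j + 1)) :
    meanSqDist task (pairLaw hk s task D m h (j + 1)) ≤
      meanSqDist task (pairLaw hk s task D m h j) - 2 * task.stepSize (m + j + 1) *
        (meanRisk hk s task D (m + j) -
          ∫ θ, risk task D (proj task.feasible (h θ)) ∂(modelLaw hk s task D m)) +
        task.stepSize (m + j + 1) ^ 2 * gradBound d ((k : ℝ) * s) task.L task.ε₀ ^ 2 := by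
  have := ht.isProbabilityMeasure
  have hn : 1 ≤ n := h1k.trans hk
  have hr : 1 ≤ r := h1s.trans hsr
  have := isProbabilityMeasure_roundMeasure (n := n) hsr task.seedLaw
  have hΛ := ht.isProbabilityMeasure_pairLaw hk hsr D m hh j
  set Λ := pairLaw hk s task D m h j with hΛdef
  set η := task.stepSize (m + j + 1)
  set G := gradBound d ((k : ℝ) * s) task.L task.ε₀
  have hstep := ht.measurable_pairStep (s := s) hk D (m + j + 1)
  have hcont := (ht.continuous_risk_proj hn hr D).measurable
  have hfst : ∫ z, risk task D (proj task.feasible z.1) ∂Λ =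
      ∫ θ, risk task D (proj task.feasible (h θ)) ∂(modelLaw hk s task D m) := by
    rw [← integral_map (φ := Prod.fst) measurable_fst.aemeasurable hcont.aestronglyMeasurable,
      ht.pairLaw_map_fst hk hsr D m hh, integral_map hh.aemeasurable hcont.aestronglyMeasurable]
  have hsnd : ∫ z, risk task D (proj task.feasible z.2) ∂Λ = meanRisk hk s task D (m + j) := by
    rw [← integral_map (φ := Prod.snd) measurable_snd.aemeasurable hcont.aestronglyMeasurable,
      ht.pairLaw_map_snd hk hsr D m hh, meanRisk]
  have i1 := ht.integrable_risk_proj hn hr D Λ measurable_fst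
  have i2 := ht.integrable_risk_proj hn hr D Λ measurable_snd
  have i3 := ht.integrable_sqDist Λ measurable_id
  simp only [id_eq] at i3
  have i4 : Integrable (fun z : Vec d × Vec d => 2 * η *
      (risk task D (proj task.feasible z.2) - risk task D (proj task.feasible z.1))) Λ :=
    (i2.sub i1).const_mul _
  have i5 : Integrable (fun z : Vec d × Vec d =>
      ‖proj task.feasible z.2 - proj task.feasible z.1‖ ^ 2 - 2 * η *
      (risk task D (proj task.feasible z.2) - risk task D (proj task.feasible z.1))) Λ :=
    i3.sub i4
  have hint := ht.integrable_sqDist (Λ.prod (roundMeasure n r s task.seedLaw)) hstep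
  rw [meanSqDist, pairLaw, integral_map hstep.aemeasurable
    ht.measurable_sqDist.aestronglyMeasurable, integral_prod _ hint]
  have hpt : ∀ᵐ z ∂Λ, ∫ ρ, ‖proj task.feasible (stepModel hk task D (m + j + 1) (z.2, ρ)) -
      proj task.feasible z.1‖ ^ 2 ∂(roundMeasure n r s task.seedLaw) ≤
      ‖proj task.feasible z.2 - proj task.feasible z.1‖ ^ 2 - 2 * η *
        (risk task D (proj task.feasible z.2) - risk task D (proj task.feasible z.1)) +
        η ^ 2 * G ^ 2 := by
    filter_upwards [ht.ae_mem_pairLaw hk hsr D m hh hK j] with z hz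
    have h1 := ht.integral_norm_update_sub_sq_le hk h1k h1s hsr D (m + j + 1) hη hz.2 hz.1
    have hmu : Measurable fun y : Fin (k * s) → Compressed S =>
        ‖update task (m + j + 1) z.2 y - z.1‖ ^ 2 := by
      have h2 := (measurable_update (k := k) (s := s) task ht.measurable_expand ht.nonempty
        ht.isClosed ht.convex (m + j + 1)).comp (measurable_prodMk_left (x := z.2))
      rw [Function.comp_def] at h2
      exact (h2.sub_const _).norm.pow_const 2
    rw [iterationLaw, integral_map
      (measurable_revealed_right hk task ht.measurable_expand D z.2).aemeasurable
      hmu.aestronglyMeasurable] at h1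
    have e : ∀ ρ : Round n r s S, proj task.feasible (stepModel hk task D (m + j + 1) (z.2, ρ)) =
        update task (m + j + 1) z.2 (revealed hk task D z.2 ρ) := fun ρ =>
      proj_eq_self ht.nonempty ht.isClosed (proj_mem ht.nonempty ht.isClosed _)
    simp_rw [e, proj_eq_self ht.nonempty ht.isClosed hz.1,
      proj_eq_self ht.nonempty ht.isClosed hz.2]
    exact h1
  calc _ ≤ ∫ z, (‖proj task.feasible z.2 - proj task.feasible z.1‖ ^ 2 - 2 * η *
        (risk task D (proj task.feasible z.2) - risk task D (proj task.feasible z.1)) +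
        η ^ 2 * G ^ 2) ∂Λ :=
        integral_mono_ae hint.integral_prod_left (i5.add (integrable_const _)) hpt
    _ = _ := by
        rw [integral_add i5 (integrable_const _), integral_sub i3 i4, integral_const_mul,
          integral_sub i2 i1, hfst, hsnd, meanSqDist]
        simp

end

/-! ### The convergence guarantee -/

section

variable {d n r k s : ℕ} {X : Type u} {S : Type v} [MeasurableSpace S] {task : Task d X S}

lemma IsConvexTask.risk_ae_eq (ht : IsConvexTask task) (hk : k ≤ n) (hsr : s ≤ r)
    (D : Dataset n r X) (T : ℕ) :
    (fun z => risk task D (proj task.feasible z.2)) =ᵐ[runLaw hk s task D T]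
      fun z => risk task D z.2 := by
  have h := ae_of_ae_map measurable_snd.aemeasurable (ht.ae_mem_modelLaw hk hsr D T)
  filter_upwards [h] with z hz
  rw [proj_eq_self ht.nonempty ht.isClosed hz]

lemma IsConvexTask.integrable_risk (ht : IsConvexTask task) (hk : k ≤ n) (h1k : 1 ≤ k)
    (h1s : 1 ≤ s) (hsr : s ≤ r) (D : Dataset n r X) (T : ℕ) :
    Integrable (fun z => risk task D z.2) (runLaw hk s task D T) := by
  have := ht.isProbabilityMeasure
  have := isProbabilityMeasure_runLaw hk hsr task ht.measurable_expand ht.nonempty ht.isClosed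
    ht.convex D T
  exact (ht.integrable_risk_proj (h1k.trans hk) (h1s.trans hsr) D (runLaw hk s task D T)
    measurable_snd).congr (ht.risk_ae_eq hk hsr D T)

lemma IsConvexTask.integral_risk_eq (ht : IsConvexTask task) (hk : k ≤ n) (h1k : 1 ≤ k)
    (h1s : 1 ≤ s) (hsr : s ≤ r) (D : Dataset n r X) (T : ℕ) :
    ∫ z, risk task D z.2 ∂(runLaw hk s task D T) = meanRisk hk s task D T := by
  rw [meanRisk, modelLaw, integral_map measurable_snd.aemeasurable (ht.continuous_risk_proj
    (h1k.trans hk) (h1s.trans hsr) D).measurable.aestronglyMeasurable]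
  exact (integral_congr_ae (ht.risk_ae_eq hk hsr D T)).symm

lemma ldpFactor_pos {ε₀ : ℝ} (hε : 0 < ε₀) : 0 < ldpFactor ε₀ := by
  have := Real.one_lt_exp_iff.2 hε
  exact div_pos (by linarith) (by linarith)

lemma gradBound_pos {m L ε₀ : ℝ} (hm : 0 < m) (hL : 0 < L) : 0 < gradBound d m L ε₀ := by
  unfold gradBound
  positivity

/-- `√(1 + a²) ≤ 1 + a` for `a ≥ 0`. -/
lemma gradBound_le {m L ε₀ : ℝ} (hm : 0 < m) (hL : 0 < L) (hε : 0 < ε₀) :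
    gradBound d m L ε₀ ≤ L * (1 + √(14 * d / m) * ldpFactor ε₀) := by
  have h := ldpFactor_pos hε
  unfold gradBound
  refine mul_le_mul_of_nonneg_left ?_ hL.le
  rw [Real.sqrt_le_left (by positivity)]
  have h1 : √(14 * d / m) ^ 2 = 14 * d / m := Real.sq_sqrt (by positivity)
  have h2 : 0 ≤ √(14 * d / m) * ldpFactor ε₀ := by positivity
  calc 1 + 14 * d / m * ldpFactor ε₀ ^ 2 = 1 + (√(14 * d / m) * ldpFactor ε₀) ^ 2 := by
        rw [mul_pow, h1]
    _ ≤ _ := by nlinarith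

lemma IsConvexTask.meanRisk_sub_le (ht : IsConvexTask task) (hk : k ≤ n) (h1k : 1 ≤ k)
    (h1s : 1 ≤ s) (hsr : s ≤ r) (D : Dataset n r X) (hdiam : 0 < Metric.diam task.feasible)
    (hη : ∀ t : ℕ, 1 ≤ t → task.stepSize t =
      Metric.diam task.feasible / (gradBound d ((k : ℝ) * s) task.L task.ε₀ * √t))
    {θopt : Vec d} (hopt : θopt ∈ task.feasible) (T : ℕ) :
    meanRisk hk s task D T - risk task D θopt ≤
      3 / 2 * (gradBound d ((k : ℝ) * s) task.L task.ε₀ * Metric.diam task.feasible) /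
        √((T + 1 : ℕ) : ℝ) * (2 + Real.log T) := by
  have hks0 : (0 : ℝ) < (k : ℝ) * s := by exact_mod_cast (Nat.mul_pos h1k h1s)
  have hG : 0 < gradBound d ((k : ℝ) * s) task.L task.ε₀ := gradBound_pos hks0 ht.L_pos
  have hη0 : ∀ t : ℕ, 0 ≤ task.stepSize (t + 1) := fun t => by
    rw [hη _ (Nat.le_add_left 1 t)]
    positivity
  have hpair : ∀ (m : ℕ) (h : Vec d → Vec d), Measurable h → ∀ j,
      IsProbabilityMeasure (pairLaw hk s task D m h j) := fun m h hh j =>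
    ht.isProbabilityMeasure_pairLaw hk hsr D m hh j
  -- The truncated `t - m` gives a harmless default for `t < m`, where only nonnegativity and the
  -- diameter bound are required.
  refine last_iterate_le (f := fun t => meanRisk hk s task D t - risk task D θopt)
    (a := fun t => meanSqDist task (pairLaw hk s task D 0 (fun _ => θopt) t))
    (b := fun m t => meanSqDist task (pairLaw hk s task D m id (t - m))) hG hdiam
    (fun t => meanSqDist_nonneg _ _) (fun t => ?_) (fun m t => meanSqDist_nonneg _ _)
    (fun m t => ?_) (fun m => ?_) (fun t => ?_) (fun m t hmt => ?_) T
  · have := hpair 0 (fun _ => θopt) measurable_const t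
    exact ht.meanSqDist_le _
  · have := hpair m id measurable_id (t - m)
    exact ht.meanSqDist_le _
  · rw [Nat.sub_self, pairLaw, meanSqDist, integral_map (by fun_prop)
      ht.measurable_sqDist.aestronglyMeasurable]
    simp
  · have h1 := ht.meanSqDist_pairLaw_succ_le hk h1k h1s hsr D 0 (h := fun _ => θopt)
      measurable_const (fun _ _ => hopt) t (hη0 _)
    have := ht.isProbabilityMeasure_modelLaw hk hsr D 0
    rw [integral_const, proj_eq_self ht.nonempty ht.isClosed hopt, zero_add,
      hη _ (Nat.le_add_left 1 t)] at h1
    simpa using h1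
  · obtain ⟨j, rfl⟩ := Nat.exists_eq_add_of_le hmt
    have h1 := ht.meanSqDist_pairLaw_succ_le hk h1k h1s hsr D m (h := id)
      measurable_id (fun _ h => h) j (hη0 _)
    rw [hη _ (Nat.le_add_left 1 (m + j))] at h1
    rw [show m + j + 1 - m = j + 1 by omega, show m + j - m = j by omega, sub_sub_sub_cancel_right]
    exact h1

/-- It amounts to `3 log 2 > 2`; this is where `T > 1` is needed. -/
lemma two_add_log_le {T : ℕ} (hT : 1 < T) : 2 + Real.log T ≤ 4 * Real.log T := by
  have h1 : Real.log 2 ≤ Real.log T := Real.log_le_log two_pos (by exact_mod_cast hT)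
  have h2 := Real.log_two_gt_d9
  linarith

theorem convergence_of_camel (ht : IsConvexTask task) (hk : k ≤ n) (h1k : 1 ≤ k) (h1s : 1 ≤ s)
    (hsr : s ≤ r) (D : Dataset n r X) {diam γ M A : ℝ} (hdiam : diam = Metric.diam task.feasible)
    (hM : M = totalPoints n r) (hγ : γ = samplingRate n r k s)
    (hA : A = √(14 * d / (γ * M)) * ldpFactor task.ε₀)
    (hη : ∀ t : ℕ, 1 ≤ t →
      task.stepSize t = diam / (gradBound d (γ * M) task.L task.ε₀ * √t))
    {θopt : Vec d} (hopt : θopt ∈ task.feasible) {T : ℕ} (hT : 1 < T) :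
    (∫ z, risk task D z.2 ∂(runLaw hk s task D T)) - risk task D θopt ≤
      6 * (task.L * diam * Real.log T / √T * (1 + A)) := by
  have hγM : γ * M = (k : ℝ) * s := by
    rw [hγ, hM, samplingRate_mul_totalPoints (h1k.trans hk) (h1s.trans hsr)]
  have hks0 : (0 : ℝ) < (k : ℝ) * s := by exact_mod_cast (Nat.mul_pos h1k h1s)
  rw [hγM] at hA hη
  rw [ht.integral_risk_eq hk h1k h1s hsr]
  -- With diameter zero the feasible set is a single point and both sides vanish; the general
  -- argument divides by the diameter.
  rcases (Metric.diam_nonneg (s := task.feasible)).eq_or_lt with h0 | h0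
  · have h1 : ∀ θ, risk task D (proj task.feasible θ) = risk task D θopt := by
      intro θ
      have h2 := ht.norm_proj_sub_le_diam θ θopt
      rw [← h0, proj_eq_self ht.nonempty ht.isClosed hopt] at h2
      rw [sub_eq_zero.1 (norm_le_zero_iff.1 h2)]
    have := ht.isProbabilityMeasure_modelLaw hk hsr D T
    rw [meanRisk]
    simp [h1, hdiam, ← h0]
  · subst hdiam
    refine (ht.meanRisk_sub_le hk h1k h1s hsr D h0 hη hopt T).trans ?_
    have hG := gradBound_le (d := d) hks0 ht.L_pos ht.ε₀_pos
    rw [← hA] at hG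
    have hG0 := gradBound_pos (d := d) (ε₀ := task.ε₀) hks0 ht.L_pos
    have hT0 : (0 : ℝ) < T := by positivity
    have hsq : √(T : ℝ) ≤ √((T + 1 : ℕ) : ℝ) := Real.sqrt_le_sqrt (by push_cast; linarith)
    have hsT : 0 < √(T : ℝ) := Real.sqrt_pos.2 hT0
    have hlog := two_add_log_le hT
    have hlog0 : 0 ≤ Real.log T := Real.log_natCast_nonneg T
    have hLA : 0 ≤ task.L * (1 + A) := hG0.le.trans hG
    set Δ := Metric.diam task.feasible
    set G := gradBound d ((k : ℝ) * s) task.L task.ε₀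
    calc 3 / 2 * (G * Δ) / √((T + 1 : ℕ) : ℝ) * (2 + Real.log T)
        ≤ 3 / 2 * (task.L * (1 + A) * Δ) / √(T : ℝ) * (4 * Real.log T) := by gcongr
      _ = _ := by ring

end

end Camel

/-! ### The three guarantees together -/

theorem mainTheorem1 :
    -- Privacy
    (∀ E : ℝ, 0 < E → ∀ δ₁ : ℝ, 0 < δ₁ → δ₁ < 1 →
      ∃ C : ℝ, 0 < C ∧
        ∀ (d n r k s : ℕ) (X : Type u) (S : Type v) [MeasurableSpace S]
          (task : Camel.Task d X S) (hk : k ≤ n),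
          1 ≤ k → 1 ≤ s → s ≤ r →
          MeasureTheory.IsProbabilityMeasure task.seedLaw → Measurable task.expand →
          task.feasible.Nonempty → IsClosed task.feasible → Convex ℝ task.feasible →
          task.init ∈ task.feasible →
          0 < task.L → 0 < task.ε₀ → task.ε₀ ≤ E →
          ∀ δ' : ℝ, 0 < δ' → δ' ≤ δ₁ →
          ∀ γ M ε' : ℝ, M = Camel.totalPoints n r → γ = Camel.samplingRate n r k s →
            ε' = Camel.shuffledEps C task.ε₀ δ' (γ * M) →
            (∀ (θ : Camel.Vec d) (α : ℝ), 1 < α →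
              Camel.IsRDP α (Camel.iterationRDP γ ε' α)
                (fun D : Camel.Dataset n r X => Camel.iterationLaw hk s task θ D)) ∧
            (∀ (T : ℕ) (δ : ℝ), 1 ≤ T → 0 < δ → δ < 1 →
              ∃ ε : ℝ, IsLeast (Camel.convertedEps T γ ε' δ '' Set.Ioi 1) ε ∧
                Camel.IsDP ε δ
                  (fun D : Camel.Dataset n r X => Camel.runLaw hk s task D T))) ∧
    -- Communication
    (∃ C : ℕ, ∀ (n k s p κ d e l : ℕ) [Fact p.Prime] (hk : k ≤ n),
      1 ≤ k → 1 ≤ s → 2 ≤ l →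
      ∀ (pub : Camel.Public p κ l (n * s)) (c : Camel.ProtocolCoins p l (n * s))
        (x : Fin (n * s) → Camel.Compressed (ZMod p))
        (digest : Fin κ → Bool) (θ : Fin d → Fin e → Bool),
        Camel.clientServerBits (Camel.iterationMsgs hk pub c x digest θ) ≤
          C * (l * (Camel.seedBits p + 1)) * (n * s) ∧
        Camel.interServerBits (Camel.iterationMsgs hk pub c x digest θ) ≤
          C * (l * (Camel.seedBits p + 1) + κ) * (n * s)) ∧
    -- Convergence
    (∃ C : ℝ, 0 < C ∧ ∀ c₀ : ℝ, 0 < c₀ → ∃ C' : ℝ, 0 < C' ∧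
      ∀ (d n r k s : ℕ) (X : Type u) (S : Type v) [MeasurableSpace S]
        (task : Camel.Task d X S) (hk : k ≤ n) (D : Camel.Dataset n r X),
        1 ≤ d → 1 ≤ k → 1 ≤ s → s ≤ r →
        MeasureTheory.IsProbabilityMeasure task.seedLaw → Measurable task.expand →
        Camel.IsIdealPRG task.seedLaw task.expand →
        IsClosed task.feasible → Convex ℝ task.feasible →
        Bornology.IsBounded task.feasible → task.init ∈ task.feasible →
        0 < task.L → 0 < task.ε₀ →
        (∀ x : X, ConvexOn ℝ task.feasible (fun θ => task.loss θ x) ∧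
          (∀ θ ∈ task.feasible, DifferentiableAt ℝ (fun θ' => task.loss θ' x) θ) ∧
          ∃ U : Set (Camel.Vec d), IsOpen U ∧ task.feasible ⊆ U ∧
            ∀ θ₁ ∈ U, ∀ θ₂ ∈ U, |task.loss θ₁ x - task.loss θ₂ x| ≤ task.L * ‖θ₁ - θ₂‖) →
        ∀ diam γ M A : ℝ, diam = Metric.diam task.feasible →
          M = Camel.totalPoints n r → γ = Camel.samplingRate n r k s →
          A = √(14 * d / (γ * M)) * Camel.ldpFactor task.ε₀ →
          (∀ t : ℕ, 1 ≤ t →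
            task.stepSize t = diam / (Camel.gradBound d (γ * M) task.L task.ε₀ * √t)) →
          ∀ θopt ∈ task.feasible, IsMinOn (Camel.risk task D) task.feasible θopt →
          ∀ T : ℕ, 1 < T →
            MeasureTheory.Integrable (fun z => Camel.risk task D z.2)
              (Camel.runLaw hk s task D T) ∧
            (∫ z, Camel.risk task D z.2 ∂(Camel.runLaw hk s task D T)) -
                Camel.risk task D θopt ≤
              C * (task.L * diam * Real.log T / √T * (1 + A)) ∧
            (c₀ ≤ A →
              (∫ z, Camel.risk task D z.2 ∂(Camel.runLaw hk s task D T)) -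
                  Camel.risk task D θopt ≤
                C' * (task.L * diam * Real.log T / √T * A))) := by
  refine ⟨fun E hE δ₁ h0 h1 => ⟨Camel.shuffleConst E δ₁, Camel.shuffleConst_pos hE h0 h1, ?_⟩,
    -- The second convergence constant comes from `1 + A ≤ (1 / c₀ + 1) A` for `A ≥ c₀`.
    ⟨100, ?_⟩, ⟨6, by norm_num, fun c₀ hc₀ => ⟨6 * (1 / c₀ + 1), by positivity, ?_⟩⟩⟩
  · intro d n r k s X S _ task hk h1k h1s hsr hprob he hne hc hconv _ _ hε hεE δ' hδ0 hδ1 γ M ε' hM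
      hγ hε'
    exact Camel.privacy_of_camel hE h0 h1 task hk h1k h1s hsr hprob he hne hc hconv hε hεE hδ0 hδ1
      hM hγ hε'
  · intro n k s p κ d e l _ hk h1k h1s hl pub c x digest θ
    exact Camel.communication_of_camel hk h1k h1s hl pub c x digest θ
  · intro d n r k s X S _ task hk D hd h1k h1s hsr hprob he hideal hc hconv hbdd hinit hL hε hloss
      diam γ M A hdiam hM hγ hA hη θopt hopt _ T hT
    have ht : Camel.IsConvexTask task :=
      ⟨hd, hprob, he, hideal, hc, hconv, hbdd, hinit, hL, hε, fun x => (hloss x).1,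
        fun x => (hloss x).2.1, fun x => (hloss x).2.2⟩
    have hmain := Camel.convergence_of_camel ht hk h1k h1s hsr D hdiam hM hγ hA hη hopt hT
    refine ⟨ht.integrable_risk hk h1k h1s hsr D T, hmain, fun hcA => hmain.trans ?_⟩
    have hA1 : 1 + A ≤ (1 / c₀ + 1) * A := by
      have : 1 ≤ A / c₀ := by rwa [le_div_iff₀ hc₀, one_mul]
      calc 1 + A ≤ A / c₀ + A := by linarith
        _ = _ := by ring
    have hpos : 0 ≤ task.L * diam * Real.log T / √T := by
      have h1 : 0 ≤ diam := hdiam ▸ Metric.diam_nonneg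
      have h2 : 0 ≤ Real.log T := Real.log_natCast_nonneg T
      positivity
    calc 6 * (task.L * diam * Real.log T / √T * (1 + A))
        ≤ 6 * (task.L * diam * Real.log T / √T * ((1 / c₀ + 1) * A)) := by gcongr
      _ = _ := by ring
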